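/- **Setting.** Let $(\Omega,\mathcal F,\mathbb P)$ be a probability space with a group $(\tau_x)_{x\in\mathbb R}$ of measure-preserving transformations ($\tau_0=\mathrm{id}$, $\tau_x\circ\tau_y=\tau_{x+y}$) under which $\mathbb P$ is ergodic. Let $V:\mathbb R\times\Omega\to\mathbb R$ be measurable with $V(x,\omega)=V(0,\tau_x\omega)$, with $V(\cdot,\omega)$ bounded and uniformly continuous for every $\omega$, and with $\inf_x V(x,\omega)=0$ and $\sup_x V(x,\omega)=1$ for $\mathbb P$-a.e. $\omega$. Let $\beta>0$. Let $G:\mathbb R\to[0,\infty)$ be continuous with $G(p)\to+\infty$ as $p\to\pm\infty$, and let $p_m<p_M<0$ and $0\le m<M$ be such that $G(0)=0$, $G(p_m)=m$, $G(p_M)=M$, and $G$ is strictly decreasing on $(-\infty,p_m]$, strictly increasing on $[p_m,p_M]$, strictly decreasing on $[p_M,0]$ and strictly increasing on $[0,\infty)$. Let $G_1$ and $G_3$ be the restrictions of $G$ to $(-\infty,p_m]$ and $[p_M,0]$. **Effective Hamiltonian.** For $\theta\in\mathbb R$ and $\omega\in\Omega$ let $u_\theta(\cdot,\cdot,\omega)$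 be the unique uniformly continuous viscosity solution on $[0,\infty)\times\mathbb R$ of $\partial_tu+G(\partial_xu)+\beta V(x,\omega)=0$, $u(0,x)=\theta x$. Let $\overline H^L(\theta)$ and $\overline H^U(\theta)$ be the $\mathbb P$-a.s. constant values of $\liminf_{t\to\infty}\frac{-u_\theta(t,0,\omega)}t$ and $\limsup_{t\to\infty}\frac{-u_\theta(t,0,\omega)}t$, and let $\overline H(\theta)$ be their common value when they are equal. **The function $\Lambda$.** Assume $\max\{\beta,M\}<m+\beta$. For $\lambda\in D:=[\beta,\infty)\cap(M,m+\beta)$ and $\mathbb P$-a.e. $\omega$, let $(\underline x_i)_{i\in\mathbb Z}$, $(\overline y_i)_{i\in\mathbb Z}$ be the bi-infinite real sequences determined by $$\underline x_i=\inf\{x\ge\overline y_{i-1}:\lambda-\beta V(x,\omega)\ge M\},\quad \overline y_i=\inf\{x\ge\underline x_i:\lambda-\beta V(x,\omega)<m\},\quad \underline x_{-1}\le0<\underline x_0,$$ and let $\underline f^\lambda_{1,3}(\cdot,\omega)$ be the Lipschitz function that vanishes at $0$ and has derivative $G_1^{-1}(\lambda-\beta V(x,\omega))$ on each $(\underline x_i,\overline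 y_i)$ and $G_3^{-1}(\lambda-\beta V(x,\omega))$ on each $(\overline y_i,\underline x_{i+1})$. Let $\underline\theta_{1,3}(\lambda)=\mathbb E[(\underline f^\lambda_{1,3})'_+(0,\omega)]$, where $'_+$ is the right derivative. Put $$\theta_{1,3}(\max\{\beta,M\})=\lim_{\lambda\downarrow\max\{\beta,M\}}\underline\theta_{1,3}(\lambda),\qquad \theta_{1,3}(m+\beta)=\lim_{\lambda\uparrow m+\beta}\underline\theta_{1,3}(\lambda),$$ $$\Lambda(\theta)=\inf\{\lambda\in(\max\{\beta,M\},m+\beta):\underline\theta_{1,3}(\lambda)\le\theta\}.$$ **Theorem.** Under these assumptions the following hold. 1. For all $\theta\in\mathbb R$ and $\omega\in\Omega$ the solution $u_\theta(\cdot,\cdot,\omega)$ exists and is unique. 2. For every $\lambda\in D$ and $\mathbb P$-a.e. $\omega$, $\lim_{x\to\pm\infty}\underline f^\lambda_{1,3}(x,\omega)/x=\underline\theta_{1,3}(\lambda)$. The function $\underline\theta_{1,3}$ is strictly decreasing and right-continuous on $D$. 3. For every $\theta\in\big(\theta_{1,3}(m+\beta),\theta_{1,3}(\max\{\beta,M\})\big)$,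 the liminf and the limsup above are $\mathbb P$-a.s. constant, and $$\overline H(\theta)=\overline H^L(\theta)=\overline H^U(\theta)=\Lambda(\theta).$$ 4. Consequently $\overline H$ is nonincreasing on $\big(\theta_{1,3}(m+\beta),\theta_{1,3}(\max\{\beta,M\})\big)$. -/

import Mathlib

open Set Filter MeasureTheory Topology

noncomputable section

/-! ### The setting -/

/-- The Hamiltonian `G` is continuous, coercive and double-well, with local minimum value `m` at
`pm`, local maximum value `M` at `pM` and absolute minimum value `0` at `0`. -/
structure IsDoubleWell (G : ℝ → ℝ) (m M pm pM : ℝ) : Prop where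
  continuous : Continuous G
  coercive_top : Tendsto G atTop atTop
  coercive_bot : Tendsto G atBot atTop
  pm_lt_pM : pm < pM
  pM_neg : pM < 0
  zero_le_m : 0 ≤ m
  m_lt_M : m < M
  map_zero : G 0 = 0
  map_pm : G pm = m
  map_pM : G pM = M
  anti_left : StrictAntiOn G (Iic pm)
  mono_left : StrictMonoOn G (Icc pm pM)
  anti_right : StrictAntiOn G (Icc pM 0)
  mono_right : StrictMonoOn G (Ici 0)

/-- `τ` is a group of measure-preserving transformations, indexed by `ℝ`, under which `P` is
ergodic: every measurable set which is invariant under all `τ x` has probability `0` or `1`. -/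
structure IsErgodicGroup {Ω : Type*} [MeasurableSpace Ω] (P : Measure Ω) (τ : ℝ → Ω → Ω) :
    Prop where
  zero : τ 0 = id
  comp : ∀ x y, τ x ∘ τ y = τ (x + y)
  preserving : ∀ x, MeasurePreserving (τ x) P P
  ergodic : ∀ A : Set Ω, MeasurableSet A → (∀ x, τ x ⁻¹' A = A) → P A = 0 ∨ P A = 1

/-- `V` is a measurable stationary potential with bounded and uniformly continuous sample paths
whose infimum and supremum over `ℝ` are almost surely `0` and `1`. -/
structure IsPotential {Ω : Type*} [MeasurableSpace Ω] (P : Measure Ω) (τ : ℝ → Ω → Ω)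
    (V : ℝ → Ω → ℝ) : Prop where
  measurable : Measurable (Function.uncurry V)
  stationary : ∀ x ω, V x ω = V 0 (τ x ω)
  uniformContinuous : ∀ ω, UniformContinuous fun x => V x ω
  bounded : ∀ ω, ∃ C, ∀ x, |V x ω| ≤ C
  normalized : ∀ᵐ ω ∂P, IsGLB (range fun x => V x ω) 0 ∧ IsLUB (range fun x => V x ω) 1

/-! ### Viscosity solutions and the effective Hamiltonian -/

/-- `u` is a uniformly continuous viscosity solution on `[0,∞) × ℝ` of
`∂ₜu + H(∂ₓu, x) = 0`, `u(0, ·) = g`. (The values `u t x` with `t < 0` play no role.) -/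
structure IsUCViscositySolution (H : ℝ → ℝ → ℝ) (g : ℝ → ℝ) (u : ℝ → ℝ → ℝ) : Prop where
  uniformContinuousOn : UniformContinuousOn (Function.uncurry u) (Ici 0 ×ˢ univ)
  initial : ∀ x, u 0 x = g x
  subsolution : ∀ t x : ℝ, 0 < t → ∀ φ : ℝ × ℝ → ℝ, ContDiff ℝ 1 φ →
    IsLocalMax (fun q => Function.uncurry u q - φ q) (t, x) →
      deriv (fun s => φ (s, x)) t + H (deriv (fun y => φ (t, y)) x) x ≤ 0
  supersolution : ∀ t x : ℝ, 0 < t → ∀ φ : ℝ × ℝ → ℝ, ContDiff ℝ 1 φ →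
    IsLocalMin (fun q => Function.uncurry u q - φ q) (t, x) →
      0 ≤ deriv (fun s => φ (s, x)) t + H (deriv (fun y => φ (t, y)) x) x

/-- `H(p, x, ω) = G(p) + β V(x, ω)`. -/
def hamiltonian {Ω : Type*} (G : ℝ → ℝ) (β : ℝ) (V : ℝ → Ω → ℝ) (ω : Ω) (p x : ℝ) : ℝ :=
  G p + β * V x ω

/-- `u_θ(·, ·, ω)`: the uniformly continuous viscosity solution of
`∂ₜu + G(∂ₓu) + β V(x, ω) = 0` with the initial condition `u(0, x) = θ x`. -/
def linearSolution {Ω : Type*} (G : ℝ → ℝ) (β : ℝ) (V : ℝ → Ω → ℝ) (θ : ℝ) (ω : Ω) :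
    ℝ → ℝ → ℝ :=
  Classical.epsilon (IsUCViscositySolution (hamiltonian G β V ω) fun x => θ * x)

/-- `liminf_{t → ∞} -u_θ(t, 0, ω) / t`; the quotient is bounded for `t ≥ 1` because `u_θ` is
uniformly continuous. -/
def lowerRate {Ω : Type*} (G : ℝ → ℝ) (β : ℝ) (V : ℝ → Ω → ℝ) (θ : ℝ) (ω : Ω) : ℝ :=
  liminf (fun t : ℝ => -linearSolution G β V θ ω t 0 / t) atTop

/-- `limsup_{t → ∞} -u_θ(t, 0, ω) / t`. -/
def upperRate {Ω : Type*} (G : ℝ → ℝ) (β : ℝ) (V : ℝ → Ω → ℝ) (θ : ℝ) (ω : Ω) : ℝ :=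
  limsup (fun t : ℝ => -linearSolution G β V θ ω t 0 / t) atTop

/-- The almost sure value of an almost surely constant random variable. -/
def essValue {Ω : Type*} [MeasurableSpace Ω] (P : Measure Ω) (X : Ω → ℝ) : ℝ :=
  Classical.epsilon fun c : ℝ => ∀ᵐ ω ∂P, X ω = c

/-- The lower effective Hamiltonian `H̄ᴸ(θ)`. -/
def effectiveL {Ω : Type*} [MeasurableSpace Ω] (P : Measure Ω) (G : ℝ → ℝ) (β : ℝ)
    (V : ℝ → Ω → ℝ) (θ : ℝ) : ℝ :=
  essValue P (lowerRate G β V θ)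

/-- The upper effective Hamiltonian `H̄ᵁ(θ)`. -/
def effectiveU {Ω : Type*} [MeasurableSpace Ω] (P : Measure Ω) (G : ℝ → ℝ) (β : ℝ)
    (V : ℝ → Ω → ℝ) (θ : ℝ) : ℝ :=
  essValue P (upperRate G β V θ)

open Classical in
/-- The effective Hamiltonian `H̄(θ)`: the common value of `H̄ᴸ(θ)` and `H̄ᵁ(θ)` when these are
equal (and `0`, a value without meaning, when they are not). -/
def effective {Ω : Type*} [MeasurableSpace Ω] (P : Measure Ω) (G : ℝ → ℝ) (β : ℝ)
    (V : ℝ → Ω → ℝ) (θ : ℝ) : ℝ :=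
  if effectiveL P G β V θ = effectiveU P G β V θ then effectiveL P G β V θ else 0

/-! ### The piecewise continuously differentiable correctors -/

/-- The bi-infinite sequences `x i` (lower `x`) and `y i` (upper `y`) of switching points of
`W = λ - β V(·, ω)`, given by their coupled recursion and by the anchoring condition. In `ℝ` the
empty set has no greatest lower bound, so the two infima are over nonempty sets. -/
structure IsSwitching (W : ℝ → ℝ) (m M : ℝ) (x y : ℤ → ℝ) : Prop where
  x_rec : ∀ i, IsGLB {z | y (i - 1) ≤ z ∧ M ≤ W z} (x i)
  y_rec : ∀ i, IsGLB {z | x i ≤ z ∧ W z < m} (y i)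
  anchor : x (-1) ≤ 0 ∧ 0 < x 0

/-- The union over `i` of the intervals `[x i, y i)`. (The switching sequences of `W` are
unique.) -/
def firstPhase (W : ℝ → ℝ) (m M : ℝ) : Set ℝ :=
  {z | ∃ x y : ℤ → ℝ, IsSwitching W m M x y ∧ ∃ i, z ∈ Ico (x i) (y i)}

/-- The inverse of the restriction `G₁` of `G` to `(-∞, pm]`. -/
def invG₁ (G : ℝ → ℝ) (pm : ℝ) : ℝ → ℝ := Function.invFunOn G (Iic pm)

/-- The inverse of the restriction `G₃` of `G` to `[pM, 0]`. -/
def invG₃ (G : ℝ → ℝ) (pM : ℝ) : ℝ → ℝ := Function.invFunOn G (Icc pM 0)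

open Classical in
/-- The derivative of the corrector: `G₁⁻¹(W z)` on the intervals `(x i, y i)` and `G₃⁻¹(W z)`
on the intervals `(y i, x (i+1))`, where `W = λ - β V(·, ω)`. At the switching points it is the
right derivative. -/
def slope13 (G : ℝ → ℝ) (m M pm pM : ℝ) (W : ℝ → ℝ) (z : ℝ) : ℝ :=
  if z ∈ firstPhase W m M then invG₁ G pm (W z) else invG₃ G pM (W z)

/-- The corrector at level `lam`, which vanishes at `0`. -/
def corrector13 {Ω : Type*} (G : ℝ → ℝ) (m M pm pM β : ℝ) (V : ℝ → Ω → ℝ) (lam : ℝ) (ω : Ω)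
    (x : ℝ) : ℝ :=
  ∫ z in (0 : ℝ)..x, slope13 G m M pm pM (fun s => lam - β * V s ω) z

/-- The mean slope of the corrector at level `lam`. -/
def theta13 {Ω : Type*} [MeasurableSpace Ω] (P : Measure Ω) (G : ℝ → ℝ) (m M pm pM β : ℝ)
    (V : ℝ → Ω → ℝ) (lam : ℝ) : ℝ :=
  ∫ ω, slope13 G m M pm pM (fun s => lam - β * V s ω) 0 ∂P

/-- The right limit of `theta13` at `max β M`. -/
def theta13Top {Ω : Type*} [MeasurableSpace Ω] (P : Measure Ω) (G : ℝ → ℝ) (m M pm pM β : ℝ)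
    (V : ℝ → Ω → ℝ) : ℝ :=
  Function.rightLim (theta13 P G m M pm pM β V) (max β M)

/-- The left limit of `theta13` at `m + β`. -/
def theta13Bot {Ω : Type*} [MeasurableSpace Ω] (P : Measure Ω) (G : ℝ → ℝ) (m M pm pM β : ℝ)
    (V : ℝ → Ω → ℝ) : ℝ :=
  Function.leftLim (theta13 P G m M pm pM β V) (m + β)

/-- The generalized inverse `Λ` of `theta13`. -/
def Lambda13 {Ω : Type*} [MeasurableSpace Ω] (P : Measure Ω) (G : ℝ → ℝ) (m M pm pM β : ℝ)
    (V : ℝ → Ω → ℝ) (θ : ℝ) : ℝ :=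
  sInf {lam | lam ∈ Ioo (max β M) (m + β) ∧ theta13 P G m M pm pM β V lam ≤ θ}

end

/-! The solution with initial slope θ is trapped between travelling profiles f(x) − λt, where f is
made of correctors. At level λ a corrector solves G(f') = W with W = λ − βV. It enters the branch G₁
when W climbs to M and leaves it for G₃ only when W falls below m. This hysteresis makes every kink
admissible. At a switch from G₁ to G₃ one has W = m, the slope jumps up from pm, and G ≥ m between
the two slopes, as a supersolution needs at a convex kink. At a switch from G₃ to G₁ one has W = M,
the slope jumps down from pM, and G ≤ M between the two slopes, as a subsolution needs at a concave
kink. So correctors are viscosity solutions although G is not convex (`exists_phaseSlope_limits`).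

Whether z is in the first phase depends on the path to the left of z and immediately to its right
(`phaseSet`). This description commutes with translations, and it agrees almost surely with the
switching sequences because W recurrently passes above M and below m in both directions
(`ae_isRecurrent`, `IsRecurrent.firstPhase_eq`). Hence the slope is a bounded stationary process,
and an ergodic theorem for the flow gives f(x)/x its almost sure limit (`ae_tendsto_corrector13`).
Raising λ enlarges the first phase and lowers the slope on each branch, and G₁⁻¹ ≤ pm < pM ≤ G₃⁻¹,
so the slope decreases strictly at every point (`phaseSlope_lt`). Right continuity in λ holds at all
but countably many z, which suffices after averaging over z in [0, 1].

For the rate (`exists_rate_bounds`), take l₁ < Λ(θ) < l₂, so that the mean slopes satisfy θ₂ < θ <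
θ₁. At a point z with l₂ − βV(z) < m both correctors use G₃, on which G decreases, so the one at
level l₁ has the larger slope. Following level l₁ left of z and level l₂ right of z gives a concave
kink at which G ≤ l₂ − βV. This is a subsolution of rate l₂, and it lies below θx + c because its
slope is θ₁ at −∞ and θ₂ at +∞. The opposite gluing is a supersolution of rate l₁ above θx − c.
Comparison puts −u(t, 0) between l₁t − c and l₂t + c, and l₁, l₂ may be taken arbitrarily close to
Λ(θ).

Comparison is proved by doubling variables on the whole half-plane. Existence is Perron's method
between the barriers θx ± Ct, where coercivity makes the supremum Lipschitz. -/

noncomputable section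

/-! ### Comparison principle for uniformly continuous viscosity solutions -/

/-- Viscosity subsolutions on `(0,∞) × ℝ` of `∂ₜu + H(∂ₓu, x) = 0`. -/
def IsViscositySub (H : ℝ → ℝ → ℝ) (u : ℝ → ℝ → ℝ) : Prop :=
  ∀ t x : ℝ, 0 < t → ∀ φ : ℝ × ℝ → ℝ, ContDiff ℝ 1 φ →
    IsLocalMax (fun q => Function.uncurry u q - φ q) (t, x) →
      deriv (fun s => φ (s, x)) t + H (deriv (fun y => φ (t, y)) x) x ≤ 0

/-- Viscosity supersolutions on `(0,∞) × ℝ` of `∂ₜu + H(∂ₓu, x) = 0`. -/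
def IsViscositySuper (H : ℝ → ℝ → ℝ) (u : ℝ → ℝ → ℝ) : Prop :=
  ∀ t x : ℝ, 0 < t → ∀ φ : ℝ × ℝ → ℝ, ContDiff ℝ 1 φ →
    IsLocalMin (fun q => Function.uncurry u q - φ q) (t, x) →
      0 ≤ deriv (fun s => φ (s, x)) t + H (deriv (fun y => φ (t, y)) x) x

/-- The half-plane is convex, so a segment can be cut into steps shorter than δ, each costing at
most ρ, and their number is affine in its length. With ρ = 1 this bounds growth; with ρ small it
controls the solutions near time 0. -/
lemma UniformContinuousOn.exists_affine_modulus {u : ℝ → ℝ → ℝ}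
    (hu : UniformContinuousOn (Function.uncurry u) (Ici 0 ×ˢ univ)) {ρ : ℝ} (hρ : 0 < ρ) :
    ∃ B, 0 ≤ B ∧ ∀ t s x y : ℝ, 0 ≤ t → 0 ≤ s →
      |u t x - u s y| ≤ ρ + B * (|t - s| + |x - y|) := by
  obtain ⟨δ, hδ, h⟩ := Metric.uniformContinuousOn_iff.1 hu ρ hρ
  refine ⟨ρ / δ, by positivity, fun t s x y ht hs => ?_⟩
  set d := |t - s| + |x - y| with hd
  have hd0 : 0 ≤ d := by positivity
  set N : ℕ := ⌊d / δ⌋₊ + 1 with hN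
  have hN0 : (0 : ℝ) < N := by positivity
  have hdN : d < δ * N := by
    have := Nat.lt_floor_add_one (d / δ)
    rw [div_lt_iff₀ hδ] at this
    push_cast [hN]; linarith
  have hNd : (N : ℝ) ≤ d / δ + 1 := by
    push_cast [hN]
    linarith [Nat.floor_le (div_nonneg hd0 hδ.le)]
  let f : ℕ → ℝ := fun k => u (s + (k / N : ℝ) * (t - s)) (y + (k / N : ℝ) * (x - y))
  have hstep : ∀ k ∈ Finset.range N, |f (k + 1) - f k| ≤ ρ := by
    intro k hk
    have hk' : (k : ℝ) + 1 ≤ N := by exact_mod_cast Finset.mem_range.1 hk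
    have key : ∀ r : ℝ, 0 ≤ r → r ≤ 1 → 0 ≤ s + r * (t - s) := fun r h0 h1 => by
      nlinarith
    have h1 : dist (s + ((k + 1 : ℕ) / N : ℝ) * (t - s), y + ((k + 1 : ℕ) / N : ℝ) * (x - y))
        (s + (k / N : ℝ) * (t - s), y + (k / N : ℝ) * (x - y)) < δ := by
      rw [Prod.dist_eq, max_lt_iff, Real.dist_eq, Real.dist_eq]
      have e1 : s + ((k + 1 : ℕ) / N : ℝ) * (t - s) - (s + (k / N : ℝ) * (t - s))
          = (t - s) / N := by push_cast; field_simp; ring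
      have e2 : y + ((k + 1 : ℕ) / N : ℝ) * (x - y) - (y + (k / N : ℝ) * (x - y))
          = (x - y) / N := by push_cast; field_simp; ring
      have a1 := abs_nonneg (t - s)
      have a2 := abs_nonneg (x - y)
      rw [e1, e2, abs_div, abs_div, abs_of_pos hN0, div_lt_iff₀ hN0, div_lt_iff₀ hN0]
      constructor <;> linarith
    have := h _ ⟨key _ (by positivity) (by rw [div_le_one hN0]; push_cast; linarith), mem_univ _⟩ _
      ⟨key _ (by positivity) (by rw [div_le_one hN0]; linarith), mem_univ _⟩ h1
    exact this.le
  have e0 : f 0 = u s y := by simp [f]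
  have e1 : f N = u t x := by
    have : (N / N : ℝ) = 1 := div_self hN0.ne'
    simp [f]
  calc |u t x - u s y| = |∑ k ∈ Finset.range N, (f (k + 1) - f k)| := by
        rw [Finset.sum_range_sub, e0, e1]
    _ ≤ ∑ k ∈ Finset.range N, |f (k + 1) - f k| := Finset.abs_sum_le_sum_abs _ _
    _ ≤ ∑ _k ∈ Finset.range N, ρ := Finset.sum_le_sum hstep
    _ = N * ρ := by simp
    _ ≤ (d / δ + 1) * ρ := by gcongr
    _ = ρ + ρ / δ * d := by ring

/-- The doubled functional of the comparison proof. -/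
def doubling (u v : ℝ → ℝ → ℝ) (ε c μ η : ℝ) (z : (ℝ × ℝ) × (ℝ × ℝ)) : ℝ :=
  u z.1.1 z.1.2 - v z.2.1 z.2.2 - ((z.1.2 - z.2.2) ^ 2 + (z.1.1 - z.2.1) ^ 2) / ε
    - c * z.1.1 - μ * z.1.1 ^ 2 - η * z.1.2 ^ 2

/-- With the second point frozen, the penalties form a smooth function of the first point that
touches `u` from above, up to a constant. -/
lemma sub_jet_of_isMax {H : ℝ → ℝ → ℝ} {u v : ℝ → ℝ → ℝ} (hsub : IsViscositySub H u)
    {ε c μ η t x s y : ℝ} (ht : 0 < t) (hs : 0 ≤ s)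
    (hmax : ∀ z : (ℝ × ℝ) × (ℝ × ℝ), 0 ≤ z.1.1 → 0 ≤ z.2.1 →
      doubling u v ε c μ η z ≤ doubling u v ε c μ η ((t, x), (s, y))) :
    2 * (t - s) / ε + c + 2 * μ * t + H (2 * (x - y) / ε + 2 * η * x) x ≤ 0 := by
  have := hsub t x ht
    (fun q => ((q.2 - y) ^ 2 + (q.1 - s) ^ 2) / ε + c * q.1 + μ * q.1 ^ 2 + η * q.2 ^ 2)
    (by fun_prop) (by
      filter_upwards [(continuous_fst.tendsto (t, x)).eventually (lt_mem_nhds ht)] with q hq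
      have := hmax (q, (s, y)) (le_of_lt hq) hs
      simp only [doubling] at this
      simp only [Function.uncurry]
      linarith)
  have d1 : HasDerivAt (fun τ => ((x - y) ^ 2 + (τ - s) ^ 2) / ε + c * τ + μ * τ ^ 2 + η * x ^ 2)
      (2 * (t - s) / ε + c + 2 * μ * t) t := by
    have h := (((((hasDerivAt_id t).sub_const s).pow 2).const_add ((x - y) ^ 2)).div_const ε).add
      ((hasDerivAt_id t).const_mul c) |>.add (((hasDerivAt_id t).pow 2).const_mul μ)
      |>.add_const (η * x ^ 2)
    exact h.congr_deriv (by simp; ring)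
  have d2 : HasDerivAt (fun ξ => ((ξ - y) ^ 2 + (t - s) ^ 2) / ε + c * t + μ * t ^ 2 + η * ξ ^ 2)
      (2 * (x - y) / ε + 2 * η * x) x := by
    have h := ((((((hasDerivAt_id x).sub_const y).pow 2).add_const ((t - s) ^ 2)).div_const
      ε).add_const (c * t) |>.add_const (μ * t ^ 2)).add (((hasDerivAt_id x).pow 2).const_mul η)
    exact h.congr_deriv (by simp; ring)
  rw [d1.deriv, d2.deriv] at this
  exact this

lemma super_jet_of_isMax {H : ℝ → ℝ → ℝ} {u v : ℝ → ℝ → ℝ} (hsup : IsViscositySuper H v)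
    {ε c μ η t x s y : ℝ} (ht : 0 ≤ t) (hs : 0 < s)
    (hmax : ∀ z : (ℝ × ℝ) × (ℝ × ℝ), 0 ≤ z.1.1 → 0 ≤ z.2.1 →
      doubling u v ε c μ η z ≤ doubling u v ε c μ η ((t, x), (s, y))) :
    0 ≤ 2 * (t - s) / ε + H (2 * (x - y) / ε) y := by
  have := hsup s y hs
    (fun q => -(((x - q.2) ^ 2 + (t - q.1) ^ 2) / ε))
    (by fun_prop) (by
      filter_upwards [(continuous_fst.tendsto (s, y)).eventually (lt_mem_nhds hs)] with q hq
      have := hmax ((t, x), q) ht (le_of_lt hq)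
      simp only [doubling] at this
      simp only [Function.uncurry]
      linarith)
  have d1 : HasDerivAt (fun τ => -(((x - y) ^ 2 + (t - τ) ^ 2) / ε)) (2 * (t - s) / ε) s := by
    have h := (((((hasDerivAt_id s).const_sub t).pow 2).const_add ((x - y) ^ 2)).div_const ε).neg
    exact h.congr_deriv (by simp; ring)
  have d2 : HasDerivAt (fun ξ => -(((x - ξ) ^ 2 + (t - s) ^ 2) / ε)) (2 * (x - y) / ε) y := by
    have h := (((((hasDerivAt_id y).const_sub x).pow 2).add_const ((t - s) ^ 2)).div_const ε).neg
    exact h.congr_deriv (by simp; ring)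
  rw [d1.deriv, d2.deriv] at this
  exact this

lemma sq_abs_add_abs_div_le {ε : ℝ} (hε : 0 < ε) (a b : ℝ) :
    (|a| + |b|) ^ 2 / (2 * ε) ≤ (b ^ 2 + a ^ 2) / ε := by
  rw [div_le_div_iff₀ (by positivity) hε, ← sq_abs a, ← sq_abs b]
  nlinarith [mul_nonneg hε.le (sq_nonneg (|a| - |b|))]

lemma div_mul_le_div_eight {δ a b : ℝ} (hδ : 0 < δ) (ha : 0 ≤ a) (hb : b ≤ a) :
    δ / (8 * (1 + a)) * b ≤ δ / 8 := by
  rw [div_mul_eq_mul_div, div_le_div_iff₀ (by positivity) (by positivity)]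
  nlinarith

/-- Because u ≤ v at time 0, the difference grows at most linearly in t and in the distance of the
two points, and not at all in x. Completing squares against the penalties then bounds all of them.
The term μt² thus replaces a finite time horizon. -/
lemma doubling_bound {u v : ℝ → ℝ → ℝ} {B ε c μ η : ℝ} (hB : 0 ≤ B) (hε : 0 < ε) (hc : 0 ≤ c)
    (hμ : 0 < μ)
    (hu : ∀ t s x y : ℝ, 0 ≤ t → 0 ≤ s → |u t x - u s y| ≤ 1 + B * (|t - s| + |x - y|))
    (hv : ∀ t s x y : ℝ, 0 ≤ t → 0 ≤ s → |v t x - v s y| ≤ 1 + B * (|t - s| + |x - y|))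
    (h0 : ∀ x, u 0 x ≤ v 0 x) {t x s y : ℝ} (ht : 0 ≤ t) (hs : 0 ≤ s)
    (hpos : 0 ≤ doubling u v ε c μ η ((t, x), (s, y))) :
    (|t - s| + |x - y| - 4 * B * ε) ^ 2 / (4 * ε) + μ / 2 * (t - 2 * B / μ) ^ 2 + μ / 2 * t ^ 2
      + (|t - s| + |x - y|) ^ 2 / (4 * ε) + η * x ^ 2 ≤ 2 + 2 * B ^ 2 / μ + 4 * B ^ 2 * ε := by
  set r := |t - s| + |x - y| with hr
  have h1 := le_of_abs_le (hu t 0 x x ht le_rfl)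
  have h2 := le_of_abs_le (hv 0 s x y le_rfl hs)
  simp only [doubling] at hpos
  rw [sub_zero, sub_self, abs_zero, add_zero, abs_of_nonneg ht] at h1
  rw [zero_sub, abs_neg, abs_of_nonneg hs] at h2
  have h3 : s ≤ t + |t - s| := by linarith [neg_abs_le (t - s)]
  have h4 := h0 x
  have h5 : r ^ 2 / (2 * ε) ≤ ((x - y) ^ 2 + (t - s) ^ 2) / ε := sq_abs_add_abs_div_le hε _ _
  have h6 : B * (s + |x - y|) ≤ B * (t + r) := by
    apply mul_le_mul_of_nonneg_left _ hB; linarith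
  have hct : 0 ≤ c * t := by positivity
  have hBr : 0 ≤ B * r := by positivity
  have e1 : (r - 4 * B * ε) ^ 2 / (4 * ε) + r ^ 2 / (4 * ε)
      = r ^ 2 / (2 * ε) - 2 * (B * r) + 4 * B ^ 2 * ε := by
    field_simp; ring
  have e2 : μ / 2 * (t - 2 * B / μ) ^ 2 + μ / 2 * t ^ 2 = μ * t ^ 2 - 2 * (B * t) + 2 * B ^ 2 / μ := by
    field_simp; ring
  linarith

lemma exists_max_doubling {u v : ℝ → ℝ → ℝ} {B ε c μ η : ℝ} (hB : 0 ≤ B) (hε : 0 < ε) (hc : 0 ≤ c)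
    (hμ : 0 < μ) (hη : 0 < η)
    (hucont : ContinuousOn (Function.uncurry u) (Ici 0 ×ˢ univ))
    (hvcont : ContinuousOn (Function.uncurry v) (Ici 0 ×ˢ univ))
    (hu : ∀ t s x y : ℝ, 0 ≤ t → 0 ≤ s → |u t x - u s y| ≤ 1 + B * (|t - s| + |x - y|))
    (hv : ∀ t s x y : ℝ, 0 ≤ t → 0 ≤ s → |v t x - v s y| ≤ 1 + B * (|t - s| + |x - y|))
    (h0 : ∀ x, u 0 x ≤ v 0 x) {z₀ : (ℝ × ℝ) × (ℝ × ℝ)} (hz₁ : 0 ≤ z₀.1.1) (hz₂ : 0 ≤ z₀.2.1)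
    (hz₀ : 0 ≤ doubling u v ε c μ η z₀) :
    ∃ t x s y : ℝ, 0 ≤ t ∧ 0 ≤ s ∧ ∀ z : (ℝ × ℝ) × (ℝ × ℝ), 0 ≤ z.1.1 → 0 ≤ z.2.1 →
      doubling u v ε c μ η z ≤ doubling u v ε c μ η ((t, x), (s, y)) := by
  set S : Set ((ℝ × ℝ) × (ℝ × ℝ)) := (Ici 0 ×ˢ univ) ×ˢ (Ici 0 ×ˢ univ) with hS
  set K := 2 + 2 * B ^ 2 / μ + 4 * B ^ 2 * ε with hK
  have hK0 : 0 ≤ K := by positivity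
  set R := √(K / (μ / 2)) + √(K * (4 * ε)) + √(K / η) with hR
  have hbd : ∀ t x s y : ℝ, 0 ≤ t → 0 ≤ s → 0 ≤ doubling u v ε c μ η ((t, x), (s, y)) →
      |t| ≤ R ∧ |x| ≤ R ∧ |s| ≤ R ∧ |y| ≤ R := by
    intro t x s y ht hs hpos
    have h := doubling_bound hB hε hc hμ hu hv h0 ht hs hpos
    rw [← hK] at h
    have p1 : 0 ≤ (|t - s| + |x - y| - 4 * B * ε) ^ 2 / (4 * ε) := by positivity
    have p2 : 0 ≤ μ / 2 * (t - 2 * B / μ) ^ 2 := by positivity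
    have p3 : 0 ≤ μ / 2 * t ^ 2 := by positivity
    have p4 : 0 ≤ (|t - s| + |x - y|) ^ 2 / (4 * ε) := by positivity
    have p5 : 0 ≤ η * x ^ 2 := by positivity
    have b1 : |t| ≤ √(K / (μ / 2)) :=
      Real.abs_le_sqrt (by rw [le_div_iff₀ (by positivity)]; linarith)
    have b2 : |x| ≤ √(K / η) := Real.abs_le_sqrt (by rw [le_div_iff₀ hη]; linarith)
    have b3 : |t - s| + |x - y| ≤ √(K * (4 * ε)) :=
      (le_abs_self _).trans (Real.abs_le_sqrt (by rw [← div_le_iff₀ (by positivity)]; linarith))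
    have b4 : |s| ≤ |t| + |t - s| := by
      have := abs_sub t (t - s); rwa [sub_sub_cancel] at this
    have b5 : |y| ≤ |x| + |x - y| := by
      have := abs_sub x (x - y); rwa [sub_sub_cancel] at this
    have := abs_nonneg (t - s)
    have := abs_nonneg (x - y)
    have := abs_nonneg t
    have := abs_nonneg x
    have := Real.sqrt_nonneg (K / (μ / 2))
    have := Real.sqrt_nonneg (K / η)
    have := Real.sqrt_nonneg (K * (4 * ε))
    refine ⟨?_, ?_, ?_, ?_⟩ <;> linarith
  have hbd' : ∀ z : (ℝ × ℝ) × (ℝ × ℝ), 0 ≤ z.1.1 → 0 ≤ z.2.1 → 0 ≤ doubling u v ε c μ η z →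
      z ∈ Metric.closedBall (0 : (ℝ × ℝ) × (ℝ × ℝ)) R ∩ S := by
    rintro ⟨⟨t, x⟩, ⟨s, y⟩⟩ ht hs hpos
    obtain ⟨b1, b2, b3, b4⟩ := hbd t x s y ht hs hpos
    refine ⟨?_, ⟨⟨ht, mem_univ _⟩, ⟨hs, mem_univ _⟩⟩⟩
    simp only [mem_closedBall_zero_iff, Prod.norm_def, Real.norm_eq_abs]
    simp [b1, b2, b3, b4]
  have hcont : ContinuousOn (doubling u v ε c μ η) S := by
    have c1 : ContinuousOn (fun z : (ℝ × ℝ) × (ℝ × ℝ) => u z.1.1 z.1.2) S :=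
      hucont.comp continuous_fst.continuousOn fun z hz => hz.1
    have c2 : ContinuousOn (fun z : (ℝ × ℝ) × (ℝ × ℝ) => v z.2.1 z.2.2) S :=
      hvcont.comp continuous_snd.continuousOn fun z hz => hz.2
    unfold doubling
    exact ((((c1.sub c2).sub (by fun_prop)).sub (by fun_prop)).sub (by fun_prop)).sub
      (by fun_prop)
  have hSc : IsClosed S := (isClosed_Ici.prod isClosed_univ).prod (isClosed_Ici.prod isClosed_univ)
  obtain ⟨⟨⟨t, x⟩, ⟨s, y⟩⟩, hz, hmax⟩ :=
    ((isCompact_closedBall (0 : (ℝ × ℝ) × (ℝ × ℝ)) R).inter_right hSc).exists_isMaxOn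
      ⟨z₀, hbd' z₀ hz₁ hz₂ hz₀⟩ (hcont.mono inter_subset_right)
  refine ⟨t, x, s, y, hz.2.1.1, hz.2.2.1, fun z h1 h2 => ?_⟩
  by_cases hpos : 0 ≤ doubling u v ε c μ η z
  · exact hmax (hbd' z h1 h2 hpos)
  · exact (le_of_not_ge hpos).trans (hz₀.trans (hmax (hbd' z₀ hz₁ hz₂ hz₀)))

-- The linear term ct makes the inequality strict, while μt² and ηx² force a maximum to exist.
-- Coercivity is not needed: once ε is fixed the momenta 2(x − y)/ε stay bounded, so continuity of G
-- on a compact interval absorbs the perturbation 2ηx.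
set_option maxHeartbeats 1000000 in
theorem viscosity_comparison {G F : ℝ → ℝ} (hG : Continuous G) (hF : UniformContinuous F)
    {u v : ℝ → ℝ → ℝ} (hu : UniformContinuousOn (Function.uncurry u) (Ici 0 ×ˢ univ))
    (hv : UniformContinuousOn (Function.uncurry v) (Ici 0 ×ˢ univ))
    (hsub : IsViscositySub (fun p x => G p + F x) u)
    (hsup : IsViscositySuper (fun p x => G p + F x) v) (h0 : ∀ x, u 0 x ≤ v 0 x) :
    ∀ t x : ℝ, 0 ≤ t → u t x ≤ v t x := by
  intro t₁ x₁ ht₁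
  by_contra! hlt
  set δ := u t₁ x₁ - v t₁ x₁ with hδ
  have hδ0 : 0 < δ := sub_pos.2 hlt
  obtain ⟨Bu, hBu0, hBu⟩ := hu.exists_affine_modulus one_pos
  obtain ⟨Bv, hBv0, hBv⟩ := hv.exists_affine_modulus one_pos
  obtain ⟨Cu, hCu0, hCu⟩ := hu.exists_affine_modulus (show 0 < δ / 16 by positivity)
  obtain ⟨Cv, hCv0, hCv⟩ := hv.exists_affine_modulus (show 0 < δ / 16 by positivity)
  set B := Bu + Bv with hB
  have hB0 : 0 ≤ B := by positivity
  set C := Cu + Cv with hC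
  have hC0 : 0 ≤ C := by positivity
  have hBu' : ∀ t s x y : ℝ, 0 ≤ t → 0 ≤ s → |u t x - u s y| ≤ 1 + B * (|t - s| + |x - y|) :=
    fun t s x y ht hs => (hBu t s x y ht hs).trans (by gcongr; linarith)
  have hBv' : ∀ t s x y : ℝ, 0 ≤ t → 0 ≤ s → |v t x - v s y| ≤ 1 + B * (|t - s| + |x - y|) :=
    fun t s x y ht hs => (hBv t s x y ht hs).trans (by gcongr; linarith)
  have hCu' : ∀ t s x y : ℝ, 0 ≤ t → 0 ≤ s → |u t x - u s y| ≤ δ / 16 + C * (|t - s| + |x - y|) :=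
    fun t s x y ht hs => (hCu t s x y ht hs).trans (by gcongr; linarith)
  have hCv' : ∀ t s x y : ℝ, 0 ≤ t → 0 ≤ s → |v t x - v s y| ≤ δ / 16 + C * (|t - s| + |x - y|) :=
    fun t s x y ht hs => (hCv t s x y ht hs).trans (by gcongr; linarith)
  set c := δ / (8 * (1 + t₁)) with hc
  have hc0 : 0 < c := by positivity
  set μ := δ / (8 * (1 + t₁ ^ 2)) with hμ
  have hμ0 : 0 < μ := by positivity
  obtain ⟨δF, hδF, hF'⟩ := Metric.uniformContinuous_iff.1 hF (c / 4) (by positivity)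
  -- Points closer than κ change F by less than c/4 and make the linear part of the moduli at most
  -- δ/16.
  set κ := min δF (δ / (16 * (C + 1))) with hκ
  have hκ0 : 0 < κ := lt_min hδF (by positivity)
  -- Chosen so that r² ≤ 2ε(1 + Br) excludes r ≥ κ: then 1 ≤ r/κ, and the right side is at most
  -- κr/2.
  set ε := κ / (4 * (1 / κ + B)) with hε
  have hε0 : 0 < ε := by positivity
  set K := 2 + 2 * B ^ 2 / μ + 4 * B ^ 2 * ε with hK
  have hK0 : 0 ≤ K := by positivity
  set R := 2 * κ / ε with hR
  have hGu : UniformContinuousOn G (Icc (-R - 1) (R + 1)) :=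
    isCompact_Icc.uniformContinuousOn_of_continuous hG.continuousOn
  obtain ⟨δG', hδG', hG''⟩ := Metric.uniformContinuousOn_iff.1 hGu (c / 4) (by positivity)
  set δG := min δG' 1 with hδGdef
  have hδG : 0 < δG := lt_min hδG' one_pos
  -- η comes last. Since ηx² ≤ K at the maximum, (2ηx)² ≤ 4ηK < δG², so 2ηx is within the modulus of
  -- G.
  set η := min (δ / (8 * (1 + x₁ ^ 2))) (δG ^ 2 / (8 * (K + 1))) with hη
  have hη0 : 0 < η := lt_min (by positivity) (by positivity)
  have hstart : δ / 2 ≤ doubling u v ε c μ η ((t₁, x₁), (t₁, x₁)) := by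
    have a1 : c * t₁ ≤ δ / 8 := div_mul_le_div_eight hδ0 ht₁ le_rfl
    have a2 : μ * t₁ ^ 2 ≤ δ / 8 := div_mul_le_div_eight hδ0 (sq_nonneg _) le_rfl
    have a3 : η * x₁ ^ 2 ≤ δ / 8 :=
      (mul_le_mul_of_nonneg_right (min_le_left _ _) (sq_nonneg _)).trans
        (div_mul_le_div_eight hδ0 (sq_nonneg _) le_rfl)
    simp only [doubling, sub_self]
    norm_num
    linarith
  obtain ⟨t, x, s, y, ht, hs, hmax⟩ := exists_max_doubling (η := η) hB0 hε0 hc0.le hμ0 hη0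
    hu.continuousOn hv.continuousOn hBu' hBv' h0 (z₀ := ((t₁, x₁), (t₁, x₁))) ht₁ ht₁
    (by linarith)
  have hval : δ / 2 ≤ doubling u v ε c μ η ((t, x), (s, y)) := hstart.trans (hmax _ ht₁ ht₁)
  set r := |t - s| + |x - y| with hr
  have hr0 : 0 ≤ r := by positivity
  have hq : r ^ 2 / (2 * ε) ≤ ((x - y) ^ 2 + (t - s) ^ 2) / ε := sq_abs_add_abs_div_le hε0 _ _
  -- Moving the second point onto the first removes the penalty and changes only `v`.
  have hr1 : r ^ 2 / (2 * ε) ≤ 1 + B * r := by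
    have h1 := hmax ((t, x), (t, x)) ht ht
    simp only [doubling, sub_self] at h1
    norm_num at h1
    have h2 := le_of_abs_le (hBv' t s x y ht hs)
    linarith
  have hrκ : r < κ := by
    by_contra! hle
    have h1 : 1 ≤ r / κ := by rwa [one_le_div hκ0]
    have h2 : r ^ 2 ≤ 2 * ε * (r / κ + B * r) := by
      rw [div_le_iff₀ (by positivity), mul_comm] at hr1
      exact hr1.trans (by gcongr)
    have h3 : 2 * ε * (r / κ + B * r) = κ * r / 2 := by
      rw [hε]; field_simp; ring
    have h4 : 0 < r := hκ0.trans_le hle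
    have h5 : κ * r ≤ r ^ 2 := by
      rw [sq]; exact mul_le_mul_of_nonneg_right hle h4.le
    have h6 : 0 < κ * r := mul_pos hκ0 h4
    linarith
  have hCr : C * r ≤ δ / 16 := by
    have : r ≤ δ / (16 * (C + 1)) := hrκ.le.trans (min_le_right _ _)
    calc C * r ≤ (C + 1) * (δ / (16 * (C + 1))) := by gcongr; linarith
      _ = δ / 16 := by field_simp
  have hpen : 0 ≤ ((x - y) ^ 2 + (t - s) ^ 2) / ε := by positivity
  have hct : 0 ≤ c * t := by positivity
  have hμt : 0 ≤ μ * t ^ 2 := by positivity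
  have hηx : 0 ≤ η * x ^ 2 := by positivity
  have hval' := hval
  simp only [doubling] at hval'
  -- At t = 0 the initial ordering and the modulus of `v` leave a value of at most δ/8, below the
  -- guaranteed δ/2; the case s = 0 is symmetric, with the modulus of `u`.
  have ht0 : 0 < t := by
    rcases ht.lt_or_eq with h | h
    · exact h
    · exfalso
      have h1 := le_of_abs_le (hCv' t s x y ht hs)
      have h2 := h0 x
      rw [← hr] at h1
      rw [h] at h2
      linarith
  have hs0 : 0 < s := by
    rcases hs.lt_or_eq with h | h
    · exact h
    · exfalso
      have h1 := le_of_abs_le (hCu' t s x y ht hs)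
      have h2 := h0 y
      rw [← hr] at h1
      rw [h] at h2
      linarith
  have hj1 := sub_jet_of_isMax hsub ht0 hs hmax
  have hj2 := super_jet_of_isMax hsup ht hs0 hmax
  have hxy : |x - y| < κ := by linarith [abs_nonneg (t - s)]
  have hFxy : |F x - F y| < c / 4 := hF' (hxy.trans_le (min_le_left _ _))
  have hp : |2 * (x - y) / ε| ≤ R := by
    rw [abs_div, abs_mul, abs_two, abs_of_pos hε0, hR]
    gcongr
  have hηx2 : η * x ^ 2 ≤ K := by
    have h := doubling_bound hB0 hε0 hc0.le hμ0 hBu' hBv' h0 ht hs (le_trans (by positivity) hval)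
    have p1 : 0 ≤ (|t - s| + |x - y| - 4 * B * ε) ^ 2 / (4 * ε) := by positivity
    have p2 : 0 ≤ μ / 2 * (t - 2 * B / μ) ^ 2 := by positivity
    have p3 : 0 ≤ μ / 2 * t ^ 2 := by positivity
    have p4 : 0 ≤ (|t - s| + |x - y|) ^ 2 / (4 * ε) := by positivity
    linarith
  have hηx3 : |2 * η * x| < δG := by
    apply abs_lt_of_sq_lt_sq _ hδG.le
    have h1 : η * (8 * (K + 1)) ≤ δG ^ 2 := by
      rw [← le_div_iff₀ (by positivity)]; exact min_le_right _ _
    have h2 : (2 * η * x) ^ 2 = 4 * η * (η * x ^ 2) := by ring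
    have h3 : 4 * η * (η * x ^ 2) ≤ 4 * η * K := by gcongr
    have h4 := mul_nonneg hη0.le hK0
    linarith
  have hGp : |G (2 * (x - y) / ε + 2 * η * x) - G (2 * (x - y) / ε)| < c / 4 := by
    have h1 := abs_le.1 hp
    have h2 := abs_lt.1 (hηx3.trans_le (min_le_right _ _))
    refine hG'' _ ⟨by linarith, by linarith⟩ _ ⟨by linarith, by linarith⟩ ?_
    rw [Real.dist_eq, add_sub_cancel_left]
    exact hηx3.trans_le (min_le_left _ _)
  -- Subtracting the two jet inequalities leaves c + 2μt bounded by the variations of G and F, whose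
  -- sum is less than c/2.
  have h1 := abs_lt.1 hFxy
  have h2 := abs_lt.1 hGp
  have : 0 ≤ μ * t := by positivity
  linarith


/-! ### Existence of viscosity solutions by Perron's method -/

lemma deriv_fst_eq_fderiv {φ : ℝ × ℝ → ℝ} {t x : ℝ} (h : DifferentiableAt ℝ φ (t, x)) :
    deriv (fun s => φ (s, x)) t = fderiv ℝ φ (t, x) (1, 0) := by
  have h1 : HasDerivAt (fun s : ℝ => (s, x)) (1, 0) t :=
    (hasDerivAt_id t).prodMk (hasDerivAt_const t x)
  exact (h.hasFDerivAt.comp_hasDerivAt t h1).deriv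

lemma deriv_snd_eq_fderiv {φ : ℝ × ℝ → ℝ} {t x : ℝ} (h : DifferentiableAt ℝ φ (t, x)) :
    deriv (fun y => φ (t, y)) x = fderiv ℝ φ (t, x) (0, 1) := by
  have h1 : HasDerivAt (fun y : ℝ => (t, y)) (0, 1) x :=
    (hasDerivAt_const x t).prodMk (hasDerivAt_id x)
  exact (h.hasFDerivAt.comp_hasDerivAt x h1).deriv

/-- Used to check a viscosity inequality for φ on the smooth function that φ touches. -/
lemma partials_eq_of_isLocalExtr {φ ψ : ℝ × ℝ → ℝ} {t x : ℝ} (hφ : DifferentiableAt ℝ φ (t, x))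
    (hψ : DifferentiableAt ℝ ψ (t, x)) (h : IsLocalExtr (fun q => ψ q - φ q) (t, x)) :
    deriv (fun s => φ (s, x)) t = deriv (fun s => ψ (s, x)) t ∧
      deriv (fun y => φ (t, y)) x = deriv (fun y => ψ (t, y)) x := by
  have h0 := h.fderiv_eq_zero
  have h1 : fderiv ℝ (fun q => ψ q - φ q) (t, x) = fderiv ℝ ψ (t, x) - fderiv ℝ φ (t, x) :=
    fderiv_sub hψ hφ
  rw [h0, eq_comm, sub_eq_zero] at h1
  rw [deriv_fst_eq_fderiv hφ, deriv_fst_eq_fderiv hψ, deriv_snd_eq_fderiv hφ,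
    deriv_snd_eq_fderiv hψ, h1]
  exact ⟨rfl, rfl⟩

/-- The value of the Hamilton–Jacobi operator on a smooth function. -/
def hjOperator (H : ℝ → ℝ → ℝ) (φ : ℝ × ℝ → ℝ) (z : ℝ × ℝ) : ℝ :=
  deriv (fun s => φ (s, z.2)) z.1 + H (deriv (fun y => φ (z.1, y)) z.2) z.2

lemma continuous_hjOperator {H : ℝ → ℝ → ℝ} (hH : Continuous (Function.uncurry H))
    {φ : ℝ × ℝ → ℝ} (hφ : ContDiff ℝ 1 φ) : Continuous (hjOperator H φ) := by
  have hd : ∀ z, DifferentiableAt ℝ φ z := fun z => (hφ.differentiable one_ne_zero) z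
  have h1 : Continuous (fderiv ℝ φ) := hφ.continuous_fderiv one_ne_zero
  have h2 : hjOperator H φ = fun z => fderiv ℝ φ z (1, 0) +
      Function.uncurry H (fderiv ℝ φ z (0, 1), z.2) := by
    funext z
    simp only [hjOperator, Function.uncurry]
    rw [deriv_fst_eq_fderiv (hd (z.1, z.2)), deriv_snd_eq_fderiv (hd (z.1, z.2))]
  rw [h2]
  exact (h1.clm_apply continuous_const).add
    (hH.comp ((h1.clm_apply continuous_const).prodMk continuous_snd))

lemma hasDerivAt_sq_sub (a b : ℝ) : HasDerivAt (fun s : ℝ => (s - b) ^ 2) (2 * (a - b)) a := by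
  have h := ((hasDerivAt_id a).sub_const b).pow 2
  exact h.congr_deriv (by simp)

/-- Adding a quadratic centred at `z` does not change the first derivatives at `z`. -/
lemma hjOperator_add_sq {H : ℝ → ℝ → ℝ} {φ : ℝ × ℝ → ℝ} (hφ : Differentiable ℝ φ) (k c : ℝ)
    (z : ℝ × ℝ) :
    hjOperator H (fun q => φ q + c + k * ((q.1 - z.1) ^ 2 + (q.2 - z.2) ^ 2)) z
      = hjOperator H φ z := by
  have e1 : deriv (fun s => φ (s, z.2) + c + k * ((s - z.1) ^ 2 + (z.2 - z.2) ^ 2)) z.1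
      = deriv (fun s => φ (s, z.2)) z.1 := by
    have hd : DifferentiableAt ℝ (fun s => φ (s, z.2)) z.1 := by fun_prop
    have := ((hd.hasDerivAt.add_const c).add
      (((hasDerivAt_sq_sub z.1 z.1).add_const ((z.2 - z.2) ^ 2)).const_mul k)).deriv
    exact this.trans (by simp)
  have e2 : deriv (fun y => φ (z.1, y) + c + k * ((z.1 - z.1) ^ 2 + (y - z.2) ^ 2)) z.2
      = deriv (fun y => φ (z.1, y)) z.2 := by
    have hd : DifferentiableAt ℝ (fun y => φ (z.1, y)) z.2 := by fun_prop
    have := ((hd.hasDerivAt.add_const c).add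
      (((hasDerivAt_sq_sub z.2 z.2).const_add ((z.1 - z.1) ^ 2)).const_mul k)).deriv
    exact this.trans (by simp)
  simp only [hjOperator, e1, e2]

/-- A function which is pointwise approximated from below by continuous subsolutions that do not
exceed it is a subsolution. -/
lemma isViscositySub_of_approx {H : ℝ → ℝ → ℝ} (hH : Continuous (Function.uncurry H))
    {u : ℝ → ℝ → ℝ}
    (h : ∀ t x, 0 < t → ∀ ε > 0, ∃ w : ℝ → ℝ → ℝ, Continuous (Function.uncurry w) ∧
      IsViscositySub H w ∧ (∀ s y, 0 < s → w s y ≤ u s y) ∧ u t x - ε < w t x) :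
    IsViscositySub H u := by
  intro t x ht φ hφ hmax
  by_contra! hpos
  have hφd : Differentiable ℝ φ := hφ.differentiable one_ne_zero
  -- The quadratic makes the maximum strict. As `w` is within ρ² of `u` at the centre and never
  -- exceeds it, a maximum of w − φ₂ over the closed ball lies in the open ball.
  set φ₂ : ℝ × ℝ → ℝ := fun q => φ q + 0 + 1 * ((q.1 - t) ^ 2 + (q.2 - x) ^ 2) with hφ₂
  have hφ₂c : ContDiff ℝ 1 φ₂ := by fun_prop
  have hpos₂ : 0 < hjOperator H φ₂ (t, x) := by
    have := hjOperator_add_sq (H := H) hφd 1 0 (t, x)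
    rw [hφ₂]
    exact this ▸ hpos
  have hev : ∀ᶠ z in 𝓝 (t, x), 0 < hjOperator H φ₂ z ∧ 0 < z.1 ∧
      Function.uncurry u z - φ z ≤ Function.uncurry u (t, x) - φ (t, x) :=
    ((continuous_hjOperator hH hφ₂c).tendsto _ |>.eventually (lt_mem_nhds hpos₂)).and
      (((continuous_fst.tendsto (t, x)).eventually (lt_mem_nhds ht)).and hmax)
  obtain ⟨ρ, hρ, hball⟩ := Metric.nhds_basis_closedBall.mem_iff.1 hev
  obtain ⟨w, hwc, hws, hwu, hwa⟩ := h t x ht (ρ ^ 2) (by positivity)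
  obtain ⟨⟨s, y⟩, hz, hzmax⟩ := (isCompact_closedBall (t, x) ρ).exists_isMaxOn
    ⟨(t, x), Metric.mem_closedBall_self hρ.le⟩
    (f := fun q => Function.uncurry w q - φ₂ q) (hwc.sub hφ₂c.continuous).continuousOn
  obtain ⟨b1, b2, b3⟩ := hball hz
  have h1 := hzmax (Metric.mem_closedBall_self hρ.le)
  simp only [mem_ofPred_eq, Function.uncurry, hφ₂] at h1 b3 b2
  have h2 := hwu s y b2
  have h3 : (s - t) ^ 2 + (y - x) ^ 2 < ρ ^ 2 := by nlinarith
  have h4 : (s, y) ∈ Metric.ball (t, x) ρ := by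
    rw [Metric.mem_ball, Prod.dist_eq, max_lt_iff, Real.dist_eq, Real.dist_eq]
    constructor <;> refine abs_lt_of_sq_lt_sq ?_ hρ.le <;> nlinarith
  have h5 : IsLocalMax (fun q => Function.uncurry w q - φ₂ q) (s, y) :=
    hzmax.isLocalMax (Filter.mem_of_superset (Metric.isOpen_ball.mem_nhds h4)
      Metric.ball_subset_closedBall)
  exact (hws s y b2 φ₂ hφ₂c h5).not_gt b1

/-- The class of functions in Perron's method for the initial condition `θ x`. -/
structure PerronClass (G F : ℝ → ℝ) (θ C : ℝ) (w : ℝ → ℝ → ℝ) : Prop where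
  continuous : Continuous (Function.uncurry w)
  sub : IsViscositySub (fun p x => G p + F x) w
  lower : ∀ t x, 0 ≤ t → θ * x - C * t ≤ w t x
  upper : ∀ t x, 0 ≤ t → w t x ≤ θ * x + C * t

/-- The hypotheses under which Perron's method is run. -/
structure PerronData (G F : ℝ → ℝ) (θ C CF L : ℝ) : Prop where
  contG : Continuous G
  contF : Continuous F
  boundF : ∀ x, |F x| ≤ CF
  C_ge : |G θ| + CF ≤ C
  L_ge : |θ| + 1 ≤ L
  large_pos : C + 1 + CF < G L
  large_neg : C + 1 + CF < G (-L)

namespace PerronData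

variable {G F : ℝ → ℝ} {θ C CF L : ℝ}

lemma CF_nonneg (D : PerronData G F θ C CF L) : 0 ≤ CF := (abs_nonneg _).trans (D.boundF 0)

lemma C_nonneg (D : PerronData G F θ C CF L) : 0 ≤ C :=
  (add_nonneg (abs_nonneg _) D.CF_nonneg).trans D.C_ge

lemma contH (D : PerronData G F θ C CF L) :
    Continuous (Function.uncurry fun p x => G p + F x) :=
  (D.contG.comp continuous_fst).add (D.contF.comp continuous_snd)

lemma barrier (D : PerronData G F θ C CF L) :
    PerronClass G F θ C fun t x => θ * x - C * t where
  continuous := by fun_prop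
  sub := by
    intro t x ht φ hφ hmax
    obtain ⟨e1, e2⟩ := partials_eq_of_isLocalExtr (φ := φ)
      (ψ := Function.uncurry fun t x => θ * x - C * t)
      ((hφ.differentiable one_ne_zero) _) (by unfold Function.uncurry; fun_prop) (Or.inr hmax)
    have d1 : HasDerivAt (fun s => θ * x - C * s) (-C) t := by
      simpa using ((hasDerivAt_id t).const_mul C).const_sub (θ * x)
    have d2 : HasDerivAt (fun y => θ * y - C * t) θ x := by
      simpa using ((hasDerivAt_id x).const_mul θ).sub_const (C * t)
    rw [e1, e2]
    simp only [Function.uncurry, d1.deriv, d2.deriv]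
    linarith [le_abs_self (G θ), le_of_abs_le (D.boundF x), D.C_ge]
  lower t x ht := le_rfl
  upper t x ht := by nlinarith [D.C_nonneg]

end PerronData

/-- The supremal convolution of `w` in time. -/
def timeSupConv (C : ℝ) (w : ℝ → ℝ → ℝ) (t x : ℝ) : ℝ :=
  sSup ((fun r => w (r * max t 0) x - (C + 1) * |max t 0 - r * max t 0|) '' Icc 0 (2 * C + 1))

/-! ### Regularisation of competitors in time -/

namespace PerronClass

variable {G F : ℝ → ℝ} {θ C CF L : ℝ} {w : ℝ → ℝ → ℝ}

lemma continuous_slice (hw : PerronClass G F θ C w) (t x : ℝ) :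
    Continuous fun r => w (r * max t 0) x - (C + 1) * |max t 0 - r * max t 0| := by
  have : Continuous fun r : ℝ => Function.uncurry w (r * max t 0, x) :=
    hw.continuous.comp (by fun_prop)
  exact this.sub (by fun_prop)

/-- The supremum only sees s ≤ (2C + 1)t. For later s the barriers already give w(s, x) − (C + 1)(s
− t) ≤ θx − Ct ≤ w(t, x). -/
lemma le_timeSupConv (D : PerronData G F θ C CF L) (hw : PerronClass G F θ C w) {t s : ℝ}
    (ht : 0 < t) (hs : 0 ≤ s) (x : ℝ) :
    w s x - (C + 1) * |t - s| ≤ timeSupConv C w t x := by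
  have hC := D.C_nonneg
  have hbdd : BddAbove ((fun r => w (r * max t 0) x - (C + 1) * |max t 0 - r * max t 0|) ''
      Icc 0 (2 * C + 1)) :=
    (isCompact_Icc.image (hw.continuous_slice t x)).bddAbove
  by_cases h : s ≤ (2 * C + 1) * t
  · refine le_csSup hbdd ⟨s / t, ⟨by positivity, by rwa [div_le_iff₀ ht]⟩, ?_⟩
    simp only [max_eq_left ht.le, div_mul_cancel₀ s ht.ne']
  · push Not at h
    have h1 : w t x ≤ timeSupConv C w t x :=
      le_csSup hbdd ⟨1, ⟨by norm_num, by linarith⟩, by simp [max_eq_left ht.le]⟩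
    have h2 := hw.upper s x hs
    have h3 := hw.lower t x ht.le
    have h4 : s - t ≤ |t - s| := by rw [abs_sub_comm]; exact le_abs_self _
    nlinarith

lemma exists_timeSupConv_eq (D : PerronData G F θ C CF L) (hw : PerronClass G F θ C w) {t : ℝ}
    (ht : 0 ≤ t) (x : ℝ) :
    ∃ s, 0 ≤ s ∧ timeSupConv C w t x = w s x - (C + 1) * |t - s| := by
  have hC := D.C_nonneg
  obtain ⟨r, hr, he⟩ := isCompact_Icc.exists_sSup_image_eq (s := Icc 0 (2 * C + 1))
    ⟨0, le_rfl, by linarith⟩ (hw.continuous_slice t x).continuousOn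
  refine ⟨r * t, mul_nonneg hr.1 ht, ?_⟩
  rw [timeSupConv, he, max_eq_left ht]

/-- The Hamiltonian does not depend on time, so a test function touching the convolution at t,
shifted in time, touches `w` at the maximising time s. The penalty slope C + 1 exceeds the barrier
rate C, so s > 0 and the upper barrier survives. -/
lemma timeSupConv_mem (D : PerronData G F θ C CF L) (hw : PerronClass G F θ C w) :
    PerronClass G F θ C (timeSupConv C w) where
  continuous := by
    have : Continuous fun q : ℝ × ℝ => sSup ((fun r => w (r * max q.1 0) q.2
        - (C + 1) * |max q.1 0 - r * max q.1 0|) '' Icc 0 (2 * C + 1)) := by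
      refine isCompact_Icc.continuous_sSup (f := fun (q : ℝ × ℝ) r => w (r * max q.1 0) q.2
        - (C + 1) * |max q.1 0 - r * max q.1 0|) ?_
      have h1 : Continuous fun z : (ℝ × ℝ) × ℝ => Function.uncurry w (z.2 * max z.1.1 0, z.1.2) :=
        hw.continuous.comp (by fun_prop)
      exact h1.sub (by fun_prop)
    exact this
  sub := by
    intro t x ht φ hφ hmax
    obtain ⟨s, hs, he⟩ := hw.exists_timeSupConv_eq D ht.le x
    have hs0 : 0 < s := by
      rcases hs.lt_or_eq with h | h
      · exact h
      · exfalso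
        have h1 := hw.le_timeSupConv D ht ht.le x
        have h2 := hw.lower t x ht.le
        have h3 := hw.upper 0 x le_rfl
        rw [← h] at he
        simp only [sub_zero, sub_self, abs_zero, mul_zero, abs_of_pos ht] at he h1 h3
        linarith
    have hshift : Tendsto (fun q : ℝ × ℝ => (q.1 + (t - s), q.2)) (𝓝 (s, x)) (𝓝 (t, x)) := by
      have : Continuous fun q : ℝ × ℝ => (q.1 + (t - s), q.2) := by fun_prop
      simpa using this.tendsto (s, x)
    have hφ' : ContDiff ℝ 1 fun q : ℝ × ℝ => φ (q.1 + (t - s), q.2) :=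
      hφ.comp (by fun_prop)
    have := hw.sub s x hs0 (fun q => φ (q.1 + (t - s), q.2)) hφ' (by
      filter_upwards [hshift.eventually hmax,
        (continuous_fst.tendsto (s, x)).eventually (lt_mem_nhds hs0),
        (continuous_fst.tendsto (t, x)).comp hshift |>.eventually (lt_mem_nhds ht)] with q h1 h2 h3
      simp only [Function.uncurry, Function.comp] at h1 h2 h3 ⊢
      have h4 := hw.le_timeSupConv D h3 h2.le q.2
      rw [he] at h1
      have h5 : q.1 + (t - s) - q.1 = t - s := by ring
      rw [h5] at h4
      have h6 : s + (t - s) = t := by ring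
      rw [h6]
      linarith)
    have e1 : deriv (fun τ => φ (τ + (t - s), x)) s = deriv (fun τ => φ (τ, x)) t := by
      rw [deriv_comp_add_const (f := fun τ => φ (τ, x))]; simp
    simpa [e1] using this
  lower t x ht := by
    rcases ht.lt_or_eq with h | h
    · have := hw.le_timeSupConv D h ht x
      simp only [sub_self, abs_zero, mul_zero, sub_zero] at this
      exact (hw.lower t x ht).trans this
    · obtain ⟨s, hs, he⟩ := hw.exists_timeSupConv_eq D ht x
      have h1 := hw.lower 0 x le_rfl
      have hne : (Icc 0 (2 * C + 1)).Nonempty := ⟨0, le_rfl, by linarith [D.C_nonneg]⟩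
      rw [← h]
      -- At t = 0 the window of times shrinks to the single time 0.
      simpa [timeSupConv, hne] using h1
  upper t x ht := by
    obtain ⟨s, hs, he⟩ := hw.exists_timeSupConv_eq D ht x
    have h1 := hw.upper s x hs
    have h2 : s - t ≤ |t - s| := by rw [abs_sub_comm]; exact le_abs_self _
    have := D.C_nonneg
    have := abs_nonneg (t - s)
    rw [he]
    nlinarith

end PerronClass

/-- Perron's solution. -/
def perronSolution (G F : ℝ → ℝ) (θ C : ℝ) (t x : ℝ) : ℝ :=
  sSup {a | ∃ w, PerronClass G F θ C w ∧ a = w t x}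

/-! ### Perron's solution: Lipschitz bound and viscosity inequalities -/

namespace PerronData

variable {G F : ℝ → ℝ} {θ C CF L : ℝ} {w : ℝ → ℝ → ℝ}

lemma le_perronSolution (hw : PerronClass G F θ C w) {t : ℝ} (ht : 0 ≤ t) (x : ℝ) :
    w t x ≤ perronSolution G F θ C t x := by
  refine le_csSup ⟨θ * x + C * t, ?_⟩ ⟨w, hw, rfl⟩
  rintro a ⟨w, hw, rfl⟩
  exact hw.upper t x ht

lemma perronSolution_le (D : PerronData G F θ C CF L) {t x b : ℝ}
    (h : ∀ w, PerronClass G F θ C w → w t x ≤ b) : perronSolution G F θ C t x ≤ b := by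
  refine csSup_le ⟨_, _, D.barrier, rfl⟩ ?_
  rintro a ⟨w, hw, rfl⟩
  exact h w hw

lemma exists_lt_of_lt_perronSolution (D : PerronData G F θ C CF L) {t x b : ℝ}
    (h : b < perronSolution G F θ C t x) : ∃ w, PerronClass G F θ C w ∧ b < w t x := by
  by_contra! hcon
  exact (D.perronSolution_le hcon).not_gt h

lemma perronSolution_zero (D : PerronData G F θ C CF L) (x : ℝ) :
    perronSolution G F θ C 0 x = θ * x := by
  refine le_antisymm (D.perronSolution_le fun w hw => by simpa using hw.upper 0 x le_rfl) ?_
  simpa using le_perronSolution D.barrier le_rfl x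

/-- The Lipschitz estimate obtained from the coercivity of `G`. -/
lemma apply_le_perronSolution_add (D : PerronData G F θ C CF L) (hw : PerronClass G F θ C w)
    {t₀ s₁ : ℝ} (ht₀ : 0 < t₀) (hs₁ : 0 ≤ s₁) (x₀ x₁ : ℝ) :
    w s₁ x₁ ≤ perronSolution G F θ C t₀ x₀ + (C + 1) * |s₁ - t₀| + L * |x₁ - x₀| := by
  have hC := D.C_nonneg
  have hL := D.L_ge
  refine le_of_forall_pos_le_add fun ε hε => ?_
  -- κ is the scale at which |s − t₀| is smoothed. Its cost (C + 1)κ is below t₀, which keeps the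
  -- maximum away from s = 0, and below ε, the allowed error.
  set κ := min t₀ ε / (2 * (C + 1)) with hκ
  have hmin : 0 < min t₀ ε := lt_min ht₀ hε
  have hκ0 : 0 < κ := by positivity
  have hCκ : (C + 1) * κ < min t₀ ε := by
    have : (C + 1) * κ = min t₀ ε / 2 := by rw [hκ]; field_simp
    linarith
  set χ : ℝ → ℝ := fun a => √(a ^ 2 + κ ^ 2) with hχ
  have hχ1 : ∀ a, |a| ≤ χ a := fun a => Real.abs_le_sqrt (by nlinarith)
  have hχ2 : ∀ a, χ a ≤ |a| + κ := fun a => by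
    refine Real.sqrt_le_iff.2 ⟨by positivity, ?_⟩
    nlinarith [sq_abs a, mul_nonneg (abs_nonneg a) hκ0.le]
  have hχpos : ∀ a : ℝ, 0 < a ^ 2 + κ ^ 2 := fun a => by positivity
  have hχc : Continuous χ := by fun_prop
  set Ψ : ℝ × ℝ → ℝ := fun q => w q.1 q.2 - (C + 1) * χ (q.1 - t₀) - L * |q.2 - x₀| with hΨ
  have hΨc : Continuous Ψ := by
    have h1 : Continuous fun q : ℝ × ℝ => w q.1 q.2 := hw.continuous
    have h2 : Continuous fun q : ℝ × ℝ => χ (q.1 - t₀) := hχc.comp (by fun_prop)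
    exact (h1.sub (continuous_const.mul h2)).sub (by fun_prop)
  have hθabs : ∀ x, θ * x ≤ θ * x₀ + |θ| * |x - x₀| := fun x => by
    have := le_abs_self (θ * (x - x₀))
    rw [abs_mul] at this
    linarith
  have hub : ∀ s x, 0 ≤ s → Ψ (s, x) ≤ (C + 1) * t₀ + θ * x₀ - s - |x - x₀| := by
    intro s x hs
    have h1 := hw.upper s x hs
    have h2 := hχ1 (s - t₀)
    have h3 := le_abs_self (s - t₀)
    have h4 : (C + 1) * (s - t₀) ≤ (C + 1) * χ (s - t₀) := by gcongr; linarith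
    have h5 : (|θ| + 1) * |x - x₀| ≤ L * |x - x₀| := by gcongr
    have h6 := hθabs x
    simp only [hΨ]
    linarith
  have hΨ₀ : θ * x₀ - C * t₀ - (C + 1) * κ ≤ Ψ (t₀, x₀) := by
    have h1 := hw.lower t₀ x₀ ht₀.le
    have h2 := hχ2 (t₀ - t₀)
    simp only [sub_self, abs_zero, zero_add] at h2
    have h3 : (C + 1) * χ 0 ≤ (C + 1) * κ := by gcongr
    simp only [hΨ, sub_self, abs_zero, mul_zero, sub_zero]
    linarith
  set R := (C + 1) * t₀ + C * t₀ + (C + 1) * κ with hR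
  have hcpt : IsCompact (Icc 0 R ×ˢ Icc (x₀ - R) (x₀ + R)) := isCompact_Icc.prod isCompact_Icc
  have hR0 : t₀ ≤ R := by nlinarith [mul_nonneg hC ht₀.le]
  obtain ⟨⟨s, x⟩, hz, hmaxK⟩ := hcpt.exists_isMaxOn
    ⟨(t₀, x₀), ⟨ht₀.le, hR0⟩, ⟨by linarith, by linarith⟩⟩ hΨc.continuousOn
  have hs : 0 ≤ s := hz.1.1
  have hmax₀ : Ψ (t₀, x₀) ≤ Ψ (s, x) :=
    hmaxK (show (t₀, x₀) ∈ _ from ⟨⟨ht₀.le, hR0⟩, ⟨by linarith, by linarith⟩⟩)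
  have hmax : ∀ q : ℝ × ℝ, 0 ≤ q.1 → Ψ q ≤ Ψ (s, x) := by
    rintro ⟨s', x'⟩ hs'
    by_cases hΨ' : Ψ (t₀, x₀) ≤ Ψ (s', x')
    · have h1 := hub s' x' hs'
      have h2 := abs_nonneg (x' - x₀)
      have h3 : |x' - x₀| ≤ R := by simp only at hs'; linarith
      rw [abs_le] at h3
      exact hmaxK (show (s', x') ∈ _ from
        ⟨⟨hs', by simp only; linarith⟩, ⟨by linarith, by linarith⟩⟩)
    · exact (le_of_not_ge hΨ').trans hmax₀
  have hs0 : 0 < s := by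
    rcases hs.lt_or_eq with h | h
    · exact h
    · exfalso
      have h1 := hw.upper 0 x le_rfl
      have h2 := hχ1 (0 - t₀)
      rw [zero_sub, abs_neg, abs_of_pos ht₀] at h2
      have h4 : (C + 1) * t₀ ≤ (C + 1) * χ (-t₀) := by gcongr
      have h5 : (|θ| + 1) * |x - x₀| ≤ L * |x - x₀| := by gcongr
      have h6 := hθabs x
      have h7 := abs_nonneg (x - x₀)
      rw [← h] at hmax₀
      have h8 : Ψ (0, x) ≤ θ * x₀ - (C + 1) * t₀ := by
        simp only [hΨ, zero_sub]
        linarith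
      have := hCκ.trans_le (min_le_left _ _)
      linarith
  -- Off x₀ the penalty is smooth with space slope ±L and time slope at least −(C + 1), so the
  -- subsolution inequality would give G(±L) ≤ C + 1 + CF, against the choice of L.
  have hx : x = x₀ := by
    by_contra hne
    have key : ∀ σ : ℝ, (∀ᶠ y in 𝓝 x, |y - x₀| = σ * (y - x₀)) → C + 1 + CF < G (L * σ) →
        False := by
      intro σ hσ hGσ
      have hφ : ContDiff ℝ 1
          fun q : ℝ × ℝ => (C + 1) * √((q.1 - t₀) ^ 2 + κ ^ 2) + L * (σ * (q.2 - x₀)) := by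
        have : ContDiff ℝ 1 fun q : ℝ × ℝ => √((q.1 - t₀) ^ 2 + κ ^ 2) :=
          ContDiff.sqrt (by fun_prop) fun q => (hχpos _).ne'
        exact (contDiff_const.mul this).add (by fun_prop)
      have := hw.sub s x hs0 _ hφ (by
        filter_upwards [(continuous_fst.tendsto (s, x)).eventually (lt_mem_nhds hs0),
          (continuous_snd.tendsto (s, x)).eventually hσ] with q h1 h2
        have h3 := hmax q (le_of_lt h1)
        have h4 := hσ.self_of_nhds
        simp only [hΨ, hχ] at h3
        simp only [Function.uncurry]
        rw [h2, h4] at h3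
        linarith)
      have d1 : HasDerivAt
          (fun τ => (C + 1) * √((τ - t₀) ^ 2 + κ ^ 2) + L * (σ * (x - x₀)))
          ((C + 1) * (2 * (s - t₀) / (2 * √((s - t₀) ^ 2 + κ ^ 2)))) s :=
        ((((hasDerivAt_sq_sub s t₀).add_const (κ ^ 2)).sqrt (hχpos _).ne').const_mul
          (C + 1)).add_const _
      have d2 : HasDerivAt
          (fun y => (C + 1) * √((s - t₀) ^ 2 + κ ^ 2) + L * (σ * (y - x₀))) (L * σ) x := by
        have := ((((hasDerivAt_id x).sub_const x₀).const_mul σ).const_mul L).const_add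
          ((C + 1) * √((s - t₀) ^ 2 + κ ^ 2))
        exact this.congr_deriv (by simp)
      rw [d1.deriv, d2.deriv] at this
      have hsq : 0 < √((s - t₀) ^ 2 + κ ^ 2) := Real.sqrt_pos.2 (hχpos _)
      have h5 : -1 ≤ 2 * (s - t₀) / (2 * √((s - t₀) ^ 2 + κ ^ 2)) := by
        rw [mul_div_mul_left _ _ two_ne_zero, le_div_iff₀ hsq]
        have := hχ1 (s - t₀)
        have := neg_abs_le (s - t₀)
        simp only [hχ] at *
        linarith
      have h6 := (abs_le.1 (D.boundF x)).1
      have h7 : (C + 1) * -1 ≤ (C + 1) * (2 * (s - t₀) / (2 * √((s - t₀) ^ 2 + κ ^ 2))) := by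
        gcongr
      linarith
    rcases lt_or_gt_of_ne hne with h | h
    · refine key (-1) ?_ (by simpa using D.large_neg)
      filter_upwards [gt_mem_nhds h] with y hy
      rw [abs_of_neg (sub_neg.2 hy)]; ring
    · refine key 1 ?_ (by simpa using D.large_pos)
      filter_upwards [lt_mem_nhds h] with y hy
      rw [abs_of_pos (sub_pos.2 hy)]; ring
  subst hx
  -- On the line x = x₀ the remaining gap in time is paid by the time convolution of `w`, itself a
  -- competitor.
  have h1 := hmax (s₁, x₁) hs₁
  have h2 := le_perronSolution (hw.timeSupConv_mem D) ht₀.le x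
  have h3 := hw.le_timeSupConv D ht₀ hs x
  have h4 : (C + 1) * |s - t₀| ≤ (C + 1) * χ (s - t₀) := by gcongr; exact hχ1 _
  have h5 : (C + 1) * χ (s₁ - t₀) ≤ (C + 1) * (|s₁ - t₀| + κ) := by gcongr; exact hχ2 _
  have h6 := hCκ.trans_le (min_le_right _ _)
  rw [abs_sub_comm] at h3
  simp only [hΨ, sub_self, abs_zero, mul_zero, sub_zero] at h1
  linarith

lemma perronSolution_sub_le (D : PerronData G F θ C CF L) {t s : ℝ} (ht : 0 ≤ t) (hs : 0 ≤ s)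
    (x y : ℝ) :
    perronSolution G F θ C s y ≤
      perronSolution G F θ C t x + (C + 1) * |s - t| + L * |y - x| := by
  refine D.perronSolution_le fun w hw => ?_
  rcases ht.lt_or_eq with h | h
  · exact D.apply_le_perronSolution_add hw h hs x y
  · rw [← h, D.perronSolution_zero]
    have h1 := hw.upper s y hs
    have h2 := le_abs_self (θ * (y - x))
    rw [abs_mul] at h2
    have h3 : |θ| * |y - x| ≤ L * |y - x| := by
      gcongr; linarith [D.L_ge]
    rw [sub_zero, abs_of_nonneg hs]
    linarith

lemma abs_perronSolution_sub_le (D : PerronData G F θ C CF L) {t s : ℝ} (ht : 0 ≤ t)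
    (hs : 0 ≤ s) (x y : ℝ) :
    |perronSolution G F θ C s y - perronSolution G F θ C t x|
      ≤ (C + 1) * |s - t| + L * |y - x| := by
  have h1 := D.perronSolution_sub_le ht hs x y
  have h2 := D.perronSolution_sub_le hs ht y x
  rw [abs_sub_comm t, abs_sub_comm x] at h2
  rw [abs_le]
  constructor <;> linarith

/-- Competitors are not bounded at negative times, hence the truncation of time at 0. -/
lemma continuous_perronSolution_max (D : PerronData G F θ C CF L) :
    Continuous fun q : ℝ × ℝ => perronSolution G F θ C (max q.1 0) q.2 := by
  rw [continuous_iff_continuousAt]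
  intro q
  rw [ContinuousAt, tendsto_iff_dist_tendsto_zero]
  refine squeeze_zero (fun _ => dist_nonneg) (fun p => D.abs_perronSolution_sub_le
    (le_max_right _ _) (le_max_right _ _) _ _) ?_
  have : Continuous fun p : ℝ × ℝ =>
    (C + 1) * |max p.1 0 - max q.1 0| + L * |p.2 - q.2| := by fun_prop
  simpa using this.tendsto q

lemma uniformContinuousOn_perronSolution (D : PerronData G F θ C CF L) :
    UniformContinuousOn (Function.uncurry (perronSolution G F θ C)) (Ici 0 ×ˢ univ) := by
  have hC := D.C_nonneg
  have hL : 0 < L := by linarith [D.L_ge, abs_nonneg θ]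
  rw [Metric.uniformContinuousOn_iff]
  intro ε hε
  refine ⟨ε / (C + 1 + L), by positivity, ?_⟩
  rintro ⟨t, x⟩ ht ⟨s, y⟩ hs hd
  rw [Prod.dist_eq, max_lt_iff, Real.dist_eq, Real.dist_eq] at hd
  simp only at hd
  have h := D.abs_perronSolution_sub_le hs.1 ht.1 y x
  rw [Real.dist_eq]
  refine h.trans_lt ?_
  calc (C + 1) * |t - s| + L * |x - y|
      < (C + 1) * (ε / (C + 1 + L)) + L * (ε / (C + 1 + L)) := by
        refine add_lt_add ?_ ?_
        · exact mul_lt_mul_of_pos_left hd.1 (by positivity)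
        · exact mul_lt_mul_of_pos_left hd.2 (by positivity)
    _ = ε := by field_simp

lemma perronSolution_isSub (D : PerronData G F θ C CF L) :
    IsViscositySub (fun p x => G p + F x) (perronSolution G F θ C) := by
  refine isViscositySub_of_approx D.contH fun t x ht ε hε => ?_
  obtain ⟨w, hw, h⟩ := D.exists_lt_of_lt_perronSolution
    (sub_lt_self (perronSolution G F θ C t x) hε)
  exact ⟨w, hw.continuous, hw.sub, fun s y hs => le_perronSolution hw hs.le y, h⟩

lemma perronSolution_lower (D : PerronData G F θ C CF L) {t : ℝ} (ht : 0 ≤ t) (x : ℝ) :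
    θ * x - C * t ≤ perronSolution G F θ C t x :=
  le_perronSolution D.barrier ht x

lemma perronSolution_upper (D : PerronData G F θ C CF L) {t : ℝ} (ht : 0 ≤ t) (x : ℝ) :
    perronSolution G F θ C t x ≤ θ * x + C * t :=
  D.perronSolution_le fun _ hw => hw.upper t x ht

open Classical in
/-- Perron's bump construction: if `χ` is a smooth strict subsolution on a ball, below the upper
barrier there, and below `u` outside a smaller neighbourhood of the centre, then
`max u χ` belongs to Perron's class. -/
lemma bump_mem (D : PerronData G F θ C CF L) {z₀ : ℝ × ℝ} {ρ : ℝ}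
    {χ : ℝ × ℝ → ℝ} (hχ : ContDiff ℝ 1 χ) {N : Set (ℝ × ℝ)} (hN : IsClosed N)
    (hNball : N ⊆ Metric.ball z₀ ρ)
    (hball : ∀ z ∈ Metric.ball z₀ ρ, hjOperator (fun p x => G p + F x) χ z ≤ 0 ∧
      χ z ≤ θ * z.2 + C * z.1 ∧ (z ∉ N → χ z ≤ perronSolution G F θ C (max z.1 0) z.2)) :
    PerronClass G F θ C fun t x => if (t, x) ∈ N then
      max (perronSolution G F θ C (max t 0) x) (χ (t, x)) else
        perronSolution G F θ C (max t 0) x := by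
  set U : ℝ × ℝ → ℝ := fun q => perronSolution G F θ C (max q.1 0) q.2 with hU
  have hUc : Continuous U := D.continuous_perronSolution_max
  set W : ℝ × ℝ → ℝ := fun q => if q ∈ N then max (U q) (χ q) else U q with hW
  have hUW : ∀ q, U q ≤ W q := fun q => by
    simp only [hW]; split_ifs
    · exact le_max_left _ _
    · exact le_rfl
  have hWball : ∀ q ∈ Metric.ball z₀ ρ, W q = max (U q) (χ q) := fun q hq => by
    simp only [hW]; split_ifs with h
    · rfl
    · exact (max_eq_left ((hball q hq).2.2 h)).symm
  have hWout : ∀ q ∉ N, W q = U q := fun q hq => by simp only [hW, if_neg hq]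
  change PerronClass G F θ C fun t x => W (t, x)
  refine ⟨?_, ?_, ?_, ?_⟩
  · change Continuous W
    rw [continuous_iff_continuousAt]
    intro q
    by_cases hq : q ∈ N
    · have h1 : W =ᶠ[𝓝 q] fun q => max (U q) (χ q) :=
        Filter.eventually_of_mem (Metric.isOpen_ball.mem_nhds (hNball hq)) hWball
      exact (continuousAt_congr h1).2 (hUc.max hχ.continuous).continuousAt
    · have h1 : W =ᶠ[𝓝 q] U :=
        Filter.eventually_of_mem (hN.isOpen_compl.mem_nhds hq) hWout
      exact (continuousAt_congr h1).2 hUc.continuousAt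
  · intro t x ht φ hφ hmax
    by_cases heq : W (t, x) = U (t, x)
    · refine D.perronSolution_isSub t x ht φ hφ ?_
      filter_upwards [hmax, (continuous_fst.tendsto (t, x)).eventually (lt_mem_nhds ht)]
        with q h1 h2
      have h3 := hUW q
      have h4 : max q.1 0 = q.1 := max_eq_left (le_of_lt h2)
      simp only [Function.uncurry] at h1 ⊢
      rw [heq] at h1
      simp only [hU, h4, max_eq_left ht.le] at h1 h3
      linarith
    · have hq : (t, x) ∈ N := by
        by_contra h; exact heq (hWout _ h)
      have hb := hNball hq
      have hWχ : W (t, x) = χ (t, x) := by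
        rw [hWball _ hb] at heq ⊢
        rcases max_choice (U (t, x)) (χ (t, x)) with h | h
        · exact absurd h heq
        · exact h
      obtain ⟨e1, e2⟩ := partials_eq_of_isLocalExtr (φ := φ) (ψ := χ)
        ((hφ.differentiable one_ne_zero) (t, x)) ((hχ.differentiable one_ne_zero) (t, x))
        (Or.inr (by
          filter_upwards [hmax, Metric.isOpen_ball.mem_nhds hb] with q h1 h2
          have h3 := hWball q h2
          have h4 := le_max_right (U q) (χ q)
          simp only [Function.uncurry] at h1
          rw [hWχ] at h1
          linarith))
      rw [e1, e2]
      exact (hball _ hb).1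
  · intro t x ht
    refine le_trans ?_ (hUW (t, x))
    simp only [hU, max_eq_left ht]
    exact D.perronSolution_lower ht x
  · intro t x ht
    have h1 : U (t, x) ≤ θ * x + C * t := by
      simp only [hU, max_eq_left ht]
      exact D.perronSolution_upper ht x
    simp only [hW]
    split_ifs with h
    · exact max_le h1 (hball _ (hNball h)).2.1
    · exact h1

/-- If the inequality failed, the test function, bent down by a quadratic and raised by κ, could be
patched into the supremum and would give a competitor that is larger at the contact point. -/
lemma perronSolution_isSuper (D : PerronData G F θ C CF L) :
    IsViscositySuper (fun p x => G p + F x) (perronSolution G F θ C) := by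
  classical
  intro t x ht φ hφ hmin
  by_contra! hneg
  have hφd : Differentiable ℝ φ := hφ.differentiable one_ne_zero
  set u := perronSolution G F θ C with hu
  -- The bump needs room. At contact with the barrier, φ would touch the barrier from below and
  -- inherit its gradient (C, θ), for which the operator is nonnegative.
  have hupper : u t x < θ * x + C * t := by
    refine (D.perronSolution_upper ht.le x).lt_of_ne fun heq => ?_
    obtain ⟨e1, e2⟩ := partials_eq_of_isLocalExtr (φ := φ)
      (ψ := Function.uncurry fun t x => θ * x + C * t)
      (hφd _) (by unfold Function.uncurry; fun_prop) (Or.inl (by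
        filter_upwards [hmin, (continuous_fst.tendsto (t, x)).eventually (lt_mem_nhds ht)]
          with q h1 h2
        have h3 := D.perronSolution_upper (le_of_lt h2) q.2
        simp only [Function.uncurry] at h1 h3 ⊢
        rw [← hu] at h3
        rw [hu, heq, ← hu] at h1
        linarith))
    have d1 : HasDerivAt (fun s => θ * x + C * s) C t := by
      simpa using ((hasDerivAt_id t).const_mul C).const_add (θ * x)
    have d2 : HasDerivAt (fun y => θ * y + C * t) θ x := by
      simpa using ((hasDerivAt_id x).const_mul θ).add_const (C * t)
    rw [e1, e2] at hneg
    simp only [Function.uncurry, d1.deriv, d2.deriv] at hneg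
    linarith [neg_abs_le (G θ), (abs_le.1 (D.boundF x)).1, D.C_ge]
  set χ₀ : ℝ × ℝ → ℝ := fun q =>
    φ q + (u t x - φ (t, x)) + (-1) * ((q.1 - t) ^ 2 + (q.2 - x) ^ 2) with hχ₀
  have hχ₀c : ContDiff ℝ 1 χ₀ := by fun_prop
  have hχ₀neg : hjOperator (fun p x => G p + F x) χ₀ (t, x) < 0 := by
    have := hjOperator_add_sq (H := fun p x => G p + F x) hφd (-1) (u t x - φ (t, x)) (t, x)
    rw [hχ₀]
    exact this ▸ hneg
  have hχ₀val : χ₀ (t, x) = u t x := by simp [hχ₀]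
  set g := (θ * x + C * t - u t x) / 2 with hg
  have hg0 : 0 < g := by rw [hg]; linarith
  have hcont : Continuous fun q : ℝ × ℝ => θ * q.2 + C * q.1 - χ₀ q :=
    Continuous.sub (by fun_prop) hχ₀c.continuous
  have hev : ∀ᶠ z in 𝓝 (t, x), hjOperator (fun p x => G p + F x) χ₀ z < 0 ∧ 0 < z.1 ∧
      g < θ * z.2 + C * z.1 - χ₀ z ∧
      Function.uncurry u (t, x) - φ (t, x) ≤ Function.uncurry u z - φ z :=
    ((continuous_hjOperator D.contH hχ₀c).tendsto _ |>.eventually (gt_mem_nhds hχ₀neg)).and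
      (((continuous_fst.tendsto (t, x)).eventually (lt_mem_nhds ht)).and
        ((hcont.tendsto (t, x) |>.eventually (lt_mem_nhds (by
          simp only [hχ₀val, hg]; linarith))).and hmin))
  obtain ⟨ρ, hρ, hball⟩ := Metric.mem_nhds_iff.1 hev
  -- κ ≤ g keeps the raised bump under the barrier; κ ≤ ρ²/2 keeps the set where it may exceed `u`
  -- inside the ball.
  set κ := min g (ρ ^ 2 / 2) with hκ
  have hκ0 : 0 < κ := lt_min hg0 (by positivity)
  set χ : ℝ × ℝ → ℝ := fun q => χ₀ q + κ with hχ
  have hχop : ∀ z, hjOperator (fun p x => G p + F x) χ z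
      = hjOperator (fun p x => G p + F x) χ₀ z := fun z => by
    simp only [hjOperator, hχ, deriv_add_const]
  set N : Set (ℝ × ℝ) := {q | (q.1 - t) ^ 2 + (q.2 - x) ^ 2 ≤ κ} with hN
  have hmem := D.bump_mem (z₀ := (t, x)) (ρ := ρ) (χ := χ) (hχ₀c.add contDiff_const) (N := N)
    (isClosed_le (by fun_prop) continuous_const) (by
      rintro ⟨s, y⟩ hz
      have hz' : (s - t) ^ 2 + (y - x) ^ 2 ≤ κ := hz
      have h1 : κ ≤ ρ ^ 2 / 2 := min_le_right _ _
      have h2 : 0 < ρ ^ 2 := by positivity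
      rw [Metric.mem_ball, Prod.dist_eq, max_lt_iff, Real.dist_eq, Real.dist_eq]
      constructor <;> refine abs_lt_of_sq_lt_sq ?_ hρ.le <;> nlinarith) (by
      rintro ⟨s, y⟩ hz
      obtain ⟨b1, b2, b3, b4⟩ := hball hz
      have h1 : κ ≤ g := min_le_left _ _
      refine ⟨by rw [hχop]; exact b1.le, by simp only [hχ]; linarith, fun hz => ?_⟩
      have hz' : κ < (s - t) ^ 2 + (y - x) ^ 2 := not_le.1 hz
      simp only [Function.uncurry] at b4 b2
      simp only [hχ, hχ₀, max_eq_left b2.le, ← hu]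
      linarith)
  have h1 := le_perronSolution hmem ht.le x
  have h2 : (t, x) ∈ N := by simp [hN, hκ0.le]
  rw [if_pos h2] at h1
  have h3 := (le_max_right _ _).trans h1
  simp only [hχ, hχ₀val, ← hu] at h3
  linarith

end PerronData

lemma exists_perronData {G F : ℝ → ℝ} (hG : Continuous G) (hGtop : Tendsto G atTop atTop)
    (hGbot : Tendsto G atBot atTop) (hF : Continuous F) {CF : ℝ} (hCF : ∀ x, |F x| ≤ CF) (θ : ℝ) :
    ∃ L, PerronData G F θ (|G θ| + CF) CF L := by
  obtain ⟨L, h1, h2, h3⟩ := ((hGtop.eventually_gt_atTop (|G θ| + CF + 1 + CF)).and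
    (((hGbot.comp tendsto_neg_atTop_atBot).eventually_gt_atTop (|G θ| + CF + 1 + CF)).and
      (eventually_ge_atTop (|θ| + 1)))).exists
  exact ⟨L, hG, hF, hCF, le_rfl, h3, h1, h2⟩

theorem existsUnique_viscositySolution {G F : ℝ → ℝ} (hG : Continuous G)
    (hGtop : Tendsto G atTop atTop) (hGbot : Tendsto G atBot atTop) (hF : UniformContinuous F)
    {CF : ℝ} (hCF : ∀ x, |F x| ≤ CF) (θ : ℝ) :
    ∃ u : ℝ → ℝ → ℝ, IsUCViscositySolution (fun p x => G p + F x) (fun x => θ * x) u ∧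
      ∀ u' : ℝ → ℝ → ℝ, IsUCViscositySolution (fun p x => G p + F x) (fun x => θ * x) u' →
        ∀ t x : ℝ, 0 ≤ t → u' t x = u t x := by
  obtain ⟨L, D⟩ := exists_perronData hG hGtop hGbot hF.continuous hCF θ
  refine ⟨perronSolution G F θ (|G θ| + CF), ⟨D.uniformContinuousOn_perronSolution,
    D.perronSolution_zero, D.perronSolution_isSub, D.perronSolution_isSuper⟩, ?_⟩
  intro u' hu' t x ht
  refine le_antisymm ?_ ?_
  · exact viscosity_comparison hG hF hu'.uniformContinuousOn D.uniformContinuousOn_perronSolution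
      hu'.subsolution D.perronSolution_isSuper
      (fun x => by rw [hu'.initial, D.perronSolution_zero]) t x ht
  · exact viscosity_comparison hG hF D.uniformContinuousOn_perronSolution hu'.uniformContinuousOn
      D.perronSolution_isSub hu'.supersolution
      (fun x => by rw [hu'.initial, D.perronSolution_zero]) t x ht


/-! ### Viscosity solutions with a piecewise continuous slope -/

lemma intervalIntegrable_of_abs_le {s : ℝ → ℝ} (hs : Measurable s) {K : ℝ} (hK : ∀ x, |s x| ≤ K)
    (a b : ℝ) : IntervalIntegrable s volume a b :=
  (intervalIntegrable_const (c := K)).mono_fun hs.aestronglyMeasurable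
    (ae_of_all _ fun x => (hK x).trans (le_abs_self K))

lemma hasDerivWithinAt_integral_Ici {s : ℝ → ℝ} (hs : Measurable s) {K : ℝ} (hK : ∀ x, |s x| ≤ K)
    (a : ℝ) {x p : ℝ} (h : Tendsto s (𝓝[>] x) (𝓝 p)) :
    HasDerivWithinAt (fun y => ∫ z in a..y, s z) p (Ici x) x :=
  intervalIntegral.integral_hasDerivWithinAt_of_tendsto_ae_right
    (intervalIntegrable_of_abs_le hs hK a x) (s := Ici x) (t := Ioi x)
    hs.stronglyMeasurable.stronglyMeasurableAtFilter (h.mono_left inf_le_left)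

lemma hasDerivWithinAt_integral_Iic {s : ℝ → ℝ} (hs : Measurable s) {K : ℝ} (hK : ∀ x, |s x| ≤ K)
    (a : ℝ) {x p : ℝ} (h : Tendsto s (𝓝[<] x) (𝓝 p)) :
    HasDerivWithinAt (fun y => ∫ z in a..y, s z) p (Iic x) x := by
  refine intervalIntegral.integral_hasDerivWithinAt_of_tendsto_ae_right
    (intervalIntegrable_of_abs_le hs hK a x) (s := Iic x) (t := Iic x)
    hs.stronglyMeasurable.stronglyMeasurableAtFilter (h.mono_left ?_)
  -- The left-hand form of the fundamental theorem uses the closed half-line, so the single point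
  -- `x` is discarded as a null set.
  have : ({x}ᶜ : Set ℝ) ∈ ae (volume : Measure ℝ) := by
    rw [mem_ae_iff, compl_compl]; exact measure_singleton x
  refine le_inf (inf_le_left.trans nhdsWithin_le_nhds) (le_principal_iff.2 ?_)
  filter_upwards [inf_le_left (a := 𝓝[≤] x) self_mem_nhdsWithin, inf_le_right (a := 𝓝[≤] x) this]
    with y h1 h2 using lt_of_le_of_ne h1 h2

lemma HasDerivWithinAt.nonpos_of_isLocalMax_right {f : ℝ → ℝ} {x d : ℝ}
    (hf : HasDerivWithinAt f d (Ici x) x) (h : IsLocalMax f x) : d ≤ 0 := by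
  rw [hasDerivWithinAt_iff_tendsto_slope] at hf
  have hne : Ici x \ {x} = Ioi x := by ext; simp [lt_iff_le_and_ne]
  rw [hne] at hf
  refine le_of_tendsto hf ?_
  filter_upwards [nhdsWithin_le_nhds h, self_mem_nhdsWithin] with y h1 h2
  rw [slope_def_field]
  exact div_nonpos_of_nonpos_of_nonneg (sub_nonpos.2 h1) (sub_nonneg.2 (le_of_lt h2))

lemma HasDerivWithinAt.nonneg_of_isLocalMax_left {f : ℝ → ℝ} {x d : ℝ}
    (hf : HasDerivWithinAt f d (Iic x) x) (h : IsLocalMax f x) : 0 ≤ d := by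
  rw [hasDerivWithinAt_iff_tendsto_slope] at hf
  have hne : Iic x \ {x} = Iio x := by ext; simp [lt_iff_le_and_ne]
  rw [hne] at hf
  refine ge_of_tendsto hf ?_
  filter_upwards [nhdsWithin_le_nhds h, self_mem_nhdsWithin] with y h1 h2
  rw [slope_def_field]
  exact div_nonneg_of_nonpos (sub_nonpos.2 h1) (sub_nonpos.2 (le_of_lt h2))

/-- The jets of a travelling profile `∫ s + c - lam t` at a maximum of its difference with a
smooth function. -/
lemma profile_jet {s : ℝ → ℝ} (hs : Measurable s) {K : ℝ} (hK : ∀ x, |s x| ≤ K)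
    (a c lam : ℝ) {t x pl pr : ℝ} (hl : Tendsto s (𝓝[<] x) (𝓝 pl))
    (hr : Tendsto s (𝓝[>] x) (𝓝 pr)) {φ : ℝ × ℝ → ℝ} (hφ : Differentiable ℝ φ)
    (hmax : IsLocalMax (fun q : ℝ × ℝ => (∫ z in a..q.2, s z) + c - lam * q.1 - φ q) (t, x)) :
    deriv (fun τ => φ (τ, x)) t = -lam ∧ deriv (fun y => φ (t, y)) x ∈ Icc pr pl := by
  have hφ1 : DifferentiableAt ℝ (fun τ => φ (τ, x)) t := by fun_prop
  have hφ2 : DifferentiableAt ℝ (fun y => φ (t, y)) x := by fun_prop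
  have m1 : IsLocalMax (fun τ => (∫ z in a..x, s z) + c - lam * τ - φ (τ, x)) t :=
    (show Continuous fun τ : ℝ => (τ, x) by fun_prop).tendsto t |>.eventually hmax
  have m2 : IsLocalMax (fun y => (∫ z in a..y, s z) + c - lam * t - φ (t, y)) x :=
    (show Continuous fun y : ℝ => (t, y) by fun_prop).tendsto x |>.eventually hmax
  have d1 : HasDerivAt (fun τ => (∫ z in a..x, s z) + c - lam * τ - φ (τ, x))
      (-lam - deriv (fun τ => φ (τ, x)) t) t := by
    have := (((hasDerivAt_id t).const_mul lam).const_sub ((∫ z in a..x, s z) + c)).sub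
      hφ1.hasDerivAt
    exact this.congr_deriv (by simp)
  have dr := (((hasDerivWithinAt_integral_Ici hs hK a hr).add_const c).sub_const (lam * t)).sub
    hφ2.hasDerivAt.hasDerivWithinAt
  have dl := (((hasDerivWithinAt_integral_Iic hs hK a hl).add_const c).sub_const (lam * t)).sub
    hφ2.hasDerivAt.hasDerivWithinAt
  have e1 := m1.hasDerivAt_eq_zero d1
  have e2 := dr.nonpos_of_isLocalMax_right m2
  have e3 := dl.nonneg_of_isLocalMax_left m2
  exact ⟨by linarith, by linarith, by linarith⟩

/-- A smooth function touching the profile from above has its space slope in `Icc pr pl` and its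
time slope equal to −lam. At a strictly convex kink this interval is empty and nothing is required.
-/
lemma isViscositySub_profile {G F s : ℝ → ℝ} (hs : Measurable s) {K : ℝ} (hK : ∀ x, |s x| ≤ K)
    (a c lam : ℝ) (h : ∀ x, ∃ pl pr, Tendsto s (𝓝[<] x) (𝓝 pl) ∧ Tendsto s (𝓝[>] x) (𝓝 pr) ∧
      ∀ p ∈ Icc pr pl, G p + F x ≤ lam) :
    IsViscositySub (fun p x => G p + F x) fun t x => (∫ z in a..x, s z) + c - lam * t := by
  intro t x ht φ hφ hmax
  obtain ⟨pl, pr, hl, hr, hp⟩ := h x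
  obtain ⟨e1, e2⟩ := profile_jet hs hK a c lam hl hr (hφ.differentiable one_ne_zero) hmax
  have := hp _ e2
  rw [e1]
  linarith

lemma isViscositySuper_profile {G F s : ℝ → ℝ} (hs : Measurable s) {K : ℝ} (hK : ∀ x, |s x| ≤ K)
    (a c lam : ℝ) (h : ∀ x, ∃ pl pr, Tendsto s (𝓝[<] x) (𝓝 pl) ∧ Tendsto s (𝓝[>] x) (𝓝 pr) ∧
      ∀ p ∈ Icc pl pr, lam ≤ G p + F x) :
    IsViscositySuper (fun p x => G p + F x) fun t x => (∫ z in a..x, s z) + c - lam * t := by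
  intro t x ht φ hφ hmin
  obtain ⟨pl, pr, hl, hr, hp⟩ := h x
  have hmax : IsLocalMax (fun q : ℝ × ℝ => (∫ z in a..q.2, -s z) + -c - -lam * q.1 - -φ q)
      (t, x) := by
    filter_upwards [hmin] with q hq
    simp only [Function.uncurry, intervalIntegral.integral_neg] at hq ⊢
    linarith
  obtain ⟨e1, e2⟩ := profile_jet hs.neg (K := K) (fun x => by simpa using hK x) a (-c) (-lam)
    hl.neg hr.neg (hφ.differentiable one_ne_zero).neg hmax
  simp only [Pi.neg_apply, deriv.fun_neg] at e1 e2
  have := hp (deriv (fun y => φ (t, y)) x) ⟨by linarith [e2.2], by linarith [e2.1]⟩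
  linarith

lemma uniformContinuousOn_profile {s : ℝ → ℝ} (hs : Measurable s) {K : ℝ} (hK : ∀ x, |s x| ≤ K)
    (a c lam : ℝ) :
    UniformContinuousOn (Function.uncurry fun t x => (∫ z in a..x, s z) + c - lam * t)
      (Ici 0 ×ˢ univ) := by
  have hK0 : 0 ≤ K := (abs_nonneg _).trans (hK 0)
  have h1 : LipschitzWith K.toNNReal fun x => ∫ z in a..x, s z := by
    refine LipschitzWith.of_dist_le_mul fun x y => ?_
    rw [Real.dist_eq, Real.dist_eq, Real.coe_toNNReal K hK0,
      intervalIntegral.integral_interval_sub_left (intervalIntegrable_of_abs_le hs hK _ _)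
        (intervalIntegrable_of_abs_le hs hK _ _)]
    exact intervalIntegral.norm_integral_le_of_norm_le_const (f := s) (C := K) fun z _ => hK z
  have h2 : UniformContinuous fun q : ℝ × ℝ => (∫ z in a..q.2, s z) :=
    h1.uniformContinuous.comp uniformContinuous_snd
  have h3 : UniformContinuous fun q : ℝ × ℝ => lam * q.1 :=
    (lipschitzWith_smul lam).uniformContinuous.comp uniformContinuous_fst
  exact ((h2.add uniformContinuous_const).sub h3).uniformContinuousOn


/-! ### The two monotone inverse branches -/

/-- Continuity of G plays no role: a jump of the inverse would skip some a in the order-convex set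
S, and G a then separates the corresponding values. -/
lemma continuousOn_rightInverse_of_strictAntiOn {G g : ℝ → ℝ} {S T : Set ℝ}
    (hG : StrictAntiOn G S) (hS : S.OrdConnected) (hg : ∀ w ∈ T, g w ∈ S ∧ G (g w) = w) :
    ContinuousOn g T := by
  intro w hw
  rw [ContinuousWithinAt, tendsto_order]
  constructor
  · intro a ha
    by_cases haS : a ∈ S
    · have h1 : w < G a := by
        have := hG haS (hg w hw).1 ha
        rwa [(hg w hw).2] at this
      filter_upwards [nhdsWithin_le_nhds (gt_mem_nhds h1), self_mem_nhdsWithin] with v hv hvT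
      by_contra! hle
      have := hG.antitoneOn (hg v hvT).1 haS hle
      rw [(hg v hvT).2] at this
      linarith
    · filter_upwards [self_mem_nhdsWithin] with v hvT
      by_contra! hle
      exact haS (hS.out (hg v hvT).1 (hg w hw).1 ⟨hle, ha.le⟩)
  · intro a ha
    by_cases haS : a ∈ S
    · have h1 : G a < w := by
        have := hG (hg w hw).1 haS ha
        rwa [(hg w hw).2] at this
      filter_upwards [nhdsWithin_le_nhds (lt_mem_nhds h1), self_mem_nhdsWithin] with v hv hvT
      by_contra! hle
      have := hG.antitoneOn haS (hg v hvT).1 hle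
      rw [(hg v hvT).2] at this
      linarith
    · filter_upwards [self_mem_nhdsWithin] with v hvT
      by_contra! hle
      exact haS (hS.out (hg w hw).1 (hg v hvT).1 ⟨ha.le, hle⟩)

namespace IsDoubleWell

variable {G : ℝ → ℝ} {m M pm pM : ℝ}

lemma invG₁_spec (hG : IsDoubleWell G m M pm pM) {w : ℝ} (hw : m ≤ w) :
    invG₁ G pm w ∈ Iic pm ∧ G (invG₁ G pm w) = w := by
  have hex : ∃ p ∈ Iic pm, G p = w := by
    obtain ⟨q, hq, hqw⟩ := ((hG.coercive_bot.eventually_ge_atTop w).and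
      (eventually_le_atBot pm)).exists
    obtain ⟨p, hp, hpw⟩ := intermediate_value_Icc' hqw hG.continuous.continuousOn
      (show w ∈ Icc (G pm) (G q) from ⟨hG.map_pm.trans_le hw, hq⟩)
    exact ⟨p, hp.2, hpw⟩
  exact ⟨Function.invFunOn_mem hex, Function.invFunOn_eq hex⟩

lemma invG₃_spec (hG : IsDoubleWell G m M pm pM) {w : ℝ} (hw : w ∈ Icc 0 M) :
    invG₃ G pM w ∈ Icc pM 0 ∧ G (invG₃ G pM w) = w := by
  have hex : ∃ p ∈ Icc pM 0, G p = w := by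
    obtain ⟨p, hp, hpw⟩ := intermediate_value_Icc' hG.pM_neg.le hG.continuous.continuousOn
      (show w ∈ Icc (G 0) (G pM) from ⟨hG.map_zero.trans_le hw.1, hw.2.trans hG.map_pM.ge⟩)
    exact ⟨p, hp, hpw⟩
  exact ⟨Function.invFunOn_mem hex, Function.invFunOn_eq hex⟩

lemma continuousOn_invG₁ (hG : IsDoubleWell G m M pm pM) : ContinuousOn (invG₁ G pm) (Ici m) :=
  continuousOn_rightInverse_of_strictAntiOn hG.anti_left ordConnected_Iic
    fun _ hw => hG.invG₁_spec hw

lemma continuousOn_invG₃ (hG : IsDoubleWell G m M pm pM) :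
    ContinuousOn (invG₃ G pM) (Icc 0 M) :=
  continuousOn_rightInverse_of_strictAntiOn hG.anti_right ordConnected_Icc
    fun _ hw => hG.invG₃_spec hw

lemma invG₁_lt (hG : IsDoubleWell G m M pm pM) {w w' : ℝ} (hw : m ≤ w) (h : w < w') :
    invG₁ G pm w' < invG₁ G pm w := by
  obtain ⟨h1, h2⟩ := hG.invG₁_spec hw
  obtain ⟨h3, h4⟩ := hG.invG₁_spec (hw.trans h.le)
  by_contra! hle
  have := hG.anti_left.antitoneOn h1 h3 hle
  linarith

lemma invG₃_lt (hG : IsDoubleWell G m M pm pM) {w w' : ℝ} (hw : 0 ≤ w) (h : w < w')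
    (hw' : w' ≤ M) : invG₃ G pM w' < invG₃ G pM w := by
  obtain ⟨h1, h2⟩ := hG.invG₃_spec ⟨hw, h.le.trans hw'⟩
  obtain ⟨h3, h4⟩ := hG.invG₃_spec ⟨hw.trans h.le, hw'⟩
  by_contra! hle
  have := hG.anti_right.antitoneOn h1 h3 hle
  linarith

lemma invG₁_m (hG : IsDoubleWell G m M pm pM) : invG₁ G pm m = pm := by
  obtain ⟨h1, h2⟩ := hG.invG₁_spec le_rfl
  exact hG.anti_left.injOn h1 self_mem_Iic (h2.trans hG.map_pm.symm)

lemma invG₃_M (hG : IsDoubleWell G m M pm pM) : invG₃ G pM M = pM := by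
  obtain ⟨h1, h2⟩ := hG.invG₃_spec ⟨hG.zero_le_m.trans hG.m_lt_M.le, le_rfl⟩
  exact hG.anti_right.injOn h1 (left_mem_Icc.2 hG.pM_neg.le) (h2.trans hG.map_pM.symm)

end IsDoubleWell

/-! ### The first phase described by a backward looking condition -/

/-- The points `z` such that, looking back from `z`, the level `M` is reached before the path gets
below `m`. -/
def phaseSet (m M : ℝ) (W : ℝ → ℝ) : Set ℝ :=
  {z | ∃ a b, a ≤ z ∧ z < b ∧ M ≤ W a ∧ ∀ s ∈ Ico a b, m ≤ W s}

section phaseSet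

variable {m M : ℝ} {W W' : ℝ → ℝ}

lemma phaseSet_mono (h : ∀ s, W s ≤ W' s) : phaseSet m M W ⊆ phaseSet m M W' := by
  rintro z ⟨a, b, h1, h2, h3, h4⟩
  exact ⟨a, b, h1, h2, h3.trans (h a), fun s hs => (h4 s hs).trans (h s)⟩

/-- Translation covariance, which the anchoring of the switching sequences at 0 conceals. -/
lemma mem_phaseSet_comp_add (y z : ℝ) :
    z ∈ phaseSet m M (fun s => W (s + y)) ↔ z + y ∈ phaseSet m M W := by
  constructor
  · rintro ⟨a, b, h1, h2, h3, h4⟩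
    refine ⟨a + y, b + y, by linarith, by linarith, h3, fun s hs => ?_⟩
    have := h4 (s - y) ⟨by linarith [hs.1], by linarith [hs.2]⟩
    simpa using this
  · rintro ⟨a, b, h1, h2, h3, h4⟩
    refine ⟨a - y, b - y, by linarith, by linarith, by simpa using h3, fun s hs => ?_⟩
    exact h4 (s + y) ⟨by linarith [hs.1], by linarith [hs.2]⟩

lemma le_of_mem_phaseSet {z : ℝ} (hz : z ∈ phaseSet m M W) : m ≤ W z := by
  obtain ⟨a, b, h1, h2, h3, h4⟩ := hz
  exact h4 z ⟨h1, h2⟩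

lemma mem_phaseSet_of_le (hW : Continuous W) (hm : m < M) {z : ℝ} (hz : M ≤ W z) :
    z ∈ phaseSet m M W := by
  have h1 : ∀ᶠ s in 𝓝 z, m < W s := hW.continuousAt.eventually (lt_mem_nhds (hm.trans_le hz))
  obtain ⟨b, hb, h⟩ := exists_Ico_subset_of_mem_nhds h1 ⟨z + 1, by linarith⟩
  exact ⟨z, b, le_rfl, hb, hz, fun s hs => (h hs).le⟩

lemma lt_of_notMem_phaseSet (hW : Continuous W) (hm : m < M) {z : ℝ} (hz : z ∉ phaseSet m M W) :
    W z < M := by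
  by_contra! h
  exact hz (mem_phaseSet_of_le hW hm h)

/-- The requirement z < b makes membership persist to the right, matching the half-open intervals [x
i, y i). -/
lemma eventually_right_mem_phaseSet {z : ℝ} (hz : z ∈ phaseSet m M W) :
    ∀ᶠ y in 𝓝[>] z, y ∈ phaseSet m M W := by
  obtain ⟨a, b, h1, h2, h3, h4⟩ := hz
  filter_upwards [Ioo_mem_nhdsGT h2] with y hy
  exact ⟨a, b, h1.trans hy.1.le, hy.2, h3, h4⟩

lemma eventually_right_notMem_phaseSet (hW : Continuous W) (hm : m < M) {z : ℝ}
    (hz : z ∉ phaseSet m M W) : ∀ᶠ y in 𝓝[>] z, y ∉ phaseSet m M W := by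
  have h1 : ∀ᶠ s in 𝓝 z, W s < M :=
    hW.continuousAt.eventually (gt_mem_nhds (lt_of_notMem_phaseSet hW hm hz))
  obtain ⟨c, hc, h⟩ := exists_Ico_subset_of_mem_nhds h1 ⟨z + 1, by linarith⟩
  filter_upwards [Ioo_mem_nhdsGT hc] with y hy
  rintro ⟨a, b, h2, h3, h4, h5⟩
  by_cases haz : a ≤ z
  · exact hz ⟨a, b, haz, hy.1.trans h3, h4, h5⟩
  · exact h4.not_gt (h ⟨(not_le.1 haz).le, h2.trans_lt hy.2⟩)

/-- If W z > m, the first phase cannot be left near z once it is entered. If W z ≤ m < M, it cannot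
be entered near z once it is left. Either way, membership is eventually constant on the left. -/
lemma eventually_left_phaseSet (hW : Continuous W) (hm : m < M) (z : ℝ) :
    (∀ᶠ y in 𝓝[<] z, y ∈ phaseSet m M W) ∨ ∀ᶠ y in 𝓝[<] z, y ∉ phaseSet m M W := by
  by_cases hz : m < W z
  · have h1 : ∀ᶠ s in 𝓝 z, m < W s := hW.continuousAt.eventually (lt_mem_nhds hz)
    obtain ⟨c, hc, h⟩ := exists_Ioc_subset_of_mem_nhds h1 ⟨z - 1, by linarith⟩
    by_cases hex : ∃ y ∈ Ioo c z, y ∈ phaseSet m M W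
    · obtain ⟨y, hy, a, b, h2, h3, h4, h5⟩ := hex
      left
      filter_upwards [Ioo_mem_nhdsLT hy.2] with x hx
      refine ⟨a, z, h2.trans hx.1.le, hx.2, h4, fun s hs => ?_⟩
      by_cases hsb : s < b
      · exact h5 s ⟨hs.1, hsb⟩
      · exact (h ⟨hy.1.trans (h3.trans_le (not_lt.1 hsb)), hs.2.le⟩).le
    · right
      push Not at hex
      filter_upwards [Ioo_mem_nhdsLT hc] with x hx using hex x hx
  · have h1 : ∀ᶠ s in 𝓝 z, W s < M :=
      hW.continuousAt.eventually (gt_mem_nhds ((not_lt.1 hz).trans_lt hm))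
    obtain ⟨c, hc, h⟩ := exists_Ioc_subset_of_mem_nhds h1 ⟨z - 1, by linarith⟩
    by_cases hex : ∃ y ∈ Ioo c z, y ∉ phaseSet m M W
    · obtain ⟨y, hy, hyn⟩ := hex
      right
      filter_upwards [Ioo_mem_nhdsLT hy.2] with x hx
      rintro ⟨a, b, h2, h3, h4, h5⟩
      by_cases hay : a ≤ y
      · exact hyn ⟨a, b, hay, hx.1.trans h3, h4, h5⟩
      · exact h4.not_gt (h ⟨hy.1.trans (not_le.1 hay), h2.trans hx.2.le⟩)
    · left
      push Not at hex
      filter_upwards [Ioo_mem_nhdsLT hc] with x hx using hex x hx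

/-- The witness `a` of membership cannot lie left of z, so it is z itself and W z ≥ M; points
outside the phase give W ≤ M in the limit. -/
lemma eq_of_left_notMem_of_mem (hW : Continuous W) (hm : m < M) {z : ℝ}
    (hl : ∀ᶠ y in 𝓝[<] z, y ∉ phaseSet m M W) (hz : z ∈ phaseSet m M W) : W z = M := by
  refine le_antisymm ?_ ?_
  · exact le_of_tendsto (hW.continuousWithinAt (s := Iio z))
      (hl.mono fun y hy => (lt_of_notMem_phaseSet hW hm hy).le)
  · obtain ⟨a, b, h1, h2, h3, h4⟩ := hz
    rcases h1.lt_or_eq with h | h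
    · exfalso
      obtain ⟨y, hy, hy'⟩ := (hl.and (Ioo_mem_nhdsLT h)).exists
      exact hy ⟨a, b, hy'.1.le, hy'.2.trans h2, h3, h4⟩
    · rwa [← h]

/-- Were W z > m, the witness of a nearby left point could be prolonged beyond z. -/
lemma eq_of_left_mem_of_notMem (hW : Continuous W) {z : ℝ}
    (hl : ∀ᶠ y in 𝓝[<] z, y ∈ phaseSet m M W) (hz : z ∉ phaseSet m M W) : W z = m := by
  refine le_antisymm ?_ ?_
  · by_contra! hlt
    have h1 : ∀ᶠ s in 𝓝 z, m < W s := hW.continuousAt.eventually (lt_mem_nhds hlt)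
    obtain ⟨c, d, hcd, h⟩ := mem_nhds_iff_exists_Ioo_subset.1 h1
    obtain ⟨y, ⟨a, b, h2, h3, h4, h5⟩, hy'⟩ := (hl.and (Ioo_mem_nhdsLT hcd.1)).exists
    refine hz ⟨a, d, h2.trans hy'.2.le, hcd.2, h4, fun s hs => ?_⟩
    by_cases hsb : s < b
    · exact h5 s ⟨hs.1, hsb⟩
    · exact (h ⟨hy'.1.trans (h3.trans_le (not_lt.1 hsb)), hs.2⟩).le
  · exact ge_of_tendsto (hW.continuousWithinAt (s := Iio z))
      (hl.mono fun y hy => le_of_mem_phaseSet hy)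

lemma eventually_notMem_phaseSet (hW : Continuous W) {z : ℝ} (hz : W z < m) :
    ∀ᶠ y in 𝓝 z, y ∉ phaseSet m M W := by
  filter_upwards [hW.continuousAt.eventually (gt_mem_nhds hz)] with y hy
  exact fun h => (le_of_mem_phaseSet h).not_gt hy

end phaseSet

/-! ### The slope of the corrector -/

open Classical in
/-- The slope of the corrector, expressed through `phaseSet`. -/
def phaseSlope (G : ℝ → ℝ) (m M pm pM : ℝ) (W : ℝ → ℝ) (z : ℝ) : ℝ :=
  if z ∈ phaseSet m M W then invG₁ G pm (W z) else invG₃ G pM (W z)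

section phaseSlope

variable {G : ℝ → ℝ} {m M pm pM : ℝ} {W W' : ℝ → ℝ}

lemma phaseSlope_of_mem {z : ℝ} (hz : z ∈ phaseSet m M W) :
    phaseSlope G m M pm pM W z = invG₁ G pm (W z) := if_pos hz

lemma phaseSlope_of_notMem {z : ℝ} (hz : z ∉ phaseSet m M W) :
    phaseSlope G m M pm pM W z = invG₃ G pM (W z) := if_neg hz

lemma phaseSlope_comp_add (y z : ℝ) :
    phaseSlope G m M pm pM (fun s => W (s + y)) z = phaseSlope G m M pm pM W (z + y) := by
  by_cases h : z + y ∈ phaseSet m M W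
  · rw [phaseSlope_of_mem h, phaseSlope_of_mem ((mem_phaseSet_comp_add y z).2 h)]
  · rw [phaseSlope_of_notMem h,
      phaseSlope_of_notMem (fun h' => h ((mem_phaseSet_comp_add y z).1 h'))]

/-- A higher path can only move a point into the first phase. There the slope drops to at most pm <
pM, below the third branch; within either branch the inverse of G is strictly decreasing. -/
lemma phaseSlope_lt (hG : IsDoubleWell G m M pm pM) (hW : Continuous W) (hW' : Continuous W')
    (hW0 : ∀ s, 0 ≤ W s) (h : ∀ s, W s < W' s) (z : ℝ) :
    phaseSlope G m M pm pM W' z < phaseSlope G m M pm pM W z := by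
  by_cases hz : z ∈ phaseSet m M W
  · rw [phaseSlope_of_mem hz, phaseSlope_of_mem (phaseSet_mono (fun s => (h s).le) hz)]
    exact hG.invG₁_lt (le_of_mem_phaseSet hz) (h z)
  · rw [phaseSlope_of_notMem hz]
    have hWM := lt_of_notMem_phaseSet hW hG.m_lt_M hz
    by_cases hz' : z ∈ phaseSet m M W'
    · rw [phaseSlope_of_mem hz']
      exact ((hG.invG₁_spec (le_of_mem_phaseSet hz')).1.trans_lt hG.pm_lt_pM).trans_le
        (hG.invG₃_spec ⟨hW0 z, hWM.le⟩).1.1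
    · rw [phaseSlope_of_notMem hz']
      exact hG.invG₃_lt (hW0 z) (h z) (lt_of_notMem_phaseSet hW' hG.m_lt_M hz').le

lemma phaseSlope_mem_Icc (hG : IsDoubleWell G m M pm pM) (hW : Continuous W)
    (hW0 : ∀ s, 0 ≤ W s) {lam : ℝ} (hlam : ∀ s, W s ≤ lam) (hMlam : M ≤ lam) (z : ℝ) :
    phaseSlope G m M pm pM W z ∈ Icc (invG₁ G pm lam) 0 := by
  by_cases hz : z ∈ phaseSet m M W
  · rw [phaseSlope_of_mem hz]
    have h1 := le_of_mem_phaseSet hz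
    refine ⟨?_, (hG.invG₁_spec h1).1.trans (hG.pm_lt_pM.trans hG.pM_neg).le⟩
    rcases (hlam z).lt_or_eq with h | h
    · exact (hG.invG₁_lt h1 h).le
    · rw [h]
  · rw [phaseSlope_of_notMem hz]
    have h1 := (hG.invG₃_spec ⟨hW0 z, (lt_of_notMem_phaseSet hW hG.m_lt_M hz).le⟩).1
    exact ⟨((hG.invG₁_spec (hG.m_lt_M.le.trans hMlam)).1.trans hG.pm_lt_pM.le).trans h1.1, h1.2⟩

lemma tendsto_phaseSlope_of_eventually_mem (hG : IsDoubleWell G m M pm pM) (hW : Continuous W)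
    {z : ℝ} {l : Filter ℝ} (hl : l ≤ 𝓝 z) [l.NeBot] (h : ∀ᶠ y in l, y ∈ phaseSet m M W) :
    Tendsto (phaseSlope G m M pm pM W) l (𝓝 (invG₁ G pm (W z))) := by
  have hWl : Tendsto W l (𝓝 (W z)) := hW.continuousAt.mono_left hl
  have hmz : m ≤ W z := ge_of_tendsto hWl (h.mono fun y hy => le_of_mem_phaseSet hy)
  have h1 : Tendsto W l (𝓝[Ici m] (W z)) :=
    tendsto_nhdsWithin_iff.2 ⟨hWl, h.mono fun y hy => le_of_mem_phaseSet hy⟩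
  exact ((hG.continuousOn_invG₁ _ hmz).tendsto.comp h1).congr'
    (h.mono fun y hy => (phaseSlope_of_mem hy).symm)

lemma tendsto_phaseSlope_of_eventually_notMem (hG : IsDoubleWell G m M pm pM) (hW : Continuous W)
    (hW0 : ∀ s, 0 ≤ W s) {z : ℝ} {l : Filter ℝ} (hl : l ≤ 𝓝 z) [l.NeBot]
    (h : ∀ᶠ y in l, y ∉ phaseSet m M W) :
    Tendsto (phaseSlope G m M pm pM W) l (𝓝 (invG₃ G pM (W z))) := by
  have hWl : Tendsto W l (𝓝 (W z)) := hW.continuousAt.mono_left hl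
  have hev : ∀ᶠ y in l, W y ∈ Icc 0 M :=
    h.mono fun y hy => ⟨hW0 y, (lt_of_notMem_phaseSet hW hG.m_lt_M hy).le⟩
  have hmz : W z ∈ Icc 0 M := isClosed_Icc.mem_of_tendsto hWl hev
  have h1 : Tendsto W l (𝓝[Icc 0 M] (W z)) := tendsto_nhdsWithin_iff.2 ⟨hWl, hev⟩
  exact ((hG.continuousOn_invG₃ _ hmz).tendsto.comp h1).congr'
    (h.mono fun y hy => (phaseSlope_of_notMem hy).symm)

/-- One-sided limits of the slope, with the inequalities which make the corrector a viscosity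
solution at its kinks. -/
lemma exists_phaseSlope_limits (hG : IsDoubleWell G m M pm pM) (hW : Continuous W)
    (hW0 : ∀ s, 0 ≤ W s) (z : ℝ) :
    ∃ pl pr, Tendsto (phaseSlope G m M pm pM W) (𝓝[<] z) (𝓝 pl) ∧
      Tendsto (phaseSlope G m M pm pM W) (𝓝[>] z) (𝓝 pr) ∧
      (∀ p ∈ Icc pr pl, G p ≤ W z) ∧ ∀ p ∈ Icc pl pr, W z ≤ G p := by
  have hlt := hG.m_lt_M
  have hM0 : 0 ≤ M := hG.zero_le_m.trans hlt.le
  rcases eventually_left_phaseSet hW hlt z with hl | hl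
  · have tl := tendsto_phaseSlope_of_eventually_mem hG hW nhdsWithin_le_nhds hl
    by_cases hz : z ∈ phaseSet m M W
    · have tr := tendsto_phaseSlope_of_eventually_mem hG hW nhdsWithin_le_nhds
        (eventually_right_mem_phaseSet hz)
      refine ⟨_, _, tl, tr, fun p hp => ?_, fun p hp => ?_⟩ <;>
      rw [le_antisymm hp.2 hp.1, (hG.invG₁_spec (le_of_mem_phaseSet hz)).2]
    · have tr := tendsto_phaseSlope_of_eventually_notMem hG hW hW0 nhdsWithin_le_nhds
        (eventually_right_notMem_phaseSet hW hlt hz)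
      -- Exit from the first phase: an upward jump from pm, so only the supersolution inequality
      -- matters, and G ≥ m holds over the whole jump.
      have hWz := eq_of_left_mem_of_notMem hW hl hz
      rw [hWz] at tl tr ⊢
      rw [hG.invG₁_m] at tl
      obtain ⟨h1, h2⟩ := hG.invG₃_spec ⟨hG.zero_le_m, hlt.le⟩
      refine ⟨_, _, tl, tr, fun p hp => ?_, fun p hp => ?_⟩
      · linarith [hp.1, hp.2, h1.1, hG.pm_lt_pM]
      · rcases le_total p pM with h | h
        · have := hG.mono_left.monotoneOn (left_mem_Icc.2 hG.pm_lt_pM.le) ⟨hp.1, h⟩ hp.1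
          rwa [hG.map_pm] at this
        · have := hG.anti_right.antitoneOn ⟨h, hp.2.trans h1.2⟩ h1 hp.2
          rwa [h2] at this
  · have tl := tendsto_phaseSlope_of_eventually_notMem hG hW hW0 nhdsWithin_le_nhds hl
    by_cases hz : z ∈ phaseSet m M W
    · have tr := tendsto_phaseSlope_of_eventually_mem hG hW nhdsWithin_le_nhds
        (eventually_right_mem_phaseSet hz)
      -- Entry into the first phase: a downward jump from pM, so only the subsolution inequality
      -- matters, and G ≤ M holds over the whole jump.
      have hWz := eq_of_left_notMem_of_mem hW hlt hl hz
      rw [hWz] at tl tr ⊢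
      rw [hG.invG₃_M] at tl
      obtain ⟨h1, h2⟩ := hG.invG₁_spec hlt.le
      refine ⟨_, _, tl, tr, fun p hp => ?_, fun p hp => ?_⟩
      · rcases le_total p pm with h | h
        · have := hG.anti_left.antitoneOn h1 h hp.1
          rwa [h2] at this
        · have := hG.mono_left.monotoneOn ⟨h, hp.2⟩ (right_mem_Icc.2 hG.pm_lt_pM.le) hp.2
          rwa [hG.map_pM] at this
      · have : invG₁ G pm M ≤ pm := h1
        linarith [hp.1, hp.2, hG.pm_lt_pM]
    · have tr := tendsto_phaseSlope_of_eventually_notMem hG hW hW0 nhdsWithin_le_nhds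
        (eventually_right_notMem_phaseSet hW hlt hz)
      refine ⟨_, _, tl, tr, fun p hp => ?_, fun p hp => ?_⟩ <;>
      rw [le_antisymm hp.2 hp.1,
        (hG.invG₃_spec ⟨hW0 z, (lt_of_notMem_phaseSet hW hlt hz).le⟩).2]

end phaseSlope

/-! ### Existence of the switching sequences -/

/-- The path `W` is above `M` and below `m` at arbitrarily large positive and negative times. -/
structure IsRecurrent (m M : ℝ) (W : ℝ → ℝ) : Prop where
  high_top : ∀ N, ∃ z, N ≤ z ∧ M ≤ W z
  high_bot : ∀ N, ∃ z, z ≤ N ∧ M ≤ W z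
  low_top : ∀ N, ∃ z, N ≤ z ∧ W z < m
  low_bot : ∀ N, ∃ z, z ≤ N ∧ W z < m

/-- The first times at which the path reaches `M` after having been below `m`. -/
def upcrossings (m M : ℝ) (W : ℝ → ℝ) : Set ℝ :=
  {x | M ≤ W x ∧ ∃ c, c < x ∧ W c < m ∧ ∀ s ∈ Ico c x, W s < M}

section switching

variable {m M : ℝ} {W : ℝ → ℝ}

lemma exists_upcrossing (hW : Continuous W) (hm : m < M) {c z : ℝ} (hc : W c < m) (hcz : c ≤ z)
    (hz : M ≤ W z) : ∃ x ∈ upcrossings m M W, c < x ∧ x ≤ z ∧ ∀ s ∈ Ico c x, W s < M := by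
  set S := {s | c ≤ s ∧ M ≤ W s} with hS
  have hSc : IsClosed S :=
    (isClosed_le continuous_const continuous_id).inter (isClosed_le continuous_const hW)
  have hbd : BddBelow S := ⟨c, fun s hs => hs.1⟩
  have hmem : sInf S ∈ S := hSc.csInf_mem ⟨z, hcz, hz⟩ hbd
  have hbelow : ∀ s ∈ Ico c (sInf S), W s < M := fun s hs => by
    by_contra! h
    exact (csInf_le hbd (show s ∈ S from ⟨hs.1, h⟩)).not_gt hs.2
  have hlt : c < sInf S := by
    refine lt_of_le_of_ne hmem.1 fun h => ?_
    have := hmem.2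
    rw [← h] at this
    linarith
  exact ⟨sInf S, ⟨hmem.2, c, hlt, hc, hbelow⟩, hlt, csInf_le hbd ⟨hcz, hz⟩, hbelow⟩

/-- Between two upcrossings the path drops from at least M to below m, which by uniform continuity
takes a fixed length. -/
lemma exists_upcrossings_separation (hW : UniformContinuous W) (hm : m < M) :
    ∃ δ > 0, ∀ x ∈ upcrossings m M W, ∀ x' ∈ upcrossings m M W, x < x' → x + δ ≤ x' := by
  obtain ⟨δ, hδ, h⟩ := Metric.uniformContinuous_iff.1 hW (M - m) (sub_pos.2 hm)
  refine ⟨δ, hδ, ?_⟩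
  rintro x ⟨hx, -⟩ x' ⟨-, c, hc, hcm, hcs⟩ hlt
  have hxc : x < c := by
    by_contra! hle
    exact hx.not_gt (hcs x ⟨hle, hlt⟩)
  by_contra! hlt'
  have := h (a := x) (b := c) (by rw [Real.dist_eq, abs_sub_comm, abs_of_pos] <;> linarith)
  rw [Real.dist_eq] at this
  linarith [le_abs_self (W x - W c)]

lemma finite_of_separated {S : Set ℝ} {δ : ℝ} (hδ : 0 < δ)
    (h : ∀ x ∈ S, ∀ x' ∈ S, x < x' → x + δ ≤ x') (a b : ℝ) : (S ∩ Icc a b).Finite := by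
  have hinj : InjOn (fun x : ℝ => ⌊x / δ⌋) (S ∩ Icc a b) := by
    have key : ∀ x ∈ S, ∀ x' ∈ S, x < x' → ⌊x / δ⌋ ≠ ⌊x' / δ⌋ := fun x hx x' hx' hlt => by
      have h1 : x / δ + 1 ≤ x' / δ := by
        rw [← div_self hδ.ne', ← add_div]
        exact (div_le_div_iff_of_pos_right hδ).2 (h x hx x' hx' hlt)
      have h2 := Int.floor_le_floor h1
      rw [Int.floor_add_one] at h2
      lia
    intro x hx x' hx' heq
    rcases lt_trichotomy x x' with h1 | h1 | h1
    · exact absurd heq (key x hx.1 x' hx'.1 h1)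
    · exact h1
    · exact absurd heq.symm (key x' hx'.1 x hx.1 h1)
  refine Set.Finite.of_finite_image ((Set.finite_Icc ⌊a / δ⌋ ⌊b / δ⌋).subset ?_) hinj
  rintro _ ⟨x, hx, rfl⟩
  exact ⟨Int.floor_le_floor ((div_le_div_iff_of_pos_right hδ).2 hx.2.1),
    Int.floor_le_floor ((div_le_div_iff_of_pos_right hδ).2 hx.2.2)⟩

/-- A separated set of reals, unbounded in both directions, is enumerated by the integers. -/
lemma exists_orderIso_of_separated {S : Set ℝ} {δ : ℝ} (hδ : 0 < δ)
    (h : ∀ x ∈ S, ∀ x' ∈ S, x < x' → x + δ ≤ x') (htop : ∀ N, ∃ x ∈ S, N < x)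
    (hbot : ∀ N, ∃ x ∈ S, x < N) : Nonempty (ℤ ≃o S) := by
  have : Nonempty S := let ⟨x, hx, _⟩ := htop 0; ⟨⟨x, hx⟩⟩
  have : NoMaxOrder S := ⟨fun a => let ⟨x, hx, hlt⟩ := htop a; ⟨⟨x, hx⟩, hlt⟩⟩
  have : NoMinOrder S := ⟨fun a => let ⟨x, hx, hlt⟩ := hbot a; ⟨⟨x, hx⟩, hlt⟩⟩
  let : LocallyFiniteOrder S := LocallyFiniteOrder.ofFiniteIcc fun a b => by
    refine Set.Finite.of_finite_image (f := Subtype.val) ?_ Subtype.val_injective.injOn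
    refine (finite_of_separated hδ h a b).subset ?_
    rintro _ ⟨x, hx, rfl⟩
    exact ⟨x.2, hx.1, hx.2⟩
  let := LinearLocallyFiniteOrder.succOrder S
  let := LinearLocallyFiniteOrder.predOrder S
  exact ⟨orderIsoIntOfLinearSuccPredArch.symm⟩

/-- A strictly increasing enumeration of a set of reals which is unbounded in both directions
brackets every real number. -/
lemma exists_bracket {S : Set ℝ} (e : ℤ ≃o S) (htop : ∀ N, ∃ x ∈ S, N < x)
    (hbot : ∀ N, ∃ x ∈ S, x < N) (z : ℝ) : ∃ k, (e k : ℝ) ≤ z ∧ z < e (k + 1) := by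
  obtain ⟨x₁, hx₁, hlt₁⟩ := htop z
  obtain ⟨x₀, hx₀, hlt₀⟩ := hbot z
  obtain ⟨k, hk, hmax⟩ := Int.exists_greatest_of_bdd (P := fun k => (e k : ℝ) ≤ z)
    ⟨e.symm ⟨x₁, hx₁⟩, fun k hk => by
      rw [e.le_symm_apply]
      exact (hk.trans hlt₁.le : (e k : ℝ) ≤ x₁)⟩
    ⟨e.symm ⟨x₀, hx₀⟩, by simpa using hlt₀.le⟩
  refine ⟨k, hk, ?_⟩
  by_contra! hle
  have := hmax _ hle
  lia

/-- The upcrossings are separated and unbounded both ways, so ℤ enumerates them and gives all the x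
i at once. It remains to see that the first return to M after y i is the next upcrossing. -/
lemma IsRecurrent.exists_switching (hrec : IsRecurrent m M W) (hW : UniformContinuous W)
    (hm : m < M) :
    ∃ x y : ℤ → ℝ, IsSwitching W m M x y ∧ ∀ z, ∃ i, x i ≤ z ∧ z < x (i + 1) := by
  have hWc := hW.continuous
  obtain ⟨δ, hδ, hsep⟩ := exists_upcrossings_separation hW hm
  have htop : ∀ N, ∃ x ∈ upcrossings m M W, N < x := fun N => by
    obtain ⟨c, hc, hcm⟩ := hrec.low_top N
    obtain ⟨z, hz, hzM⟩ := hrec.high_top c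
    obtain ⟨x, hx, hlt, -⟩ := exists_upcrossing hWc hm hcm hz hzM
    exact ⟨x, hx, hc.trans_lt hlt⟩
  have hbot : ∀ N, ∃ x ∈ upcrossings m M W, x < N := fun N => by
    obtain ⟨z, hz, hzM⟩ := hrec.high_bot (N - 1)
    obtain ⟨c, hc, hcm⟩ := hrec.low_bot z
    obtain ⟨x, hx, -, hle, -⟩ := exists_upcrossing hWc hm hcm hc hzM
    exact ⟨x, hx, by linarith⟩
  obtain ⟨e⟩ := exists_orderIso_of_separated hδ hsep htop hbot
  obtain ⟨k, hk0, hk1⟩ := exists_bracket e htop hbot 0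
  -- `e k` is the last upcrossing at or before 0; the shift gives it index −1, as the anchor
  -- demands.
  set x : ℤ → ℝ := fun i => e (i + k + 1) with hx
  set y : ℤ → ℝ := fun i => sInf {z | x i ≤ z ∧ W z < m} with hy
  have hyglb : ∀ i, IsGLB {z | x i ≤ z ∧ W z < m} (y i) := fun i =>
    isGLB_csInf (hrec.low_top (x i)) ⟨x i, fun s hs => hs.1⟩
  have hxy : ∀ i, x i ≤ y i := fun i => (hyglb i).2 fun s hs => hs.1
  have hstep : ∀ i, IsGLB {z | y i ≤ z ∧ M ≤ W z} (x (i + 1)) := fun i => by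
    set S := {z | y i ≤ z ∧ M ≤ W z} with hS
    have hSc : IsClosed S :=
      (isClosed_le continuous_const continuous_id).inter (isClosed_le continuous_const hWc)
    have hbd : BddBelow S := ⟨y i, fun s hs => hs.1⟩
    have hne : S.Nonempty := hrec.high_top (y i)
    have hmem : sInf S ∈ S := hSc.csInf_mem hne hbd
    have hWy : W (y i) ≤ m := by
      have h1 : closure {z | x i ≤ z ∧ W z < m} ⊆ {z | W z ≤ m} :=
        closure_minimal (fun s hs => hs.2.le) (isClosed_le hWc continuous_const)
      exact h1 ((hyglb i).mem_closure (hrec.low_top (x i)))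
    have hlt : y i < sInf S := by
      refine lt_of_le_of_ne hmem.1 fun h => ?_
      have := hmem.2
      rw [← h] at this
      linarith
    have hup : sInf S ∈ upcrossings m M W := by
      obtain ⟨c, hc, hyc, hcS⟩ := (hyglb i).exists_between hlt
      refine ⟨hmem.2, c, hcS, hc.2, fun s hs => ?_⟩
      by_contra! h
      exact (csInf_le hbd (show s ∈ S from ⟨hyc.trans hs.1, h⟩)).not_gt hs.2
    have hle : x (i + 1) ≤ sInf S := by
      have h1 : x i < sInf S := (hxy i).trans_lt hlt
      have h2 : i + k + 1 < e.symm ⟨sInf S, hup⟩ := by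
        rw [e.lt_symm_apply]; exact h1
      have h3 : i + 1 + k + 1 ≤ e.symm ⟨sInf S, hup⟩ := by lia
      rw [e.le_symm_apply] at h3
      exact h3
    -- A smaller x (i + 1) would precede y i. Yet the low point before it lies after x i, hence not
    -- before y i.
    have heq : x (i + 1) = sInf S := by
      refine hle.eq_of_not_lt fun hlt' => ?_
      obtain ⟨hM1, c, hc, hcm, hcs⟩ := (e (i + 1 + k + 1)).2
      have h1 : x (i + 1) < y i := by
        by_contra! h
        exact (csInf_le hbd (show x (i + 1) ∈ S from ⟨h, hM1⟩)).not_gt hlt'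
      have h2 : x i < x (i + 1) := e.strictMono (by lia)
      have h3 : x i ≤ c := by
        by_contra! h
        exact (e (i + k + 1)).2.1.not_gt (hcs (x i) ⟨h.le, h2⟩)
      exact ((hyglb i).1 ⟨h3, hcm⟩).not_gt (lt_trans hc h1)
    rw [heq]
    exact isGLB_csInf hne hbd
  refine ⟨x, y, ⟨fun i => ?_, hyglb, ?_, ?_⟩, fun z => ?_⟩
  · have := hstep (i - 1)
    rwa [sub_add_cancel] at this
  · have : (-1 : ℤ) + k + 1 = k := by ring
    simp only [hx, this]
    exact hk0
  · simp only [hx, zero_add]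
    exact hk1
  · obtain ⟨j, hj⟩ := exists_bracket e htop hbot z
    refine ⟨j - k - 1, ?_⟩
    have h1 : j - k - 1 + k + 1 = j := by ring
    have h2 : j - k - 1 + 1 + k + 1 = j + 1 := by ring
    simp only [hx, h1, h2]
    exact hj

/-- If z is in [x i, x (i + 1)) but not before y i, then a witness `a` must precede y i, since
otherwise x (i + 1) ≤ a ≤ z. The path then dips below m between a and b. -/
lemma IsRecurrent.firstPhase_eq (hrec : IsRecurrent m M W) (hW : UniformContinuous W)
    (hm : m < M) : firstPhase W m M = phaseSet m M W := by
  ext z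
  constructor
  · rintro ⟨x, y, hxy, i, hi⟩
    refine ⟨x i, y i, hi.1, hi.2, ?_, fun s hs => ?_⟩
    · have hSc : IsClosed {z | y (i - 1) ≤ z ∧ M ≤ W z} :=
        (isClosed_le continuous_const continuous_id).inter
          (isClosed_le continuous_const hW.continuous)
      exact (hSc.isGLB_mem (hxy.x_rec i) (hxy.x_rec i).nonempty).2
    · by_contra! h
      exact ((hxy.y_rec i).1 ⟨hs.1, h⟩).not_gt hs.2
  · rintro ⟨a, b, h1, h2, h3, h4⟩
    obtain ⟨x, y, hxy, hcov⟩ := hrec.exists_switching hW hm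
    obtain ⟨i, hi1, hi2⟩ := hcov z
    refine ⟨x, y, hxy, i, hi1, ?_⟩
    by_contra! hyz
    have hx1 := hxy.x_rec (i + 1)
    rw [add_sub_cancel_right] at hx1
    have hay : a < y i := by
      by_contra! h
      exact (hx1.1 ⟨h, h3⟩).not_gt (h1.trans_lt hi2)
    obtain ⟨c, hc, hyc, hcb⟩ := (hxy.y_rec i).exists_between (hyz.trans_lt h2)
    exact (h4 c ⟨hay.le.trans hyc, hcb⟩).not_gt hc.2

end switching

lemma IsRecurrent.slope13_eq {G W : ℝ → ℝ} {m M pm pM : ℝ} (hrec : IsRecurrent m M W)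
    (hW : UniformContinuous W) (hm : m < M) (z : ℝ) :
    slope13 G m M pm pM W z = phaseSlope G m M pm pM W z := by
  rw [slope13, phaseSlope, hrec.firstPhase_eq hW hm]


/-! ### The maximal ergodic lemma and averages along an ergodic flow -/

/-- The maximum of the first `N + 1` Birkhoff sums of `f`, beginning with the empty one. -/
def birkhoffMax {Ω : Type*} (T : Ω → Ω) (f : Ω → ℝ) : ℕ → Ω → ℝ
  | 0, _ => 0
  | N + 1, ω => max 0 (f ω + birkhoffMax T f N (T ω))

section birkhoffMax

variable {Ω : Type*} {T : Ω → Ω} {f : Ω → ℝ}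

lemma birkhoffMax_nonneg (N : ℕ) (ω : Ω) : 0 ≤ birkhoffMax T f N ω := by
  cases N with
  | zero => exact le_rfl
  | succ N => exact le_max_left _ _

lemma birkhoffMax_le_succ (N : ℕ) (ω : Ω) : birkhoffMax T f N ω ≤ birkhoffMax T f (N + 1) ω := by
  induction N generalizing ω with
  | zero => exact birkhoffMax_nonneg 1 ω
  | succ N ih => exact max_le_max le_rfl (by linarith [ih (T ω)])

lemma birkhoffSum_le_birkhoffMax (N : ℕ) (ω : Ω) : birkhoffSum T f N ω ≤ birkhoffMax T f N ω := by
  induction N generalizing ω with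
  | zero => simp [birkhoffMax]
  | succ N ih =>
    rw [birkhoffSum_succ']
    exact le_max_of_le_right (by linarith [ih (T ω)])

lemma birkhoffMax_le {K : ℝ} (hK : ∀ ω, |f ω| ≤ K) (N : ℕ) (ω : Ω) :
    birkhoffMax T f N ω ≤ N * K := by
  have hK0 : 0 ≤ K := (abs_nonneg _).trans (hK ω)
  induction N generalizing ω with
  | zero => simp [birkhoffMax]
  | succ N ih =>
    refine max_le (by positivity) ?_
    push_cast
    linarith [ih (T ω), le_of_abs_le (hK ω)]

lemma measurable_birkhoffMax [MeasurableSpace Ω] (hT : Measurable T) (hf : Measurable f) (N : ℕ) :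
    Measurable (birkhoffMax T f N) := by
  induction N with
  | zero => exact measurable_const
  | succ N ih => exact measurable_const.max (hf.add (ih.comp hT))

end birkhoffMax

lemma integrable_of_abs_le {Ω : Type*} [MeasurableSpace Ω] {P : Measure Ω} [IsFiniteMeasure P]
    {f : Ω → ℝ} (hf : Measurable f) {K : ℝ} (hK : ∀ ω, |f ω| ≤ K) : Integrable f P :=
  Integrable.of_bound hf.aestronglyMeasurable K (ae_of_all _ hK)

/-- The maximal ergodic lemma, for observables whose Birkhoff sums almost surely become positive. -/
theorem integral_nonneg_of_birkhoffSum_pos {Ω : Type*} [MeasurableSpace Ω] {P : Measure Ω}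
    [IsFiniteMeasure P] {T : Ω → Ω} (hT : MeasurePreserving T P P) {f : Ω → ℝ}
    (hf : Measurable f) {K : ℝ} (hK : ∀ ω, |f ω| ≤ K)
    (h : ∀ᵐ ω ∂P, ∃ n, 0 < birkhoffSum T f n ω) : 0 ≤ ∫ ω, f ω ∂P := by
  have hMm : ∀ N, Measurable (birkhoffMax T f N) := measurable_birkhoffMax hT.measurable hf
  have hMi : ∀ N, Integrable (birkhoffMax T f N) P := fun N =>
    integrable_of_abs_le (hMm N) fun ω => by
      rw [abs_of_nonneg (birkhoffMax_nonneg N ω)]; exact birkhoffMax_le hK N ω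
  let E : ℕ → Set Ω := fun N => {ω | 0 < birkhoffMax T f N ω}
  have hE : ∀ N, MeasurableSet (E N) := fun N => measurableSet_lt measurable_const (hMm N)
  have hEmono : Monotone E :=
    monotone_nat_of_le_succ fun N ω hω => lt_of_lt_of_le hω (birkhoffMax_le_succ N ω)
  have hnonneg : ∀ N, 0 ≤ ∫ ω, (E (N + 1)).indicator f ω ∂P := fun N => by
    -- Garsia's inequality: where the maximum is positive it equals f plus the previous maximum at T
    -- ω, and enlarging that maximum only helps.
    have h1 : ∀ ω, birkhoffMax T f (N + 1) ω - birkhoffMax T f (N + 1) (T ω)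
        ≤ (E (N + 1)).indicator f ω := fun ω => by
      by_cases hω : ω ∈ E (N + 1)
      · rw [indicator_of_mem hω]
        have h2 : birkhoffMax T f (N + 1) ω = f ω + birkhoffMax T f N (T ω) := by
          have h3 : 0 < birkhoffMax T f (N + 1) ω := hω
          rw [birkhoffMax] at h3 ⊢
          exact max_eq_right ((lt_max_iff.1 h3).resolve_left (lt_irrefl 0)).le
        linarith [birkhoffMax_le_succ (f := f) (T := T) N (T ω)]
      · rw [indicator_of_notMem hω]
        have h2 : birkhoffMax T f (N + 1) ω ≤ 0 := not_lt.1 hω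
        linarith [birkhoffMax_nonneg (T := T) (f := f) (N + 1) (T ω)]
    have h2 : Integrable (fun ω => birkhoffMax T f (N + 1) (T ω)) P :=
      hT.integrable_comp_of_integrable (hMi (N + 1))
    have h3 : ∫ ω, birkhoffMax T f (N + 1) (T ω) ∂P = ∫ ω, birkhoffMax T f (N + 1) ω ∂P := by
      rw [← integral_map hT.aemeasurable
        (by rw [hT.map_eq]; exact (hMm (N + 1)).aestronglyMeasurable), hT.map_eq]
    have h4 := integral_mono ((hMi (N + 1)).sub h2)
      ((integrable_of_abs_le hf hK).indicator (hE (N + 1))) h1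
    simp only [Pi.sub_apply] at h4
    rwa [integral_sub (hMi (N + 1)) h2, h3, sub_self] at h4
  have hlim : Tendsto (fun N => ∫ ω, (E (N + 1)).indicator f ω ∂P) atTop (𝓝 (∫ ω, f ω ∂P)) := by
    refine tendsto_integral_of_dominated_convergence (fun _ => K)
      (fun N => (hf.indicator (hE _)).aestronglyMeasurable) (integrable_const K)
      (fun N => ae_of_all _ fun ω => (norm_indicator_le_norm_self f ω).trans (hK ω)) ?_
    filter_upwards [h] with ω ⟨n, hn⟩
    refine tendsto_const_nhds.congr' ?_
    filter_upwards [eventually_ge_atTop n] with N hN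
    rw [indicator_of_mem]
    exact hEmono (hN.trans N.le_succ) (hn.trans_le (birkhoffSum_le_birkhoffMax n ω))
  exact ge_of_tendsto' hlim hnonneg

/-! ### Birkhoff averages along the flow -/

namespace IsErgodicGroup

variable {Ω : Type*} [MeasurableSpace Ω] {P : Measure Ω} {τ : ℝ → Ω → Ω}

lemma apply_apply (hτ : IsErgodicGroup P τ) (x y : ℝ) (ω : Ω) : τ x (τ y ω) = τ (x + y) ω :=
  congrFun (hτ.comp x y) ω

lemma apply_zero (hτ : IsErgodicGroup P τ) (ω : Ω) : τ 0 ω = ω := congrFun hτ.zero ω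

lemma neg (hτ : IsErgodicGroup P τ) : IsErgodicGroup P fun x => τ (-x) where
  zero := by simpa using hτ.zero
  comp x y := by rw [hτ.comp, neg_add]
  preserving x := hτ.preserving (-x)
  ergodic A hA h := hτ.ergodic A hA fun x => by simpa using h (-x)

lemma iterate_one (hτ : IsErgodicGroup P τ) (n : ℕ) : (τ 1)^[n] = τ n := by
  induction n with
  | zero => simp [hτ.zero]
  | succ n ih => rw [Function.iterate_succ', ih, hτ.comp, Nat.cast_succ, add_comm]

end IsErgodicGroup

/-- A bounded observable of a flow, measurable along the flow. -/
structure IsFlowObservable {Ω : Type*} [MeasurableSpace Ω] (τ : ℝ → Ω → Ω) (S : Ω → ℝ) (K : ℝ) :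
    Prop where
  measurable : Measurable fun q : ℝ × Ω => S (τ q.1 q.2)
  bound : ∀ ω, |S ω| ≤ K

namespace IsFlowObservable

variable {Ω : Type*} [MeasurableSpace Ω] {P : Measure Ω} {τ : ℝ → Ω → Ω} {S : Ω → ℝ} {K : ℝ}

lemma neg (hS : IsFlowObservable τ S K) : IsFlowObservable τ (fun ω => -S ω) K :=
  ⟨hS.measurable.neg, fun ω => by simpa using hS.bound ω⟩

lemma reverse (hS : IsFlowObservable τ S K) : IsFlowObservable (fun x => τ (-x)) S K :=
  ⟨hS.measurable.comp (measurable_fst.neg.prodMk measurable_snd), hS.bound⟩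

lemma measurable_path (hS : IsFlowObservable τ S K) (ω : Ω) : Measurable fun z => S (τ z ω) :=
  hS.measurable.comp measurable_prodMk_right

lemma intervalIntegrable (hS : IsFlowObservable τ S K) (ω : Ω) (a b : ℝ) :
    IntervalIntegrable (fun z => S (τ z ω)) volume a b :=
  intervalIntegrable_of_abs_le (hS.measurable_path ω) (fun _ => hS.bound _) a b

lemma abs_integral_le (hS : IsFlowObservable τ S K) (ω : Ω) (a b : ℝ) :
    |∫ z in a..b, S (τ z ω)| ≤ K * |b - a| :=
  intervalIntegral.norm_integral_le_of_norm_le_const (f := fun z => S (τ z ω))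
    fun _ _ => hS.bound _

lemma integral_shift (hτ : IsErgodicGroup P τ) (S : Ω → ℝ) (ω : Ω) (s a b : ℝ) :
    ∫ z in a..b, S (τ z (τ s ω)) = ∫ z in (a + s)..(b + s), S (τ z ω) := by
  simp only [hτ.apply_apply]
  exact intervalIntegral.integral_comp_add_right (fun z => S (τ z ω)) s

lemma measurable_integral (hS : IsFlowObservable τ S K) {a b : ℝ} (hab : a ≤ b) :
    Measurable fun ω => ∫ z in a..b, S (τ z ω) := by
  simp only [intervalIntegral.integral_of_le hab]
  exact (hS.measurable.stronglyMeasurable.integral_prod_left'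
    (μ := volume.restrict (Ioc a b))).measurable

lemma measurable_self (hS : IsFlowObservable τ S K) (hτ : IsErgodicGroup P τ) : Measurable S := by
  have := hS.measurable.comp (measurable_prodMk_left (x := (0 : ℝ)))
  simpa [Function.comp_def, hτ.apply_zero] using this

lemma integral_integral [IsFiniteMeasure P] (hS : IsFlowObservable τ S K)
    (hτ : IsErgodicGroup P τ) :
    ∫ ω, (∫ z in (0 : ℝ)..1, S (τ z ω)) ∂P = ∫ ω, S ω ∂P := by
  simp only [intervalIntegral.integral_of_le zero_le_one]
  rw [integral_integral_swap]
  · have : ∀ z : ℝ, ∫ ω, S (τ z ω) ∂P = ∫ ω, S ω ∂P := fun z => by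
      rw [← integral_map (hτ.preserving z).aemeasurable
        (by rw [(hτ.preserving z).map_eq]; exact (hS.measurable_self hτ).aestronglyMeasurable),
        (hτ.preserving z).map_eq]
    simp [this]
  · exact integrable_of_abs_le (hS.measurable.comp measurable_swap) fun q => hS.bound _

lemma birkhoffSum_eq (hS : IsFlowObservable τ S K) (hτ : IsErgodicGroup P τ) (c : ℝ) (n : ℕ)
    (ω : Ω) : birkhoffSum (τ 1) (fun ω => (∫ z in (0 : ℝ)..1, S (τ z ω)) - c) n ω
      = (∫ z in (0 : ℝ)..n, S (τ z ω)) - c * n := by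
  induction n with
  | zero => simp
  | succ n ih =>
    rw [birkhoffSum_succ, ih, hτ.iterate_one, integral_shift hτ, zero_add,
      ← intervalIntegral.integral_add_adjacent_intervals (hS.intervalIntegrable ω 0 n)
        (hS.intervalIntegrable ω n (n + 1 : ℕ))]
    push_cast
    rw [add_comm (1 : ℝ)]
    ring

/-- The event that the averages exceed a level larger than `c` infinitely often. -/
def exceedance (τ : ℝ → Ω → Ω) (S : Ω → ℝ) (c : ℝ) : Set Ω :=
  {ω | ∃ k : ℕ, ∃ᶠ n : ℕ in atTop, (c + 1 / (k + 1)) * n < ∫ z in (0 : ℝ)..n, S (τ z ω)}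

lemma measurableSet_exceedance (hS : IsFlowObservable τ S K) (c : ℝ) :
    MeasurableSet (exceedance τ S c) := by
  have : exceedance τ S c = ⋃ k : ℕ, ⋂ N : ℕ, ⋃ n : ℕ, ⋃ _ : N ≤ n,
      {ω | (c + 1 / (k + 1)) * n < ∫ z in (0 : ℝ)..n, S (τ z ω)} := by
    ext ω
    simp [exceedance, frequently_atTop]
  rw [this]
  exact .iUnion fun k => .iInter fun N => .iUnion fun n => .iUnion fun _ =>
    measurableSet_lt measurable_const (hS.measurable_integral (Nat.cast_nonneg n))

/-- Shifting the origin by s costs at most 2K|s|, absorbed for large n by lowering the margin from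
1/(k + 1) to 1/(k + 2). Invariance under every τ s is needed because the time-one map need not be
ergodic. -/
lemma apply_mem_exceedance (hS : IsFlowObservable τ S K) (hτ : IsErgodicGroup P τ) {c : ℝ} {ω : Ω}
    (hω : ω ∈ exceedance τ S c) (s : ℝ) : τ s ω ∈ exceedance τ S c := by
  obtain ⟨k, hk⟩ := hω
  have hpos : 0 < 1 / ((k : ℝ) + 1) - 1 / ((k + 1 : ℕ) + 1) := by
    rw [sub_pos]
    exact one_div_lt_one_div_of_lt (by positivity) (by push_cast; linarith)
  have hev : ∀ᶠ n : ℕ in atTop,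
      2 * K * |s| ≤ (1 / ((k : ℝ) + 1) - 1 / ((k + 1 : ℕ) + 1)) * n :=
    (tendsto_natCast_atTop_atTop.const_mul_atTop hpos).eventually_ge_atTop _
  refine ⟨k + 1, (hk.and_eventually hev).mono fun n hn => ?_⟩
  obtain ⟨h1, h2⟩ := hn
  rw [integral_shift hτ, zero_add]
  have e1 := intervalIntegral.integral_add_adjacent_intervals (hS.intervalIntegrable ω 0 s)
      (hS.intervalIntegrable ω s (n + s))
  have e2 := intervalIntegral.integral_add_adjacent_intervals (hS.intervalIntegrable ω 0 n)
      (hS.intervalIntegrable ω n (n + s))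
  have e3 := abs_le.1 (hS.abs_integral_le ω 0 s)
  have e4 := abs_le.1 (hS.abs_integral_le ω n (n + s))
  rw [sub_zero] at e3
  rw [add_sub_cancel_left] at e4
  linarith

/-- With c' midway between the mean and c, the exceedance event is invariant. If it had probability
one, the Birkhoff sums of the unit block integrals minus c' would almost surely become positive, and
the maximal lemma would make the mean at least c'. -/
lemma ae_eventually_le [IsProbabilityMeasure P] (hS : IsFlowObservable τ S K)
    (hτ : IsErgodicGroup P τ) {c : ℝ} (hc : ∫ ω, S ω ∂P < c) :
    ∀ᵐ ω ∂P, ∀ᶠ n : ℕ in atTop, ∫ z in (0 : ℝ)..n, S (τ z ω) ≤ c * n := by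
  set c' := (c + ∫ ω, S ω ∂P) / 2 with hc'
  have hinv : ∀ s, τ s ⁻¹' exceedance τ S c' = exceedance τ S c' := fun s => by
    ext ω
    refine ⟨fun h => ?_, fun h => hS.apply_mem_exceedance hτ h s⟩
    have := hS.apply_mem_exceedance hτ h (-s)
    rwa [hτ.apply_apply, neg_add_cancel, hτ.apply_zero] at this
  have hmeas := hS.measurableSet_exceedance c'
  have hzero : P (exceedance τ S c') = 0 := by
    refine (hτ.ergodic _ hmeas hinv).resolve_right fun h1 => ?_
    have hae : ∀ᵐ ω ∂P, ω ∈ exceedance τ S c' := (prob_compl_eq_zero_iff hmeas).2 h1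
    have h2 := integral_nonneg_of_birkhoffSum_pos (hτ.preserving 1)
      (f := fun ω => (∫ z in (0 : ℝ)..1, S (τ z ω)) - c') (K := K + |c'|)
      ((hS.measurable_integral zero_le_one).sub_const c')
      (fun ω => (abs_sub _ _).trans (by
        have := hS.abs_integral_le ω 0 1
        norm_num at this
        linarith)) (by
      filter_upwards [hae] with ω ⟨k, hk⟩
      obtain ⟨n, hn⟩ := hk.exists
      refine ⟨n, ?_⟩
      rw [hS.birkhoffSum_eq hτ]
      have : 0 ≤ 1 / ((k : ℝ) + 1) * n := by positivity
      linarith)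
    rw [integral_sub (integrable_of_abs_le (hS.measurable_integral zero_le_one)
      fun ω => hS.abs_integral_le ω 0 1) (integrable_const c'), hS.integral_integral hτ] at h2
    simp at h2
    linarith
  have hc'c : c' < c := by linarith
  obtain ⟨k, hk⟩ := exists_nat_one_div_lt (sub_pos.2 hc'c)
  filter_upwards [measure_eq_zero_iff_ae_notMem.1 hzero] with ω hω
  have h1 : ¬ ∃ᶠ n : ℕ in atTop, (c' + 1 / (k + 1)) * n < ∫ z in (0 : ℝ)..n, S (τ z ω) :=
    fun h => hω ⟨k, h⟩
  rw [not_frequently] at h1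
  filter_upwards [h1] with n hn
  refine (not_lt.1 hn).trans ?_
  gcongr
  linarith

lemma ae_tendsto_nat [IsProbabilityMeasure P] (hS : IsFlowObservable τ S K)
    (hτ : IsErgodicGroup P τ) :
    ∀ᵐ ω ∂P, Tendsto (fun n : ℕ => (∫ z in (0 : ℝ)..n, S (τ z ω)) / n) atTop
      (𝓝 (∫ ω, S ω ∂P)) := by
  have h1 : ∀ᵐ ω ∂P, ∀ k : ℕ, ∀ᶠ n : ℕ in atTop,
      ∫ z in (0 : ℝ)..n, S (τ z ω) ≤ ((∫ ω, S ω ∂P) + 1 / (k + 1)) * n :=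
    ae_all_iff.2 fun k => hS.ae_eventually_le hτ (lt_add_of_pos_right _ (by positivity))
  have h2 : ∀ᵐ ω ∂P, ∀ k : ℕ, ∀ᶠ n : ℕ in atTop,
      ∫ z in (0 : ℝ)..n, -S (τ z ω) ≤ ((∫ ω, -S ω ∂P) + 1 / (k + 1)) * n :=
    ae_all_iff.2 fun k => hS.neg.ae_eventually_le hτ (lt_add_of_pos_right _ (by positivity))
  filter_upwards [h1, h2] with ω a1 a2
  rw [tendsto_order]
  constructor
  · intro a ha
    obtain ⟨k, hk⟩ := exists_nat_one_div_lt (sub_pos.2 ha)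
    filter_upwards [a2 k, eventually_gt_atTop 0] with n hn hn0
    have : (0 : ℝ) < n := by exact_mod_cast hn0
    rw [intervalIntegral.integral_neg, integral_neg] at hn
    rw [lt_div_iff₀ this]
    nlinarith
  · intro a ha
    obtain ⟨k, hk⟩ := exists_nat_one_div_lt (sub_pos.2 ha)
    filter_upwards [a1 k, eventually_gt_atTop 0] with n hn hn0
    have : (0 : ℝ) < n := by exact_mod_cast hn0
    rw [div_lt_iff₀ this]
    nlinarith

/-- The ergodic theorem along a flow, at `+∞`. -/
theorem ae_tendsto_atTop [IsProbabilityMeasure P] (hS : IsFlowObservable τ S K)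
    (hτ : IsErgodicGroup P τ) :
    ∀ᵐ ω ∂P, Tendsto (fun x : ℝ => (∫ z in (0 : ℝ)..x, S (τ z ω)) / x) atTop
      (𝓝 (∫ ω, S ω ∂P)) := by
  filter_upwards [hS.ae_tendsto_nat hτ] with ω hω
  have h1 : Tendsto (fun x : ℝ => (∫ z in (0 : ℝ)..(⌊x⌋₊ : ℝ), S (τ z ω)) / ⌊x⌋₊ * (⌊x⌋₊ / x))
      atTop (𝓝 ((∫ ω, S ω ∂P) * 1)) :=
    (hω.comp (tendsto_nat_floor_atTop (α := ℝ))).mul (tendsto_nat_floor_div_atTop (R := ℝ))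
  have h2 : Tendsto (fun x : ℝ => (∫ z in (⌊x⌋₊ : ℝ)..x, S (τ z ω)) / x) atTop (𝓝 0) := by
    refine squeeze_zero_norm' ?_ (tendsto_const_nhds.div_atTop tendsto_id : Tendsto
      (fun x : ℝ => K / x) atTop (𝓝 0))
    filter_upwards [eventually_gt_atTop 0] with x hx
    rw [norm_div, Real.norm_eq_abs, Real.norm_eq_abs, abs_of_pos hx]
    have hK0 : 0 ≤ K := (abs_nonneg _).trans (hS.bound ω)
    gcongr
    refine (hS.abs_integral_le ω _ _).trans ?_
    rw [abs_of_nonneg (sub_nonneg.2 (Nat.floor_le hx.le))]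
    have := Nat.lt_floor_add_one x
    nlinarith
  have h3 := h1.add h2
  rw [mul_one, add_zero] at h3
  refine h3.congr' ?_
  filter_upwards [eventually_ge_atTop 1] with x hx
  have hf : (⌊x⌋₊ : ℝ) ≠ 0 := by
    exact_mod_cast (Nat.floor_pos.2 hx).ne'
  rw [← intervalIntegral.integral_add_adjacent_intervals (hS.intervalIntegrable ω 0 ⌊x⌋₊)
    (hS.intervalIntegrable ω ⌊x⌋₊ x)]
  field_simp

/-- The ergodic theorem along a flow, at `-∞`. -/
theorem ae_tendsto_atBot [IsProbabilityMeasure P] (hS : IsFlowObservable τ S K)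
    (hτ : IsErgodicGroup P τ) :
    ∀ᵐ ω ∂P, Tendsto (fun x : ℝ => (∫ z in (0 : ℝ)..x, S (τ z ω)) / x) atBot
      (𝓝 (∫ ω, S ω ∂P)) := by
  filter_upwards [hS.reverse.ae_tendsto_atTop hτ.neg] with ω hω
  refine (hω.comp tendsto_neg_atBot_atTop).congr fun x => ?_
  have h := intervalIntegral.integral_comp_neg (a := 0) (b := -x) fun z => S (τ z ω)
  rw [neg_neg, neg_zero] at h
  simp only [Function.comp]
  rw [h, intervalIntegral.integral_symm, neg_div_neg_eq]

end IsFlowObservable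


/-! ### Joint measurability of the slope -/

/-- A countable description, for joint measurability in (z, ω). The bound −N confines the
approximate starting points to a compact interval, where a subsequence converges to a true one. -/
lemma mem_phaseSet_iff_rat {m M : ℝ} {W : ℝ → ℝ} (hW : Continuous W) (hm : m < M) (z : ℝ) :
    z ∈ phaseSet m M W ↔ ∃ b : ℚ, z < b ∧ ∃ N : ℕ, ∀ n : ℕ, ∃ a : ℚ, (-(N : ℝ) ≤ a ∧
      (a : ℝ) < z + 1 / (n + 1)) ∧ M - 1 / (n + 1) ≤ W a ∧
      ∀ s : ℚ, a ≤ s ∧ s < b → m - 1 / (n + 1) ≤ W s := by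
  constructor
  · rintro ⟨a, b, h1, h2, h3, h4⟩
    obtain ⟨b', hb', hb'b⟩ := exists_rat_btwn h2
    obtain ⟨N, hN⟩ := exists_nat_ge (-a)
    refine ⟨b', hb', N, fun n => ?_⟩
    have hn : (0 : ℝ) < 1 / (n + 1) := by positivity
    have hev : ∀ᶠ s in 𝓝 a, M - 1 / ((n : ℝ) + 1) < W s :=
      hW.continuousAt.eventually (lt_mem_nhds (by linarith))
    obtain ⟨c, hc, hcs⟩ := exists_Ico_subset_of_mem_nhds hev ⟨a + 1, by linarith⟩
    obtain ⟨a', ha', ha'c⟩ := exists_rat_btwn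
      (show a < min c (z + 1 / (n + 1)) from lt_min hc (by linarith))
    rw [lt_min_iff] at ha'c
    refine ⟨a', ⟨by linarith, ha'c.2⟩, (hcs ⟨ha'.le, ha'c.1⟩).le, fun s hs => ?_⟩
    have h5 : (a' : ℝ) ≤ s := by exact_mod_cast hs.1
    have h6 : (s : ℝ) < b' := by exact_mod_cast hs.2
    have := h4 s ⟨by linarith, by linarith⟩
    linarith
  · rintro ⟨b, hb, N, h⟩
    choose a ha1 ha2 ha3 using h
    have hmem : ∀ n, (a n : ℝ) ∈ Icc (-(N : ℝ)) (z + 1) := fun n => by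
      refine ⟨(ha1 n).1, (ha1 n).2.le.trans ?_⟩
      have : (1 : ℝ) / (n + 1) ≤ 1 := by
        rw [div_le_one (by positivity)]; linarith [n.cast_nonneg (α := ℝ)]
      linarith
    obtain ⟨a₀, -, φ, hφ, hlim⟩ := isCompact_Icc.tendsto_subseq hmem
    have hinv : Tendsto (fun n => (1 : ℝ) / ((φ n : ℝ) + 1)) atTop (𝓝 0) :=
      (tendsto_one_div_add_atTop_nhds_zero_nat (𝕜 := ℝ)).comp hφ.tendsto_atTop
    have haz : a₀ ≤ z := by
      have := (tendsto_const_nhds (x := z)).add hinv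
      rw [add_zero] at this
      exact le_of_tendsto_of_tendsto' hlim this fun n => (ha1 (φ n)).2.le
    have hWa : M ≤ W a₀ := by
      have h1 := (tendsto_const_nhds (x := M)).sub hinv
      rw [sub_zero] at h1
      exact le_of_tendsto_of_tendsto' h1 ((hW.tendsto a₀).comp hlim) fun n => ha2 (φ n)
    have hrat : ∀ s : ℚ, a₀ < s → (s : ℝ) < b → m ≤ W s := fun s hs hsb => by
      have h1 := (tendsto_const_nhds (x := m)).sub hinv
      rw [sub_zero] at h1
      refine le_of_tendsto h1 ?_
      filter_upwards [hlim.eventually (gt_mem_nhds hs)] with n hn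
      exact ha3 (φ n) s ⟨by exact_mod_cast (show (a (φ n) : ℝ) ≤ s from le_of_lt hn),
        by exact_mod_cast hsb⟩
    refine ⟨a₀, b, haz, hb, hWa, fun s hs => ?_⟩
    rcases hs.1.lt_or_eq with h | h
    · by_contra! hlt
      have hev : {t | W t < m} ∈ 𝓝 s := hW.continuousAt.eventually (gt_mem_nhds hlt)
      obtain ⟨c, hc, hcs⟩ := exists_Ico_subset_of_mem_nhds hev ⟨s + 1, by linarith⟩
      obtain ⟨q, hq, hqc⟩ := exists_rat_btwn (lt_min hc hs.2)
      rw [lt_min_iff] at hqc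
      exact (hrat q (h.trans hq) hqc.2).not_gt (hcs ⟨hq.le, hqc.1⟩)
    · rw [← h]; exact hm.le.trans hWa

lemma measurableSet_phaseSet {Ω : Type*} [MeasurableSpace Ω] {m M : ℝ} (hm : m < M)
    {W : Ω → ℝ → ℝ} (hW : ∀ ω, Continuous (W ω)) (hWm : ∀ s, Measurable fun ω => W ω s) :
    MeasurableSet {q : ℝ × Ω | q.1 ∈ phaseSet m M (W q.2)} := by
  simp only [mem_phaseSet_iff_rat (hW _) hm]
  have hWq : ∀ a : ℚ, Measurable fun q : ℝ × Ω => W q.2 a := fun a => (hWm a).comp measurable_snd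
  refine measurableSet_setOfPred.2 ?_
  refine Measurable.exists fun b => Measurable.and ?_ (Measurable.exists fun N =>
    Measurable.forall fun n => Measurable.exists fun a => Measurable.and (Measurable.and ?_ ?_)
      (Measurable.and ?_ (Measurable.forall fun s => Measurable.imp ?_ ?_)))
  · exact measurableSet_setOfPred.1 (measurableSet_lt measurable_fst measurable_const)
  · exact measurable_const
  · exact measurableSet_setOfPred.1
      (measurableSet_lt measurable_const (measurable_fst.add_const _))
  · exact measurableSet_setOfPred.1 (measurableSet_le measurable_const (hWq a))
  · exact measurable_const
  · exact measurableSet_setOfPred.1 (measurableSet_le measurable_const (hWq s))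

lemma measurable_phaseSlope {Ω : Type*} [MeasurableSpace Ω] {G : ℝ → ℝ} {m M pm pM : ℝ}
    (hG : IsDoubleWell G m M pm pM) {W : Ω → ℝ → ℝ} (hW : ∀ ω, Continuous (W ω))
    (hWm : Measurable fun q : ℝ × Ω => W q.2 q.1) (hW0 : ∀ ω s, 0 ≤ W ω s) :
    Measurable fun q : ℝ × Ω => phaseSlope G m M pm pM (W q.2) q.1 := by
  have hA : MeasurableSet {q : ℝ × Ω | q.1 ∈ phaseSet m M (W q.2)} :=
    measurableSet_phaseSet hG.m_lt_M hW fun s => hWm.comp measurable_prodMk_left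
  -- Clamping the argument extends each inverse branch continuously to ℝ without changing the values
  -- that occur.
  have c1 : Continuous fun w => invG₁ G pm (max m w) :=
    hG.continuousOn_invG₁.comp_continuous (by fun_prop) fun w => mem_Ici.2 (le_max_left _ _)
  have hM0 : 0 ≤ M := hG.zero_le_m.trans hG.m_lt_M.le
  have c3 : Continuous fun w => invG₃ G pM (max 0 (min M w)) :=
    hG.continuousOn_invG₃.comp_continuous (by fun_prop)
      fun w => ⟨le_max_left _ _, max_le hM0 (min_le_left _ _)⟩
  classical
  have heq : (fun q : ℝ × Ω => phaseSlope G m M pm pM (W q.2) q.1) = fun q =>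
      if q ∈ {q : ℝ × Ω | q.1 ∈ phaseSet m M (W q.2)} then invG₁ G pm (max m (W q.2 q.1))
        else invG₃ G pM (max 0 (min M (W q.2 q.1))) := by
    funext q
    by_cases h : q.1 ∈ phaseSet m M (W q.2)
    · simp only [mem_ofPred_eq, if_pos h]
      rw [phaseSlope_of_mem h, max_eq_right (le_of_mem_phaseSet h)]
    · simp only [mem_ofPred_eq, if_neg h]
      rw [phaseSlope_of_notMem h,
        min_eq_right (lt_of_notMem_phaseSet (hW _) hG.m_lt_M h).le, max_eq_right (hW0 _ _)]
  rw [heq]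
  exact Measurable.ite hA (c1.measurable.comp hWm) (c3.measurable.comp hWm)

/-! ### Right continuity of the slope in the level -/

/-- Such points are isolated from the left in the complement of A. They are the only points where
right continuity in the level can fail. -/
lemma countable_left_boundary (A : Set ℝ) :
    {z | z ∉ A ∧ ∀ᶠ y in 𝓝[<] z, y ∈ A}.Countable := by
  refine (countable_setOfPred_isolated_left_within (s := Aᶜ)).mono ?_
  rintro z ⟨hz, hl⟩
  refine ⟨hz, ?_⟩
  rw [← empty_mem_iff_bot]
  have h1 : ∀ᶠ y in 𝓝[Aᶜ ∩ Iio z] z, y ∈ A := nhdsWithin_mono _ inter_subset_right hl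
  filter_upwards [h1, self_mem_nhdsWithin] with y h2 h3 using h3.1 h2

/-- If z belonged to the phase of every raised path, the starting points would accumulate at some
a₀: a low point of W bounds them from below, and W z < M forces a₀ < z. Then a₀ would put the points
just left of z in the phase of W itself. -/
lemma exists_notMem_phaseSet_add {m M : ℝ} {W : ℝ → ℝ} (hW : Continuous W) (hm : m < M)
    (hlow : ∀ N, ∃ z, z ≤ N ∧ W z < m) {z : ℝ} (hz : z ∉ phaseSet m M W)
    (hl : ∀ᶠ y in 𝓝[<] z, y ∉ phaseSet m M W) :
    ∃ ε > 0, z ∉ phaseSet m M fun s => W s + ε := by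
  by_contra! hcon
  obtain ⟨c, hcz, hc⟩ := hlow z
  set δ := (m - W c) / 2 with hδ
  have hδ0 : 0 < δ := by rw [hδ]; linarith
  set ε : ℕ → ℝ := fun n => δ * (1 / (n + 1)) with hε
  have hε0 : ∀ n, 0 < ε n := fun n => by positivity
  have hεδ : ∀ n, ε n ≤ δ := fun n => by
    have : (1 : ℝ) / (n + 1) ≤ 1 := by
      rw [div_le_one (by positivity)]; linarith [n.cast_nonneg (α := ℝ)]
    simp only [hε]; nlinarith
  have hεlim : Tendsto ε atTop (𝓝 0) := by
    have := (tendsto_one_div_add_atTop_nhds_zero_nat (𝕜 := ℝ)).const_mul δ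
    rwa [mul_zero] at this
  choose a b h1 h2 h3 h4 using fun n => hcon (ε n) (hε0 n)
  have hca : ∀ n, a n ∈ Icc c z := fun n => by
    refine ⟨?_, h1 n⟩
    by_contra! hlt
    have := h4 n c ⟨hlt.le, hcz.trans_lt (h2 n)⟩
    linarith [hεδ n]
  obtain ⟨a₀, ha₀, φ, hφ, hlim⟩ := isCompact_Icc.tendsto_subseq hca
  have hεφ : Tendsto (fun n => ε (φ n)) atTop (𝓝 0) := hεlim.comp hφ.tendsto_atTop
  have hWa : M ≤ W a₀ := by
    have h5 := ((hW.tendsto a₀).comp hlim).add hεφ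
    rw [add_zero] at h5
    exact ge_of_tendsto' h5 fun n => h3 (φ n)
  have haz : a₀ < z := by
    refine lt_of_le_of_ne ha₀.2 fun h => ?_
    rw [h] at hWa
    exact (lt_of_notMem_phaseSet hW hm hz).not_ge hWa
  obtain ⟨y, hy, hy'⟩ := (hl.and (Ioo_mem_nhdsLT haz)).exists
  refine hy ⟨a₀, z, hy'.1.le, hy'.2, hWa, fun s hs => ?_⟩
  rcases hs.1.lt_or_eq with h | h
  · have h5 := (tendsto_const_nhds (x := W s)).add hεφ
    rw [add_zero] at h5
    refine ge_of_tendsto h5 ?_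
    filter_upwards [hlim.eventually (gt_mem_nhds h)] with n hn
    exact h4 (φ n) s ⟨le_of_lt hn, hs.2.trans (h2 _)⟩
  · rw [← h]; exact hm.le.trans hWa

lemma tendsto_phaseSlope_level {G : ℝ → ℝ} {m M pm pM : ℝ} (hG : IsDoubleWell G m M pm pM)
    {g : ℝ → ℝ} (hg : Continuous g) {lam : ℝ} (h0 : ∀ s, 0 ≤ lam - g s)
    (hlow : ∀ N, ∃ z, z ≤ N ∧ lam - g z < m) {z : ℝ}
    (hz : ¬ (z ∉ phaseSet m M (fun s => lam - g s) ∧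
      ∀ᶠ y in 𝓝[<] z, y ∈ phaseSet m M (fun s => lam - g s))) :
    Tendsto (fun l => phaseSlope G m M pm pM (fun s => l - g s) z) (𝓝[≥] lam)
      (𝓝 (phaseSlope G m M pm pM (fun s => lam - g s) z)) := by
  have hc : ∀ l : ℝ, Continuous fun s => l - g s := fun l => continuous_const.sub hg
  have hlt := hG.m_lt_M
  have hlin : Tendsto (fun l => l - g z) (𝓝[≥] lam) (𝓝 (lam - g z)) :=
    (show Continuous fun l => l - g z by fun_prop).continuousWithinAt
  by_cases hzA : z ∈ phaseSet m M (fun s => lam - g s)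
  · have hmem : ∀ᶠ l in 𝓝[≥] lam, z ∈ phaseSet m M (fun s => l - g s) := by
      filter_upwards [self_mem_nhdsWithin] with l hl
      exact phaseSet_mono (fun s => by simp only [mem_Ici] at hl; linarith) hzA
    rw [phaseSlope_of_mem hzA]
    refine ((hG.continuousOn_invG₁ _ (le_of_mem_phaseSet hzA)).tendsto.comp
      (tendsto_nhdsWithin_iff.2 ⟨hlin,
        hmem.mono fun l hl => le_of_mem_phaseSet (W := fun s => l - g s) hl⟩)).congr'
      (hmem.mono fun l hl => (phaseSlope_of_mem hl).symm)
  · have hl := (eventually_left_phaseSet (hc lam) hlt z).resolve_left fun h => hz ⟨hzA, h⟩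
    obtain ⟨ε, hε, hεz⟩ := exists_notMem_phaseSet_add (hc lam) hlt hlow hzA hl
    have hmem : ∀ᶠ l in 𝓝[≥] lam, z ∉ phaseSet m M (fun s => l - g s) := by
      filter_upwards [Ico_mem_nhdsGE (lt_add_of_pos_right lam hε)] with l hl h
      exact hεz (phaseSet_mono (fun s => by linarith [hl.2]) h)
    have hIcc : ∀ᶠ l in 𝓝[≥] lam, l - g z ∈ Icc 0 M := by
      filter_upwards [hmem, self_mem_nhdsWithin] with l h1 h2
      exact ⟨by have := h0 z; simp only [mem_Ici] at h2; linarith,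
        (lt_of_notMem_phaseSet (hc l) hlt h1).le⟩
    rw [phaseSlope_of_notMem hzA]
    exact ((hG.continuousOn_invG₃ _ ⟨h0 z, (lt_of_notMem_phaseSet (hc lam) hlt hzA).le⟩).tendsto.comp
      (tendsto_nhdsWithin_iff.2 ⟨hlin, hIcc⟩)).congr'
      (hmem.mono fun l hl => (phaseSlope_of_notMem hl).symm)

/-! ### The stationary potential -/

namespace IsPotential

variable {Ω : Type*} [MeasurableSpace Ω] {P : Measure Ω} {τ : ℝ → Ω → Ω} {V : ℝ → Ω → ℝ}

lemma apply_flow (hV : IsPotential P τ V) (hτ : IsErgodicGroup P τ) (x y : ℝ) (ω : Ω) :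
    V x (τ y ω) = V (x + y) ω := by
  rw [hV.stationary, hτ.apply_apply, ← hV.stationary]

lemma reverse (hV : IsPotential P τ V) : IsPotential P (fun x => τ (-x)) fun x => V (-x) where
  measurable := hV.measurable.comp (measurable_fst.neg.prodMk measurable_snd)
  stationary x ω := by rw [neg_zero]; exact hV.stationary (-x) ω
  uniformContinuous ω := (hV.uniformContinuous ω).comp uniformContinuous_neg
  bounded ω := let ⟨C, hC⟩ := hV.bounded ω; ⟨C, fun x => hC (-x)⟩
  normalized := by
    filter_upwards [hV.normalized] with ω hω
    have : (range fun x => V (-x) ω) = range fun x => V x ω :=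
      (Equiv.neg ℝ).surjective.range_comp fun x => V x ω
    rwa [this]

/-- The events of visiting U after time t are translates of one another, so they share one
probability. Their union as t → −∞ is almost sure, so each of them is. Only stationarity is used,
not ergodicity. -/
lemma ae_frequently_top [IsProbabilityMeasure P] (hV : IsPotential P τ V)
    (hτ : IsErgodicGroup P τ) {U : Set ℝ} (hU : IsOpen U)
    (h : ∀ᵐ ω ∂P, ∃ x, V x ω ∈ U) : ∀ᵐ ω ∂P, ∀ N, ∃ z, N ≤ z ∧ V z ω ∈ U := by
  let E : ℝ → Set Ω := fun t => {ω | ∃ z, t < z ∧ V z ω ∈ U}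
  have hErat : ∀ t, E t = ⋃ q : ℚ, ⋃ _ : t < (q : ℝ), {ω | V q ω ∈ U} := fun t => by
    ext ω
    simp only [E, mem_iUnion, mem_ofPred_eq, exists_prop]
    constructor
    · rintro ⟨z, hz, hzU⟩
      have hopen : IsOpen (Ioi t ∩ (fun x => V x ω) ⁻¹' U) :=
        isOpen_Ioi.inter (hU.preimage (hV.uniformContinuous ω).continuous)
      exact (Rat.denseRange_cast (𝕜 := ℝ)).exists_mem_open hopen ⟨z, hz, hzU⟩
    · rintro ⟨q, hq⟩
      exact ⟨q, hq⟩
  have hEm : ∀ t, MeasurableSet (E t) := fun t => by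
    rw [hErat]
    exact .iUnion fun q => .iUnion fun _ =>
      (hV.measurable.comp measurable_prodMk_left) hU.measurableSet
  have hEshift : ∀ t, P (E t) = P (E 0) := fun t => by
    have : E t = τ t ⁻¹' E 0 := by
      ext ω
      simp only [E, mem_preimage, mem_ofPred_eq, hV.apply_flow hτ]
      exact ⟨fun ⟨z, h1, h2⟩ => ⟨z - t, by linarith, by simpa using h2⟩,
        fun ⟨z, h1, h2⟩ => ⟨z + t, by linarith, h2⟩⟩
    rw [this, (hτ.preserving t).measure_preimage (hEm 0).nullMeasurableSet]
  have hmono : Monotone fun n : ℕ => E (-(n : ℝ)) := fun n k hnk ω ⟨z, h1, h2⟩ => by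
    have : (n : ℝ) ≤ k := by exact_mod_cast hnk
    exact ⟨z, by linarith, h2⟩
  have hone : P (E 0) = 1 := by
    have h1 := hmono.measure_iUnion (μ := P)
    simp only [hEshift, ciSup_const] at h1
    rw [← h1]
    refine (mem_ae_iff_prob_eq_one (.iUnion fun n => hEm _)).1 ?_
    filter_upwards [h] with ω ⟨x, hx⟩
    obtain ⟨n, hn⟩ := exists_nat_gt (-x)
    exact mem_iUnion.2 ⟨n, x, by linarith, hx⟩
  have hall : ∀ᵐ ω ∂P, ∀ n : ℕ, ω ∈ E n :=
    ae_all_iff.2 fun n => (mem_ae_iff_prob_eq_one (hEm n)).2 ((hEshift n).trans hone)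
  filter_upwards [hall] with ω hω N
  obtain ⟨n, hn⟩ := exists_nat_ge N
  obtain ⟨z, h1, h2⟩ := hω n
  exact ⟨z, by linarith, h2⟩

lemma ae_frequently_bot [IsProbabilityMeasure P] (hV : IsPotential P τ V)
    (hτ : IsErgodicGroup P τ) {U : Set ℝ} (hU : IsOpen U)
    (h : ∀ᵐ ω ∂P, ∃ x, V x ω ∈ U) : ∀ᵐ ω ∂P, ∀ N, ∃ z, z ≤ N ∧ V z ω ∈ U := by
  have h' : ∀ᵐ ω ∂P, ∃ x, V (-x) ω ∈ U := by
    filter_upwards [h] with ω ⟨x, hx⟩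
    exact ⟨-x, by simpa using hx⟩
  filter_upwards [hV.reverse.ae_frequently_top hτ.neg hU h'] with ω hω N
  obtain ⟨z, h1, h2⟩ := hω (-N)
  exact ⟨-z, by linarith, h2⟩

/-- Where V is near its infimum 0, the path exceeds M because lam > M; where V is near its supremum
1, it is below m because lam < m + β. -/
lemma ae_isRecurrent [IsProbabilityMeasure P] (hV : IsPotential P τ V) (hτ : IsErgodicGroup P τ)
    {β m M lam : ℝ} (hβ : 0 < β) (hM : M < lam) (hlam : lam < m + β) :
    ∀ᵐ ω ∂P, IsRecurrent m M fun s => lam - β * V s ω := by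
  have hlo : ∀ᵐ ω ∂P, ∃ x, V x ω ∈ Iio ((lam - M) / β) := by
    filter_upwards [hV.normalized] with ω hω
    obtain ⟨_, ⟨x, rfl⟩, -, hx⟩ := hω.1.exists_between (div_pos (sub_pos.2 hM) hβ)
    exact ⟨x, hx⟩
  have hhi : ∀ᵐ ω ∂P, ∃ x, V x ω ∈ Ioi ((lam - m) / β) := by
    filter_upwards [hV.normalized] with ω hω
    obtain ⟨_, ⟨x, rfl⟩, hx, -⟩ := hω.2.exists_between
      (show (lam - m) / β < 1 by rw [div_lt_one hβ]; linarith)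
    exact ⟨x, hx⟩
  filter_upwards [hV.ae_frequently_top hτ isOpen_Iio hlo, hV.ae_frequently_bot hτ isOpen_Iio hlo,
    hV.ae_frequently_top hτ isOpen_Ioi hhi, hV.ae_frequently_bot hτ isOpen_Ioi hhi] with ω
    h1 h2 h3 h4
  have k1 : ∀ z, V z ω ∈ Iio ((lam - M) / β) → M ≤ lam - β * V z ω := fun z hz => by
    rw [mem_Iio, lt_div_iff₀ hβ] at hz; linarith
  have k2 : ∀ z, V z ω ∈ Ioi ((lam - m) / β) → lam - β * V z ω < m := fun z hz => by
    rw [mem_Ioi, div_lt_iff₀ hβ] at hz; linarith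
  exact ⟨fun N => (h1 N).imp fun z hz => ⟨hz.1, k1 z hz.2⟩,
    fun N => (h2 N).imp fun z hz => ⟨hz.1, k1 z hz.2⟩,
    fun N => (h3 N).imp fun z hz => ⟨hz.1, k2 z hz.2⟩,
    fun N => (h4 N).imp fun z hz => ⟨hz.1, k2 z hz.2⟩⟩

lemma ae_mem_Icc (hV : IsPotential P τ V) : ∀ᵐ ω ∂P, ∀ x, V x ω ∈ Icc 0 1 := by
  filter_upwards [hV.normalized] with ω hω x
  exact ⟨hω.1.1 ⟨x, rfl⟩, hω.2.1 ⟨x, rfl⟩⟩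

end IsPotential


/-! ### The mean slope as a function of the level -/

/-- The path `lam - β V`, with the potential clipped to `[0, 1]`. -/
def clippedLevel {Ω : Type*} (β : ℝ) (V : ℝ → Ω → ℝ) (lam : ℝ) (ω : Ω) (s : ℝ) : ℝ :=
  lam - β * max 0 (min 1 (V s ω))

/-- The slope of the corrector at the origin, for the clipped potential. -/
def levelSlope {Ω : Type*} (G : ℝ → ℝ) (m M pm pM β : ℝ) (V : ℝ → Ω → ℝ) (lam : ℝ) (ω : Ω) : ℝ :=
  phaseSlope G m M pm pM (clippedLevel β V lam ω) 0

lemma clippedLevel_mem_Icc {Ω : Type*} {V : ℝ → Ω → ℝ} {β lam : ℝ}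
    (hβ : 0 ≤ β) (ω : Ω) (s : ℝ) :
    clippedLevel β V lam ω s ∈ Icc (lam - β) lam := by
  have h0 : 0 ≤ max 0 (min 1 (V s ω)) := le_max_left _ _
  have h1 : max 0 (min 1 (V s ω)) ≤ 1 := max_le zero_le_one (min_le_left _ _)
  constructor <;> simp only [clippedLevel] <;> nlinarith

lemma clippedLevel_nonneg {Ω : Type*} {V : ℝ → Ω → ℝ} {β lam : ℝ}
    (hβ : 0 ≤ β) (hlam : β ≤ lam) (ω : Ω) (s : ℝ) :
    0 ≤ clippedLevel β V lam ω s :=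
  (sub_nonneg.2 hlam).trans (clippedLevel_mem_Icc hβ ω s).1

lemma clippedLevel_eq {Ω : Type*} {V : ℝ → Ω → ℝ} {β lam : ℝ} {ω : Ω} (h : ∀ x, V x ω ∈ Icc 0 1) :
    clippedLevel β V lam ω = fun s => lam - β * V s ω := by
  funext s
  rw [clippedLevel, min_eq_right (h s).2, max_eq_right (h s).1]

section level

variable {Ω : Type*} [MeasurableSpace Ω] {P : Measure Ω} {τ : ℝ → Ω → Ω} {V : ℝ → Ω → ℝ}
  {G : ℝ → ℝ} {m M pm pM β lam : ℝ}

lemma continuous_clippedLevel (hV : IsPotential P τ V) (ω : Ω) :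
    Continuous (clippedLevel β V lam ω) :=
  continuous_const.sub (continuous_const.mul
    (continuous_const.max (continuous_const.min (hV.uniformContinuous ω).continuous)))

lemma levelSlope_flow (hτ : IsErgodicGroup P τ) (hV : IsPotential P τ V) (z : ℝ) (ω : Ω) :
    levelSlope G m M pm pM β V lam (τ z ω)
      = phaseSlope G m M pm pM (clippedLevel β V lam ω) z := by
  have : clippedLevel β V lam (τ z ω) = fun s => clippedLevel β V lam ω (s + z) := by
    funext s
    simp only [clippedLevel, hV.apply_flow hτ]
  rw [levelSlope, this, phaseSlope_comp_add, zero_add]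

/-- Clipping the potential gives measurability and bounds for every ω, not just almost every one.
The free `K` provides one bound for a whole range of levels. -/
lemma isFlowObservable_levelSlope (hτ : IsErgodicGroup P τ) (hV : IsPotential P τ V)
    (hG : IsDoubleWell G m M pm pM) (hβ : 0 ≤ β) (hlam : β ≤ lam) (hM : M ≤ lam) {K : ℝ}
    (hK : lam ≤ K) :
    IsFlowObservable τ (levelSlope G m M pm pM β V lam) (-invG₁ G pm K) where
  measurable := by
    simp only [levelSlope_flow hτ hV]
    refine measurable_phaseSlope hG (continuous_clippedLevel hV) ?_ (clippedLevel_nonneg hβ hlam)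
    exact measurable_const.sub (measurable_const.mul
      (measurable_const.max (measurable_const.min hV.measurable)))
  bound ω := by
    have := phaseSlope_mem_Icc hG (continuous_clippedLevel (β := β) (lam := lam) hV ω)
      (clippedLevel_nonneg hβ hlam ω) (fun s => (clippedLevel_mem_Icc hβ ω s).2.trans hK)
      (hM.trans hK) 0
    rw [levelSlope, abs_of_nonpos this.2]
    exact neg_le_neg this.1

lemma ae_slope13_eq [IsProbabilityMeasure P] (hτ : IsErgodicGroup P τ) (hV : IsPotential P τ V)
    (hm : m < M) (hβ : 0 < β) (hM : M < lam) (hlam : lam < m + β) :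
    ∀ᵐ ω ∂P, ∀ z, slope13 G m M pm pM (fun s => lam - β * V s ω) z
      = levelSlope G m M pm pM β V lam (τ z ω) := by
  filter_upwards [hV.ae_isRecurrent hτ hβ hM hlam, hV.ae_mem_Icc] with ω h1 h2 z
  rw [levelSlope_flow hτ hV, clippedLevel_eq h2]
  refine h1.slope13_eq ?_ hm z
  exact uniformContinuous_const.sub
    ((lipschitzWith_smul β).uniformContinuous.comp (hV.uniformContinuous ω))

lemma theta13_eq [IsProbabilityMeasure P] (hτ : IsErgodicGroup P τ) (hV : IsPotential P τ V)
    (hm : m < M) (hβ : 0 < β) (hM : M < lam) (hlam : lam < m + β) :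
    theta13 P G m M pm pM β V lam = ∫ ω, levelSlope G m M pm pM β V lam ω ∂P := by
  refine integral_congr_ae ?_
  filter_upwards [ae_slope13_eq (G := G) (pm := pm) (pM := pM) hτ hV hm hβ hM hlam] with ω hω
  rw [hω 0, hτ.apply_zero]

theorem ae_tendsto_corrector13 [IsProbabilityMeasure P] (hτ : IsErgodicGroup P τ)
    (hV : IsPotential P τ V) (hG : IsDoubleWell G m M pm pM) (hβ : 0 < β) (hβlam : β ≤ lam)
    (hM : M < lam) (hlam : lam < m + β) :
    ∀ᵐ ω ∂P,
      Tendsto (fun x => corrector13 G m M pm pM β V lam ω x / x) atTop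
        (𝓝 (theta13 P G m M pm pM β V lam)) ∧
      Tendsto (fun x => corrector13 G m M pm pM β V lam ω x / x) atBot
        (𝓝 (theta13 P G m M pm pM β V lam)) := by
  have hS := isFlowObservable_levelSlope hτ hV hG hβ.le hβlam hM.le le_rfl
  filter_upwards [ae_slope13_eq (G := G) (pm := pm) (pM := pM) hτ hV hG.m_lt_M hβ hM hlam,
    hS.ae_tendsto_atTop hτ, hS.ae_tendsto_atBot hτ] with ω h1 h2 h3
  rw [theta13_eq hτ hV hG.m_lt_M hβ hM hlam]
  simp only [corrector13, h1]
  exact ⟨h2, h3⟩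

theorem strictAntiOn_theta13 [IsProbabilityMeasure P] (hτ : IsErgodicGroup P τ)
    (hV : IsPotential P τ V) (hG : IsDoubleWell G m M pm pM) (hβ : 0 < β) :
    StrictAntiOn (theta13 P G m M pm pM β V) (Ici β ∩ Ioo M (m + β)) := by
  rintro a ⟨ha1, ha2, ha3⟩ b ⟨hb1, hb2, hb3⟩ hab
  rw [theta13_eq hτ hV hG.m_lt_M hβ ha2 ha3, theta13_eq hτ hV hG.m_lt_M hβ hb2 hb3, ← sub_pos]
  have hSa := isFlowObservable_levelSlope hτ hV hG hβ.le ha1 ha2.le le_rfl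
  have hSb := isFlowObservable_levelSlope hτ hV hG hβ.le hb1 hb2.le le_rfl
  have hia : Integrable (levelSlope G m M pm pM β V a) P :=
    integrable_of_abs_le (hSa.measurable_self hτ) hSa.bound
  have hib : Integrable (levelSlope G m M pm pM β V b) P :=
    integrable_of_abs_le (hSb.measurable_self hτ) hSb.bound
  have hpos : ∀ ω, 0 < levelSlope G m M pm pM β V a ω - levelSlope G m M pm pM β V b ω :=
    fun ω => sub_pos.2 (phaseSlope_lt hG (continuous_clippedLevel hV ω)
      (continuous_clippedLevel hV ω) (clippedLevel_nonneg hβ.le ha1 ω)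
      (fun s => by simp only [clippedLevel]; linarith) 0)
  rw [← integral_sub hia hib, integral_pos_iff_support_of_nonneg (fun ω => (hpos ω).le)
    (hia.sub hib)]
  have : Function.support (fun ω => levelSlope G m M pm pM β V a ω
      - levelSlope G m M pm pM β V b ω) = univ := by
    ext ω; simp [(hpos ω).ne']
  rw [this]
  simp

/-- At a fixed position the slope may jump with the level. Stationarity replaces it by its average
over z in [0, 1], where the countable exceptional set is null, and dominated convergence applies
first in z and then in ω. -/
theorem continuousWithinAt_theta13 [IsProbabilityMeasure P] (hτ : IsErgodicGroup P τ)
    (hV : IsPotential P τ V) (hG : IsDoubleWell G m M pm pM) (hβ : 0 < β) (hβlam : β ≤ lam)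
    (hM : M < lam) (hlam : lam < m + β) :
    ContinuousWithinAt (theta13 P G m M pm pM β V) (Ici lam) lam := by
  have hobs : ∀ l ∈ Ico lam (m + β),
      IsFlowObservable τ (levelSlope G m M pm pM β V l) (-invG₁ G pm (m + β)) := fun l hl =>
    isFlowObservable_levelSlope hτ hV hG hβ.le (hβlam.trans hl.1) (hM.le.trans hl.1) hl.2.le
  have hval : ∀ l ∈ Ico lam (m + β), theta13 P G m M pm pM β V l
      = ∫ ω, (∫ z in (0 : ℝ)..1, levelSlope G m M pm pM β V l (τ z ω)) ∂P := fun l hl => by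
    rw [(hobs l hl).integral_integral hτ,
      theta13_eq hτ hV hG.m_lt_M hβ (hM.trans_le hl.1) hl.2]
  have hev : Ico lam (m + β) ∈ 𝓝[≥] lam := Ico_mem_nhdsGE hlam
  have hmem : lam ∈ Ico lam (m + β) := ⟨le_rfl, hlam⟩
  have hlim : Tendsto
      (fun l => ∫ ω, (∫ z in (0 : ℝ)..1, levelSlope G m M pm pM β V l (τ z ω)) ∂P) (𝓝[≥] lam)
      (𝓝 (∫ ω, (∫ z in (0 : ℝ)..1, levelSlope G m M pm pM β V lam (τ z ω)) ∂P)) := by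
    refine tendsto_integral_filter_of_dominated_convergence (fun _ => -invG₁ G pm (m + β)) ?_ ?_
      (integrable_const _) ?_
    · filter_upwards [hev] with l hl
      exact ((hobs l hl).measurable_integral zero_le_one).aestronglyMeasurable
    · filter_upwards [hev] with l hl
      refine ae_of_all _ fun ω => ?_
      have := (hobs l hl).abs_integral_le ω 0 1
      simpa using this
    · filter_upwards [hV.ae_isRecurrent hτ hβ hM hlam, hV.ae_mem_Icc] with ω h1 h2
      refine intervalIntegral.tendsto_integral_filter_of_dominated_convergence
        (fun _ => -invG₁ G pm (m + β)) ?_ ?_ intervalIntegrable_const ?_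
      · filter_upwards [hev] with l hl
        exact ((hobs l hl).measurable_path ω).aestronglyMeasurable
      · filter_upwards [hev] with l hl
        exact ae_of_all _ fun z _ => (hobs l hl).bound _
      · have hcount := countable_left_boundary (phaseSet m M fun s => lam - β * V s ω)
        filter_upwards [hcount.ae_notMem volume] with z hz _
        simp only [levelSlope_flow hτ hV, clippedLevel_eq h2]
        refine tendsto_phaseSlope_level hG (g := fun s => β * V s ω)
          (continuous_const.mul (hV.uniformContinuous ω).continuous) (fun s => ?_) h1.low_bot hz
        have := (h2 s).2
        nlinarith
  rw [ContinuousWithinAt, hval lam hmem]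
  refine hlim.congr' ?_
  filter_upwards [hev] with l hl using (hval l hl).symm

end level


/-! ### Glued profiles and the rate of decay of the solution -/

open Classical in
/-- The function which is `a` on the left of `z` and `b` on its right. -/
def glue (z : ℝ) (a b : ℝ → ℝ) (x : ℝ) : ℝ := if x < z then a x else b x

section glue

variable {z : ℝ} {a b : ℝ → ℝ}

lemma glue_of_lt {x : ℝ} (h : x < z) : glue z a b x = a x := if_pos h

lemma glue_of_le {x : ℝ} (h : z ≤ x) : glue z a b x = b x := if_neg h.not_gt

lemma measurable_glue (ha : Measurable a) (hb : Measurable b) : Measurable (glue z a b) :=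
  Measurable.ite (measurableSet_Iio (a := z)) ha hb

lemma abs_glue_le {K : ℝ} (ha : ∀ x, |a x| ≤ K) (hb : ∀ x, |b x| ≤ K) (x : ℝ) :
    |glue z a b x| ≤ K := by
  rcases lt_or_ge x z with h | h
  · rw [glue_of_lt h]; exact ha x
  · rw [glue_of_le h]; exact hb x

lemma glue_eventuallyEq_left {x : ℝ} (h : x ≤ z) : glue z a b =ᶠ[𝓝[<] x] a := by
  filter_upwards [self_mem_nhdsWithin] with y hy using glue_of_lt (lt_of_lt_of_le hy h)

lemma glue_eventuallyEq_right {x : ℝ} (h : z ≤ x) : glue z a b =ᶠ[𝓝[>] x] b := by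
  filter_upwards [self_mem_nhdsWithin] with y hy using glue_of_le (h.trans (le_of_lt hy))

lemma glue_eventuallyEq_of_lt {x : ℝ} (h : x < z) : glue z a b =ᶠ[𝓝 x] a := by
  filter_upwards [gt_mem_nhds h] with y hy using glue_of_lt hy

lemma glue_eventuallyEq_of_gt {x : ℝ} (h : z < x) : glue z a b =ᶠ[𝓝 x] b := by
  filter_upwards [lt_mem_nhds h] with y hy using glue_of_le (le_of_lt hy)

lemma integral_glue_of_le {x : ℝ} (h : x ≤ z) :
    ∫ y in z..x, glue z a b y = ∫ y in z..x, a y := by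
  rw [intervalIntegral.integral_symm, intervalIntegral.integral_symm (f := a)]
  congr 1
  rw [intervalIntegral.integral_of_le h, intervalIntegral.integral_of_le h,
    integral_Ioc_eq_integral_Ioo, integral_Ioc_eq_integral_Ioo]
  exact setIntegral_congr_fun measurableSet_Ioo fun y hy => glue_of_lt hy.2

lemma integral_glue_of_ge {x : ℝ} (h : z ≤ x) :
    ∫ y in z..x, glue z a b y = ∫ y in z..x, b y := by
  refine intervalIntegral.integral_congr fun y hy => ?_
  rw [uIcc_of_le h] at hy
  exact glue_of_le hy.1

/-- One-sided limits of a glued function, from those of its pieces and from the limits at the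
point of gluing. -/
lemma exists_glue_limits {Q : ℝ → ℝ → ℝ → Prop} {la rb : ℝ}
    (ha : ∀ x < z, ∃ pl pr, Tendsto a (𝓝[<] x) (𝓝 pl) ∧ Tendsto a (𝓝[>] x) (𝓝 pr) ∧ Q x pl pr)
    (hb : ∀ x > z, ∃ pl pr, Tendsto b (𝓝[<] x) (𝓝 pl) ∧ Tendsto b (𝓝[>] x) (𝓝 pr) ∧ Q x pl pr)
    (hla : Tendsto a (𝓝[<] z) (𝓝 la)) (hrb : Tendsto b (𝓝[>] z) (𝓝 rb)) (hQ : Q z la rb) (x : ℝ) :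
    ∃ pl pr, Tendsto (glue z a b) (𝓝[<] x) (𝓝 pl) ∧ Tendsto (glue z a b) (𝓝[>] x) (𝓝 pr) ∧
      Q x pl pr := by
  rcases lt_trichotomy x z with h | rfl | h
  · obtain ⟨pl, pr, h1, h2, h3⟩ := ha x h
    have heq := (glue_eventuallyEq_of_lt (a := a) (b := b) h).symm
    exact ⟨pl, pr, h1.congr' (heq.filter_mono nhdsWithin_le_nhds),
      h2.congr' (heq.filter_mono nhdsWithin_le_nhds), h3⟩
  · exact ⟨la, rb, hla.congr' (glue_eventuallyEq_left le_rfl).symm,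
      hrb.congr' (glue_eventuallyEq_right le_rfl).symm, hQ⟩
  · obtain ⟨pl, pr, h1, h2, h3⟩ := hb x h
    have heq := (glue_eventuallyEq_of_gt (a := a) (b := b) h).symm
    exact ⟨pl, pr, h1.congr' (heq.filter_mono nhdsWithin_le_nhds),
      h2.congr' (heq.filter_mono nhdsWithin_le_nhds), h3⟩

end glue

/-! ### Comparing glued profiles with linear functions -/

lemma exists_forall_le_of_eventually_le {h : ℝ → ℝ} (hc : Continuous h) {K : ℝ}
    (htop : ∀ᶠ x in atTop, h x ≤ K) (hbot : ∀ᶠ x in atBot, h x ≤ K) : ∃ c, ∀ x, h x ≤ c := by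
  obtain ⟨b, hb⟩ := eventually_atTop.1 htop
  obtain ⟨a, ha⟩ := eventually_atBot.1 hbot
  obtain ⟨C, hC⟩ := (isCompact_Icc (a := a) (b := b)).bddAbove_image hc.continuousOn
  refine ⟨max K C, fun x => ?_⟩
  rcases le_total x a with h1 | h1
  · exact (ha x h1).trans (le_max_left _ _)
  rcases le_total b x with h2 | h2
  · exact (hb x h2).trans (le_max_left _ _)
  · exact (hC ⟨x, ⟨h1, h2⟩, rfl⟩).trans (le_max_right _ _)

/-- A glued primitive whose pieces have asymptotic slopes below `θ` at `+∞` and above `θ` at `-∞`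
stays below `θ x + c`. -/
lemma exists_integral_glue_le {a b : ℝ → ℝ} (ha : Measurable a) (hb : Measurable b) {K : ℝ}
    (hKa : ∀ x, |a x| ≤ K) (hKb : ∀ x, |b x| ≤ K) (z : ℝ) {θ θa θb : ℝ}
    (hta : Tendsto (fun x => (∫ y in (0 : ℝ)..x, a y) / x) atBot (𝓝 θa))
    (htb : Tendsto (fun x => (∫ y in (0 : ℝ)..x, b y) / x) atTop (𝓝 θb))
    (h1 : θb < θ) (h2 : θ < θa) :
    ∃ c, ∀ x, ∫ y in z..x, glue z a b y ≤ θ * x + c := by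
  have hi : ∀ {s : ℝ → ℝ}, Measurable s → (∀ x, |s x| ≤ K) → ∀ p q,
      IntervalIntegrable s volume p q := fun hs hK p q => intervalIntegrable_of_abs_le hs hK p q
  have hcont : Continuous fun x => (∫ y in z..x, glue z a b y) - θ * x :=
    (intervalIntegral.continuous_primitive
      (hi (measurable_glue ha hb) (abs_glue_le hKa hKb)) z).sub (by fun_prop)
  set K' := max (-∫ y in (0 : ℝ)..z, a y) (-∫ y in (0 : ℝ)..z, b y) with hK'
  obtain ⟨c, hc⟩ := exists_forall_le_of_eventually_le hcont (K := K') (by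
      filter_upwards [htb.eventually (gt_mem_nhds h1), eventually_gt_atTop 0,
        eventually_ge_atTop z] with x e1 e2 e3
      rw [div_lt_iff₀ e2] at e1
      rw [integral_glue_of_ge e3, ← intervalIntegral.integral_interval_sub_left
        (hi hb hKb 0 x) (hi hb hKb 0 z)]
      linarith [le_max_right (-∫ y in (0 : ℝ)..z, a y) (-∫ y in (0 : ℝ)..z, b y)]) (by
      filter_upwards [hta.eventually (lt_mem_nhds h2), eventually_lt_atBot 0,
        eventually_le_atBot z] with x e1 e2 e3
      rw [lt_div_iff_of_neg e2] at e1
      rw [integral_glue_of_le e3, ← intervalIntegral.integral_interval_sub_left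
        (hi ha hKa 0 x) (hi ha hKa 0 z)]
      linarith [le_max_left (-∫ y in (0 : ℝ)..z, a y) (-∫ y in (0 : ℝ)..z, b y)])
  exact ⟨c, fun x => by linarith [hc x]⟩

lemma exists_le_integral_glue {a b : ℝ → ℝ} (ha : Measurable a) (hb : Measurable b) {K : ℝ}
    (hKa : ∀ x, |a x| ≤ K) (hKb : ∀ x, |b x| ≤ K) (z : ℝ) {θ θa θb : ℝ}
    (hta : Tendsto (fun x => (∫ y in (0 : ℝ)..x, a y) / x) atBot (𝓝 θa))
    (htb : Tendsto (fun x => (∫ y in (0 : ℝ)..x, b y) / x) atTop (𝓝 θb))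
    (h1 : θ < θb) (h2 : θa < θ) :
    ∃ c, ∀ x, θ * x - c ≤ ∫ y in z..x, glue z a b y := by
  have hneg : ∀ x, glue z (fun y => -a y) (fun y => -b y) x = -glue z a b x := fun x => by
    rcases lt_or_ge x z with h | h
    · rw [glue_of_lt h, glue_of_lt h]
    · rw [glue_of_le h, glue_of_le h]
  obtain ⟨c, hc⟩ := exists_integral_glue_le ha.neg hb.neg (K := K) (fun x => by simpa using hKa x)
    (fun x => by simpa using hKb x) z (θ := -θ) (θa := -θa) (θb := -θb)
    (by simpa [intervalIntegral.integral_neg, neg_div] using hta.neg)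
    (by simpa [intervalIntegral.integral_neg, neg_div] using htb.neg)
    (neg_lt_neg h1) (neg_lt_neg h2)
  refine ⟨c, fun x => ?_⟩
  have := hc x
  simp only [Pi.neg_def, hneg, intervalIntegral.integral_neg] at this
  linarith

lemma measurable_phaseSlope_path {G W : ℝ → ℝ} {m M pm pM : ℝ} (hG : IsDoubleWell G m M pm pM)
    (hW : Continuous W) (hW0 : ∀ s, 0 ≤ W s) : Measurable (phaseSlope G m M pm pM W) :=
  (measurable_phaseSlope (Ω := Unit) hG (W := fun _ => W) (fun _ => hW)
    (hW.measurable.comp measurable_fst) (fun _ => hW0)).comp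
    (measurable_prodMk_right (y := ()))

/-- The solution with initial slope `θ` decays at a rate between `l₁` and `l₂` if the correctors
at the levels `l₁ < l₂` have asymptotic slopes `θ₁ > θ` and `θ₂ < θ`. -/
theorem exists_rate_bounds {G v : ℝ → ℝ} {m M pm pM β l₁ l₂ θ θ₁ θ₂ z : ℝ}
    (hG : IsDoubleWell G m M pm pM) (hβ : 0 ≤ β) (hv : UniformContinuous v)
    (hv01 : ∀ x, v x ∈ Icc 0 1) (hl₁ : β ≤ l₁) (hMl₁ : M ≤ l₁) (hl : l₁ < l₂)
    (hz : l₂ - β * v z < m) (h1 : θ < θ₁) (h2 : θ₂ < θ)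
    (t1 : Tendsto (fun x => (∫ y in (0 : ℝ)..x, phaseSlope G m M pm pM
      (fun s => l₁ - β * v s) y) / x) atTop (𝓝 θ₁))
    (b1 : Tendsto (fun x => (∫ y in (0 : ℝ)..x, phaseSlope G m M pm pM
      (fun s => l₁ - β * v s) y) / x) atBot (𝓝 θ₁))
    (t2 : Tendsto (fun x => (∫ y in (0 : ℝ)..x, phaseSlope G m M pm pM
      (fun s => l₂ - β * v s) y) / x) atTop (𝓝 θ₂))
    (b2 : Tendsto (fun x => (∫ y in (0 : ℝ)..x, phaseSlope G m M pm pM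
      (fun s => l₂ - β * v s) y) / x) atBot (𝓝 θ₂))
    {u : ℝ → ℝ → ℝ} (hu : IsUCViscositySolution (fun p x => G p + β * v x) (fun x => θ * x) u) :
    ∃ c, ∀ t, 0 ≤ t → l₁ * t - c ≤ -u t 0 ∧ -u t 0 ≤ l₂ * t + c := by
  set W₁ : ℝ → ℝ := fun s => l₁ - β * v s with hW₁
  set W₂ : ℝ → ℝ := fun s => l₂ - β * v s with hW₂
  have c₁ : Continuous W₁ := continuous_const.sub (continuous_const.mul hv.continuous)
  have c₂ : Continuous W₂ := continuous_const.sub (continuous_const.mul hv.continuous)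
  have hβv : ∀ s, 0 ≤ β * v s ∧ β * v s ≤ β := fun s =>
    ⟨mul_nonneg hβ (hv01 s).1, mul_le_of_le_one_right hβ (hv01 s).2⟩
  have p₁ : ∀ s, 0 ≤ W₁ s := fun s => by simp only [hW₁]; linarith [(hβv s).2]
  have p₂ : ∀ s, 0 ≤ W₂ s := fun s => by simp only [hW₂]; linarith [(hβv s).2]
  have q₁ : ∀ s, W₁ s ≤ l₂ := fun s => by simp only [hW₁]; linarith [(hβv s).1]
  have q₂ : ∀ s, W₂ s ≤ l₂ := fun s => by simp only [hW₂]; linarith [(hβv s).1]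
  have hW₁₂ : ∀ s, W₁ s < W₂ s := fun s => by simp only [hW₁, hW₂]; linarith
  set s₁ := phaseSlope G m M pm pM W₁ with hs₁
  set s₂ := phaseSlope G m M pm pM W₂ with hs₂
  have m₁ : Measurable s₁ := measurable_phaseSlope_path hG c₁ p₁
  have m₂ : Measurable s₂ := measurable_phaseSlope_path hG c₂ p₂
  have hMl₂ : M ≤ l₂ := hMl₁.trans hl.le
  have hK : ∀ p ∈ Icc (invG₁ G pm l₂) 0, |p| ≤ -invG₁ G pm l₂ := fun p hp => by
    rw [abs_of_nonpos hp.2]; linarith [hp.1]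
  have k₁ : ∀ x, |s₁ x| ≤ -invG₁ G pm l₂ := fun x =>
    hK _ (phaseSlope_mem_Icc hG c₁ p₁ q₁ hMl₂ x)
  have k₂ : ∀ x, |s₂ x| ≤ -invG₁ G pm l₂ := fun x =>
    hK _ (phaseSlope_mem_Icc hG c₂ p₂ q₂ hMl₂ x)
  -- Near z both paths are below m, so both correctors are on the third branch, where G is
  -- decreasing, and both slopes are continuous at z.
  have hz₁ : W₁ z < m := (hW₁₂ z).trans hz
  have lim₁ : Tendsto s₁ (𝓝[≠] z) (𝓝 (invG₃ G pM (W₁ z))) :=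
    tendsto_phaseSlope_of_eventually_notMem hG c₁ p₁ nhdsWithin_le_nhds
      (nhdsWithin_le_nhds (eventually_notMem_phaseSet c₁ hz₁))
  have lim₂ : Tendsto s₂ (𝓝[≠] z) (𝓝 (invG₃ G pM (W₂ z))) :=
    tendsto_phaseSlope_of_eventually_notMem hG c₂ p₂ nhdsWithin_le_nhds
      (nhdsWithin_le_nhds (eventually_notMem_phaseSet c₂ hz))
  obtain ⟨i₁, e₁⟩ := hG.invG₃_spec ⟨p₁ z, hz₁.le.trans hG.m_lt_M.le⟩
  obtain ⟨i₂, e₂⟩ := hG.invG₃_spec ⟨p₂ z, hz.le.trans hG.m_lt_M.le⟩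
  have hF : UniformContinuous fun x => β * v x :=
    (lipschitzWith_smul β).uniformContinuous.comp hv
  have ltne : ∀ x : ℝ, 𝓝[<] x ≤ 𝓝[≠] x := fun x => nhdsWithin_mono _ fun y hy => ne_of_lt hy
  have gtne : ∀ x : ℝ, 𝓝[>] x ≤ 𝓝[≠] x := fun x => nhdsWithin_mono _ fun y hy => ne_of_gt hy
  obtain ⟨c, hc⟩ := exists_integral_glue_le m₁ m₂ k₁ k₂ z b1 t2 h2 h1
  obtain ⟨d, hd⟩ := exists_le_integral_glue m₂ m₁ k₂ k₁ z b2 t1 h1 h2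
  -- Level l₁ left of z, level l₂ right of it: the kink is concave, and on it G is at most its value
  -- l₂ − βv(z) at the smaller slope.
  have hsub := isViscositySub_profile (G := G) (F := fun x => β * v x) (measurable_glue m₁ m₂)
    (abs_glue_le k₁ k₂) z (-c) l₂ (exists_glue_limits
      (Q := fun x pl pr => ∀ p ∈ Icc pr pl, G p + β * v x ≤ l₂)
      (fun x _ => by
        obtain ⟨pl, pr, r1, r2, r3, r4⟩ := exists_phaseSlope_limits hG c₁ p₁ x
        refine ⟨pl, pr, r1, r2, fun p hp => ?_⟩
        have := r3 p hp
        simp only [hW₁] at this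
        linarith)
      (fun x _ => by
        obtain ⟨pl, pr, r1, r2, r3, r4⟩ := exists_phaseSlope_limits hG c₂ p₂ x
        refine ⟨pl, pr, r1, r2, fun p hp => ?_⟩
        have := r3 p hp
        simp only [hW₂] at this
        linarith)
      (lim₁.mono_left (ltne z)) (lim₂.mono_left (gtne z)) (fun p hp => by
        have := hG.anti_right.antitoneOn i₂ ⟨i₂.1.trans hp.1, hp.2.trans i₁.2⟩ hp.1
        rw [e₂] at this
        simp only [hW₂] at this
        linarith))
  -- The opposite order: the kink is convex, and on it G is at least its value l₁ − βv(z) at the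
  -- larger slope.
  have hsup := isViscositySuper_profile (G := G) (F := fun x => β * v x) (measurable_glue m₂ m₁)
    (abs_glue_le k₂ k₁) z d l₁ (exists_glue_limits
      (Q := fun x pl pr => ∀ p ∈ Icc pl pr, l₁ ≤ G p + β * v x)
      (fun x _ => by
        obtain ⟨pl, pr, r1, r2, r3, r4⟩ := exists_phaseSlope_limits hG c₂ p₂ x
        refine ⟨pl, pr, r1, r2, fun p hp => ?_⟩
        have := r4 p hp
        simp only [hW₂] at this
        linarith)
      (fun x _ => by
        obtain ⟨pl, pr, r1, r2, r3, r4⟩ := exists_phaseSlope_limits hG c₁ p₁ x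
        refine ⟨pl, pr, r1, r2, fun p hp => ?_⟩
        have := r4 p hp
        simp only [hW₁] at this
        linarith)
      (lim₂.mono_left (ltne z)) (lim₁.mono_left (gtne z)) (fun p hp => by
        have := hG.anti_right.antitoneOn ⟨i₂.1.trans hp.1, hp.2.trans i₁.2⟩ i₁ hp.2
        rw [e₁] at this
        simp only [hW₁] at this
        linarith))
  have hcomp₁ := viscosity_comparison hG.continuous hF
    (uniformContinuousOn_profile (measurable_glue m₁ m₂) (abs_glue_le k₁ k₂) z (-c) l₂)
    hu.uniformContinuousOn hsub hu.supersolution (fun x => by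
      rw [hu.initial]; linarith [hc x])
  have hcomp₂ := viscosity_comparison hG.continuous hF hu.uniformContinuousOn
    (uniformContinuousOn_profile (measurable_glue m₂ m₁) (abs_glue_le k₂ k₁) z d l₁)
    hu.subsolution hsup (fun x => by
      rw [hu.initial]; linarith [hd x])
  set A := ∫ y in z..0, glue z s₁ s₂ y with hA
  set B := ∫ y in z..0, glue z s₂ s₁ y with hB
  refine ⟨max (c - A) (B + d), fun t ht => ⟨?_, ?_⟩⟩
  · linarith [hcomp₂ t 0 ht, le_max_right (c - A) (B + d)]
  · linarith [hcomp₁ t 0 ht, le_max_left (c - A) (B + d)]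

/-! ### Identification of the effective Hamiltonian -/

section effective

variable {Ω : Type*} [MeasurableSpace Ω] {P : Measure Ω}
  {τ : ℝ → Ω → Ω} {V : ℝ → Ω → ℝ} {G : ℝ → ℝ} {m M pm pM β θ : ℝ}

theorem existsUnique_linearSolution (hV : IsPotential P τ V) (hG : IsDoubleWell G m M pm pM)
    (hβ : 0 < β) (θ : ℝ) (ω : Ω) : ∃ u : ℝ → ℝ → ℝ,
      IsUCViscositySolution (hamiltonian G β V ω) (fun x => θ * x) u ∧
      ∀ u' : ℝ → ℝ → ℝ, IsUCViscositySolution (hamiltonian G β V ω) (fun x => θ * x) u' →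
        ∀ t x : ℝ, 0 ≤ t → u' t x = u t x := by
  obtain ⟨C, hC⟩ := hV.bounded ω
  exact existsUnique_viscositySolution (F := fun x => β * V x ω) (CF := β * C) hG.continuous
    hG.coercive_top hG.coercive_bot
    ((lipschitzWith_smul β).uniformContinuous.comp (hV.uniformContinuous ω))
    (fun x => by rw [abs_mul, abs_of_pos hβ]; gcongr; exact hC x) θ

lemma linearSolution_spec (hV : IsPotential P τ V) (hG : IsDoubleWell G m M pm pM)
    (hβ : 0 < β) (θ : ℝ) (ω : Ω) :
    IsUCViscositySolution (hamiltonian G β V ω) (fun x => θ * x) (linearSolution G β V θ ω) :=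
  Classical.epsilon_spec ((existsUnique_linearSolution hV hG hβ θ ω).imp fun _ h => h.1)

variable [IsProbabilityMeasure P]

lemma ae_rate_bounds (hτ : IsErgodicGroup P τ) (hV : IsPotential P τ V)
    (hG : IsDoubleWell G m M pm pM) (hβ : 0 < β) {l₁ l₂ : ℝ} (hl₁ : β ≤ l₁) (hM : M < l₁)
    (hl : l₁ < l₂) (hl₂ : l₂ < m + β) (h1 : θ < theta13 P G m M pm pM β V l₁)
    (h2 : theta13 P G m M pm pM β V l₂ < θ) :
    ∀ᵐ ω ∂P, ∃ c, ∀ t, 0 ≤ t → l₁ * t - c ≤ -linearSolution G β V θ ω t 0 ∧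
      -linearSolution G β V θ ω t 0 ≤ l₂ * t + c := by
  have hm := hG.m_lt_M
  filter_upwards [hV.ae_mem_Icc, hV.ae_isRecurrent hτ hβ (hM.trans hl) hl₂,
    ae_slope13_eq (G := G) (pm := pm) (pM := pM) hτ hV hm hβ hM (hl.trans hl₂),
    ae_slope13_eq (G := G) (pm := pm) (pM := pM) hτ hV hm hβ (hM.trans hl) hl₂,
    ae_tendsto_corrector13 hτ hV hG hβ hl₁ hM (hl.trans hl₂),
    ae_tendsto_corrector13 hτ hV hG hβ (hl₁.trans hl.le) (hM.trans hl) hl₂]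
    with ω a1 a2 a3 a4 a5 a6
  obtain ⟨z, -, hz⟩ := a2.low_top 0
  simp only [corrector13, a3, levelSlope_flow hτ hV, clippedLevel_eq a1] at a5
  simp only [corrector13, a4, levelSlope_flow hτ hV, clippedLevel_eq a1] at a6
  exact exists_rate_bounds (v := fun x => V x ω) hG hβ.le (hV.uniformContinuous ω) a1 hl₁ hM.le hl
    hz h1 h2 a5.1 a5.2 a6.1 a6.2 (linearSolution_spec hV hG hβ θ ω)

lemma tendsto_div_of_linear_bounds {f : ℝ → ℝ} {L : ℝ} {A B : ℝ} (hA : A < L) (hB : L < B)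
    (hlow : ∀ a : ℚ, A < a → (a : ℝ) < L → ∃ c, ∀ t, 0 ≤ t → a * t - c ≤ f t)
    (hupp : ∀ b : ℚ, L < b → (b : ℝ) < B → ∃ c, ∀ t, 0 ≤ t → f t ≤ b * t + c) :
    Tendsto (fun t => f t / t) atTop (𝓝 L) := by
  have hdiv : ∀ c : ℝ, Tendsto (fun t : ℝ => c / t) atTop (𝓝 0) := fun c =>
    tendsto_const_nhds.div_atTop tendsto_id
  rw [tendsto_order]
  constructor
  · intro p hp
    obtain ⟨a, ha1, ha2⟩ := exists_rat_btwn (max_lt hA hp)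
    rw [max_lt_iff] at ha1
    obtain ⟨c, hc⟩ := hlow a ha1.1 ha2
    filter_upwards [(hdiv c).eventually (gt_mem_nhds (sub_pos.2 ha1.2)), eventually_gt_atTop 0]
      with t h1 h2
    rw [div_lt_iff₀ h2] at h1
    rw [lt_div_iff₀ h2]
    linarith [hc t h2.le]
  · intro p hp
    obtain ⟨b, hb1, hb2⟩ := exists_rat_btwn (lt_min hB hp)
    rw [lt_min_iff] at hb2
    obtain ⟨c, hc⟩ := hupp b hb1 hb2.1
    filter_upwards [(hdiv c).eventually (gt_mem_nhds (sub_pos.2 hb2.2)), eventually_gt_atTop 0]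
      with t h1 h2
    rw [div_lt_iff₀ h2] at h1
    rw [div_lt_iff₀ h2]
    linarith [hc t h2.le]

/-- By monotonicity the left limit at m + β is the infimum over the interval, so θ above it exceeds
some value. -/
lemma exists_theta13_lt (hτ : IsErgodicGroup P τ) (hV : IsPotential P τ V)
    (hG : IsDoubleWell G m M pm pM) (hβ : 0 < β) (hmax : max β M < m + β)
    (hθ : theta13Bot P G m M pm pM β V < θ) :
    ∃ lam ∈ Ioo (max β M) (m + β), theta13 P G m M pm pM β V lam < θ := by
  by_contra! hcon
  have hanti : AntitoneOn (theta13 P G m M pm pM β V) (Ioo (max β M) (m + β)) :=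
    (strictAntiOn_theta13 hτ hV hG hβ).antitoneOn.mono fun l hl =>
      ⟨(le_max_left _ _).trans hl.1.le, (le_max_right _ _).trans_lt hl.1, hl.2⟩
  have hne : (Ioo (max β M) (m + β)).Nonempty := nonempty_Ioo.2 hmax
  have hbdd : θ ∈ lowerBounds (theta13 P G m M pm pM β V '' Ioo (max β M) (m + β)) := by
    rintro _ ⟨l, hl, rfl⟩
    exact hcon l hl
  have hlim := hanti.tendsto_nhdsWithin_Ioo_left hne ⟨θ, hbdd⟩
  rw [theta13Bot, leftLim_eq_of_tendsto hlim] at hθ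
  exact (le_csInf (hne.image _) hbdd).not_gt hθ

lemma exists_lt_theta13 (hτ : IsErgodicGroup P τ) (hV : IsPotential P τ V)
    (hG : IsDoubleWell G m M pm pM) (hβ : 0 < β) (hmax : max β M < m + β)
    (hθ : θ < theta13Top P G m M pm pM β V) :
    ∃ lam ∈ Ioo (max β M) (m + β), θ < theta13 P G m M pm pM β V lam := by
  by_contra! hcon
  have hanti : AntitoneOn (theta13 P G m M pm pM β V) (Ioo (max β M) (m + β)) :=
    (strictAntiOn_theta13 hτ hV hG hβ).antitoneOn.mono fun l hl =>
      ⟨(le_max_left _ _).trans hl.1.le, (le_max_right _ _).trans_lt hl.1, hl.2⟩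
  have hne : (Ioo (max β M) (m + β)).Nonempty := nonempty_Ioo.2 hmax
  have hbdd : θ ∈ upperBounds (theta13 P G m M pm pM β V '' Ioo (max β M) (m + β)) := by
    rintro _ ⟨l, hl, rfl⟩
    exact hcon l hl
  have hlim := hanti.tendsto_nhdsWithin_Ioo_right hne ⟨θ, hbdd⟩
  rw [theta13Top, rightLim_eq_of_tendsto hlim] at hθ
  exact (csSup_le (hne.image _) hbdd).not_gt hθ

/-- Position of the level `Lambda13` with respect to the mean slopes. -/
lemma Lambda13_spec (hτ : IsErgodicGroup P τ) (hV : IsPotential P τ V)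
    (hG : IsDoubleWell G m M pm pM) (hβ : 0 < β) (hmax : max β M < m + β)
    (hθ : θ ∈ Ioo (theta13Bot P G m M pm pM β V) (theta13Top P G m M pm pM β V)) :
    Lambda13 P G m M pm pM β V θ ∈ Ioo (max β M) (m + β) ∧
    (∀ l ∈ Ioo (max β M) (m + β), l < Lambda13 P G m M pm pM β V θ →
      θ < theta13 P G m M pm pM β V l) ∧
    (∀ l ∈ Ioo (max β M) (m + β), Lambda13 P G m M pm pM β V θ < l →
      theta13 P G m M pm pM β V l < θ) := by
  have hanti : StrictAntiOn (theta13 P G m M pm pM β V) (Ioo (max β M) (m + β)) :=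
    (strictAntiOn_theta13 hτ hV hG hβ).mono fun l hl =>
      ⟨(le_max_left _ _).trans hl.1.le, (le_max_right _ _).trans_lt hl.1, hl.2⟩
  have hbdd : BddBelow {lam | lam ∈ Ioo (max β M) (m + β) ∧ theta13 P G m M pm pM β V lam ≤ θ} :=
    ⟨max β M, fun l hl => hl.1.1.le⟩
  obtain ⟨a, ha, haθ⟩ := exists_lt_theta13 hτ hV hG hβ hmax hθ.2
  obtain ⟨b, hb, hbθ⟩ := exists_theta13_lt hτ hV hG hβ hmax hθ.1
  have hage : a ≤ Lambda13 P G m M pm pM β V θ := by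
    refine le_csInf ⟨b, hb, hbθ.le⟩ fun l hl => ?_
    by_contra! hlt
    exact ((hanti hl.1 ha hlt).trans_le hl.2).not_gt haθ
  refine ⟨⟨ha.1.trans_le hage, (csInf_le hbdd ⟨hb, hbθ.le⟩).trans_lt hb.2⟩, ?_, ?_⟩
  · intro l hl hlt
    by_contra! hle
    exact (csInf_le hbdd ⟨hl, hle⟩).not_gt hlt
  · intro l hl hlt
    obtain ⟨l', hl', hlt'⟩ := exists_lt_of_csInf_lt
      (s := {lam | lam ∈ Ioo (max β M) (m + β) ∧ theta13 P G m M pm pM β V lam ≤ θ})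
      ⟨b, hb, hbθ.le⟩ hlt
    exact (hanti hl'.1 hl hlt').trans_le hl'.2

/-- Jumps of the mean slope are harmless: only its strict comparison with θ at levels other than
`Lambda13` is used, and such levels exist arbitrarily close on both sides. -/
theorem ae_tendsto_rate (hτ : IsErgodicGroup P τ) (hV : IsPotential P τ V)
    (hG : IsDoubleWell G m M pm pM) (hβ : 0 < β) (hmax : max β M < m + β)
    (hθ : θ ∈ Ioo (theta13Bot P G m M pm pM β V) (theta13Top P G m M pm pM β V)) :
    ∀ᵐ ω ∂P, Tendsto (fun t : ℝ => -linearSolution G β V θ ω t 0 / t) atTop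
      (𝓝 (Lambda13 P G m M pm pM β V θ)) := by
  obtain ⟨hL, hlo, hup⟩ := Lambda13_spec hτ hV hG hβ hmax hθ
  set L := Lambda13 P G m M pm pM β V θ with hLdef
  obtain ⟨a₀, ha₀, ha₀L⟩ := exists_between hL.1
  obtain ⟨b₀, hb₀L, hb₀⟩ := exists_between hL.2
  have key : ∀ a b : ℝ, max β M < a → a < L → L < b → b < m + β →
      ∀ᵐ ω ∂P, ∃ c, ∀ t, 0 ≤ t → a * t - c ≤ -linearSolution G β V θ ω t 0 ∧
        -linearSolution G β V θ ω t 0 ≤ b * t + c := fun a b h1 h2 h3 h4 =>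
    ae_rate_bounds hτ hV hG hβ ((le_max_left _ _).trans h1.le) ((le_max_right _ _).trans_lt h1)
      (h2.trans h3) h4 (hlo a ⟨h1, h2.trans (h3.trans h4)⟩ h2)
      (hup b ⟨h1.trans (h2.trans h3), h4⟩ h3)
  -- Rational levels suffice, so only countably many null sets are discarded.
  have k1 : ∀ᵐ ω ∂P, ∀ a : ℚ, max β M < a → (a : ℝ) < L →
      ∃ c, ∀ t, 0 ≤ t → a * t - c ≤ -linearSolution G β V θ ω t 0 := by
    refine ae_all_iff.2 fun a => ?_
    by_cases h : max β M < a ∧ (a : ℝ) < L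
    · filter_upwards [key a b₀ h.1 h.2 hb₀L hb₀] with ω ⟨c, hc⟩ _ _
      exact ⟨c, fun t ht => (hc t ht).1⟩
    · exact ae_of_all _ fun ω h1 h2 => absurd ⟨h1, h2⟩ h
  have k2 : ∀ᵐ ω ∂P, ∀ b : ℚ, L < b → (b : ℝ) < m + β →
      ∃ c, ∀ t, 0 ≤ t → -linearSolution G β V θ ω t 0 ≤ b * t + c := by
    refine ae_all_iff.2 fun b => ?_
    by_cases h : L < b ∧ (b : ℝ) < m + β
    · filter_upwards [key a₀ b ha₀ ha₀L h.1 h.2] with ω ⟨c, hc⟩ _ _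
      exact ⟨c, fun t ht => (hc t ht).2⟩
    · exact ae_of_all _ fun ω h1 h2 => absurd ⟨h1, h2⟩ h
  filter_upwards [k1, k2] with ω h1 h2
  exact tendsto_div_of_linear_bounds hL.1 hL.2 h1 h2

/-- Two almost sure values agree somewhere because P is nonzero, so the choice made by epsilon is
forced. -/
lemma essValue_eq {X : Ω → ℝ} {c : ℝ} (h : ∀ᵐ ω ∂P, X ω = c) : essValue P X = c := by
  have h1 : ∀ᵐ ω ∂P, X ω = essValue P X :=
    Classical.epsilon_spec (p := fun c : ℝ => ∀ᵐ ω ∂P, X ω = c) ⟨c, h⟩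
  obtain ⟨ω, h2, h3⟩ := (h1.and h).exists
  exact h2.symm.trans h3

theorem effective_eq_Lambda13 (hτ : IsErgodicGroup P τ) (hV : IsPotential P τ V)
    (hG : IsDoubleWell G m M pm pM) (hβ : 0 < β) (hmax : max β M < m + β)
    (hθ : θ ∈ Ioo (theta13Bot P G m M pm pM β V) (theta13Top P G m M pm pM β V)) :
    (∀ᵐ ω ∂P, lowerRate G β V θ ω = effectiveL P G β V θ) ∧
    (∀ᵐ ω ∂P, upperRate G β V θ ω = effectiveU P G β V θ) ∧
    effectiveL P G β V θ = Lambda13 P G m M pm pM β V θ ∧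
    effectiveU P G β V θ = Lambda13 P G m M pm pM β V θ ∧
    effective P G β V θ = Lambda13 P G m M pm pM β V θ := by
  have h := ae_tendsto_rate hτ hV hG hβ hmax hθ
  have hL : ∀ᵐ ω ∂P, lowerRate G β V θ ω = Lambda13 P G m M pm pM β V θ :=
    h.mono fun ω hω => hω.liminf_eq
  have hU : ∀ᵐ ω ∂P, upperRate G β V θ ω = Lambda13 P G m M pm pM β V θ :=
    h.mono fun ω hω => hω.limsup_eq
  have eL : effectiveL P G β V θ = Lambda13 P G m M pm pM β V θ := essValue_eq hL
  have eU : effectiveU P G β V θ = Lambda13 P G m M pm pM β V θ := essValue_eq hU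
  refine ⟨by rwa [eL], by rwa [eU], eL, eU, ?_⟩
  rw [effective, if_pos (eL.trans eU.symm), eL]

end effective

end

/-! ### The theorem -/

theorem theorem6p7 {Ω : Type*} [MeasurableSpace Ω] (P : Measure Ω) [IsProbabilityMeasure P]
    (τ : ℝ → Ω → Ω) (hτ : IsErgodicGroup P τ)
    (V : ℝ → Ω → ℝ) (hV : IsPotential P τ V)
    (G : ℝ → ℝ) (m M pm pM : ℝ) (hG : IsDoubleWell G m M pm pM)
    (β : ℝ) (hβ : 0 < β) (hmax : max β M < m + β) :
    -- the solutions that enter the definition of the effective Hamiltonian exist and are unique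
    (∀ (θ : ℝ) (ω : Ω), ∃ u : ℝ → ℝ → ℝ,
      IsUCViscositySolution (hamiltonian G β V ω) (fun x => θ * x) u ∧
      ∀ u' : ℝ → ℝ → ℝ, IsUCViscositySolution (hamiltonian G β V ω) (fun x => θ * x) u' →
        ∀ t x : ℝ, 0 ≤ t → u' t x = u t x) ∧
    -- `theta13` is the asymptotic slope of the correctors, decreasing and right-continuous
    (∀ lam ∈ Ici β ∩ Ioo M (m + β), ∀ᵐ ω ∂P,
      Tendsto (fun x => corrector13 G m M pm pM β V lam ω x / x) atTop
        (𝓝 (theta13 P G m M pm pM β V lam)) ∧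
      Tendsto (fun x => corrector13 G m M pm pM β V lam ω x / x) atBot
        (𝓝 (theta13 P G m M pm pM β V lam))) ∧
    StrictAntiOn (theta13 P G m M pm pM β V) (Ici β ∩ Ioo M (m + β)) ∧
    (∀ lam ∈ Ici β ∩ Ioo M (m + β),
      ContinuousWithinAt (theta13 P G m M pm pM β V) (Ici lam) lam) ∧
    -- the effective Hamiltonian is `Lambda13` on the interval
    (∀ θ ∈ Ioo (theta13Bot P G m M pm pM β V) (theta13Top P G m M pm pM β V),
      (∀ᵐ ω ∂P, lowerRate G β V θ ω = effectiveL P G β V θ) ∧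
      (∀ᵐ ω ∂P, upperRate G β V θ ω = effectiveU P G β V θ) ∧
      effectiveL P G β V θ = Lambda13 P G m M pm pM β V θ ∧
      effectiveU P G β V θ = Lambda13 P G m M pm pM β V θ ∧
      effective P G β V θ = Lambda13 P G m M pm pM β V θ) ∧
    AntitoneOn (effective P G β V)
      (Ioo (theta13Bot P G m M pm pM β V) (theta13Top P G m M pm pM β V)) := by
  refine ⟨fun θ ω => existsUnique_linearSolution hV hG hβ θ ω, fun lam hlam =>
    ae_tendsto_corrector13 hτ hV hG hβ hlam.1 hlam.2.1 hlam.2.2,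
    strictAntiOn_theta13 hτ hV hG hβ, fun lam hlam =>
    continuousWithinAt_theta13 hτ hV hG hβ hlam.1 hlam.2.1 hlam.2.2,
    fun θ hθ => effective_eq_Lambda13 hτ hV hG hβ hmax hθ, fun θ₁ hθ₁ θ₂ hθ₂ hle => ?_⟩
  rw [(effective_eq_Lambda13 hτ hV hG hβ hmax hθ₁).2.2.2.2,
    (effective_eq_Lambda13 hτ hV hG hβ hmax hθ₂).2.2.2.2]
  -- A larger θ enlarges the set whose infimum is `Lambda13`; nonemptiness for the smaller θ is
  -- needed since `sInf ∅` is 0.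
  obtain ⟨lam, hlam, hlt⟩ := exists_theta13_lt hτ hV hG hβ hmax hθ₁.1
  exact csInf_le_csInf ⟨max β M, fun l hl => hl.1.1.le⟩ ⟨lam, hlam, hlt.le⟩
    fun l hl => ⟨hl.1, hl.2.trans hle⟩
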